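/- Notation. Let $d,r$ be non-negative integers. For $f\in L^2(\mathbb R^d)$ let $\hat f$ be the Fourier transform, normalized by $\hat f(\xi)=\int f(x)e^{-2\pi i x\cdot\xi}\,dx$ for $f\in L^1\cap L^2$. For $z\in\mathbb Z^d$ and an invertible real $d\times d$ matrix $A$ define operators on $L^2(\mathbb R^d)$ by $$(T_zf)(x)=f(x-z),\qquad (D_Af)(x)=\sqrt{|\det A|}\,f(Ax),\qquad (\widetilde D_Af)(x)=|\det A|\,f(Ax),$$ and let $\overline T_z,\overline D_A,\overline{\widetilde D}_A$ be the operators on the Hilbert direct sum $L^2(\mathbb R^d)^r=L^2(\mathbb R^d)\oplus\cdots\oplus L^2(\mathbb R^d)$ ($r$ summands) that act by $T_z,D_A,\widetilde D_A$, respectively, in each summand. $A^*$ is the transpose of $A$. The matrix $A$ is expansive if all its (complex) eigenvalues have modulus strictly greater than $1$, and integral if all its entries are integers. A family $(x_j)_{j\in J}$ in a Hilbert space $H$ is a Bessel sequence if there is a constant $C$ with $\sum_j|\langle v,x_j\rangle|^2\le C\|v\|^2$ for all $v\in H$, and a Parseval frame for $H$ if $\sum_j|\langle v,x_j\rangle|^2=\|v\|^2$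 for all $v\in H$. All systems below are regarded as families indexed by $(n,z)\in\mathbb Z\times\mathbb Z^d$. Theorem. Let $A$ be an expansive integral $d\times d$ matrix and let $\psi_1,\dots,\psi_r\in L^2(\mathbb R^d)$ be such that for each $i$ the affine system $\mathcal U_A(\psi_i)=\{D_A^nT_z\psi_i : n\in\mathbb Z,\ z\in\mathbb Z^d\}$ is a Bessel sequence in $L^2(\mathbb R^d)$. Put $\Psi=\psi_1\oplus\cdots\oplus\psi_r\in L^2(\mathbb R^d)^r$. The following are equivalent: 1. the affine system $\{\overline D_A^{\,n}\,\overline T_z\Psi : n\in\mathbb Z,\ z\in\mathbb Z^d\}$ is a Parseval frame for $L^2(\mathbb R^d)^r$; 2. the quasi-affine system $\{\overline D_A^{\,n}\,\overline T_z\Psi : n\ge 0,\ z\in\mathbb Z^d\}\cup\{\overline T_z\,\overline{\widetilde D}_A^{\,n}\Psi : n<0,\ z\in\mathbb Z^d\}$ is a Parseval frame for $L^2(\mathbb R^d)^r$; 3. both of the following hold (with the series convergent for a.e. $\xi$): (a) for all $i,j\in\{1,\dots,r\}$, $\displaystyle\sum_{n\in\mathbb Z}\hat\psi_i(A^{*n}\xi)\,\overline{\hat\psi_j(A^{*n}\xi)}=\delta_{i,j}$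 for a.e. $\xi\in\mathbb R^d$; (b) for all $i,j\in\{1,\dots,r\}$ and all $k\in\mathbb Z^d\setminus A^*\mathbb Z^d$, $\displaystyle\sum_{n=0}^{\infty}\hat\psi_i(A^{*n}\xi)\,\overline{\hat\psi_j(A^{*n}(\xi+k))}=0$ for a.e. $\xi\in\mathbb R^d$. -/

import Mathlib

open MeasureTheory
open scoped FourierTransform ComplexConjugate ENNReal

noncomputable section

namespace SuperWavelet

/-- Euclidean space `ℝ^d`. -/
abbrev E (d : ℕ) : Type := EuclideanSpace ℝ (Fin d)

/-- The complex Hilbert space `L²(ℝ^d)` (Lebesgue measure). -/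
abbrev L2 (d : ℕ) : Type := Lp (α := E d) ℂ 2 (volume : Measure (E d))

/-- The `r`-fold Hilbert direct sum `L²(ℝ^d)^r`. -/
abbrev L2Sum (d r : ℕ) : Type := PiLp 2 (fun _ : Fin r => L2 d)

/-- The integer vector `z ∈ ℤ^d`, viewed as a point of `ℝ^d`. -/
def latticePt {d : ℕ} (z : Fin d → ℤ) : E d := WithLp.toLp 2 (fun i => (z i : ℝ))

section Frames

variable {H : Type*} [NormedAddCommGroup H] [InnerProductSpace ℂ H] {J : Type*}

/-- `(x_j)` is a Bessel sequence: for some `C`, `∑_j |⟨v, x_j⟩|² ≤ C ‖v‖²` for all `v`. -/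
def IsBessel (x : J → H) : Prop :=
  ∃ C : ℝ, ∀ v : H, Summable (fun j => ‖inner ℂ (x j) v‖ ^ 2) ∧
    ∑' j, ‖inner ℂ (x j) v‖ ^ 2 ≤ C * ‖v‖ ^ 2

/-- `(x_j)` is a Parseval frame: `∑_j |⟨v, x_j⟩|² = ‖v‖²` for all `v`. -/
def IsParsevalFrame (x : J → H) : Prop :=
  ∀ v : H, HasSum (fun j => ‖inner ℂ (x j) v‖ ^ 2) (‖v‖ ^ 2)

end Frames

section Matrices

/-- `A` is expansive: every (complex) eigenvalue of `A` has modulus strictly greater than `1`. -/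
def IsExpansive {d : ℕ} (A : Matrix (Fin d) (Fin d) ℝ) : Prop :=
  ∀ μ : ℂ, Module.End.HasEigenvalue (Matrix.toLin' (A.map ((↑) : ℝ → ℂ))) μ → 1 < ‖μ‖

/-- `A` is integral: all its entries are integers. -/
def IsIntegralMatrix {d : ℕ} (A : Matrix (Fin d) (Fin d) ℝ) : Prop :=
  ∀ i j, ∃ m : ℤ, A i j = m

/-- An expansive matrix is invertible, so letting the dilation matrices range over
`GL (Fin d) ℝ` does not exclude any expansive matrix. -/
theorem IsExpansive.isUnit {d : ℕ} {A : Matrix (Fin d) (Fin d) ℝ} (hA : IsExpansive A) :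
    IsUnit A := by
  rw [Matrix.isUnit_iff_isUnit_det, isUnit_iff_ne_zero]
  intro h0
  have h1 : (A.map ((↑) : ℝ → ℂ)).det = 0 := by
    have := RingHom.map_det Complex.ofRealHom A
    rw [h0, map_zero] at this
    exact this.symm
  obtain ⟨v, hv, hv0⟩ := Matrix.exists_mulVec_eq_zero_iff.mpr h1
  have h2 : Module.End.HasEigenvalue (Matrix.toLin' (A.map ((↑) : ℝ → ℂ))) 0 := by
    refine Module.End.hasEigenvalue_of_hasEigenvector (x := v) ⟨?_, hv⟩
    rw [Module.End.mem_eigenspace_iff, zero_smul, Matrix.toLin'_apply, hv0]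
  have := hA 0 h2
  simp at this
  linarith

end Matrices

section Operators

variable {d : ℕ}

/-- The unitary translation operator `(T_α f)(x) = f(x - α)` on `L²(ℝ^d)`. -/
def translation (α : E d) : L2 d ≃ₗᵢ[ℂ] L2 d where
  toFun := Lp.compMeasurePreserving (fun x => x - α) (measurePreserving_sub_right volume α)
  invFun := Lp.compMeasurePreserving (fun x => x + α) (measurePreserving_add_right volume α)
  map_add' := map_add _
  map_smul' c f := by
    ext1
    filter_upwards [Lp.coeFn_compMeasurePreserving (c • f)
      (measurePreserving_sub_right volume α),
      Lp.coeFn_compMeasurePreserving f (measurePreserving_sub_right volume α),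
      Lp.coeFn_smul c (Lp.compMeasurePreserving (fun x => x - α)
        (measurePreserving_sub_right volume α) f),
      (measurePreserving_sub_right volume α).quasiMeasurePreserving.ae (Lp.coeFn_smul c f)]
      with x h1 h2 h3 h4
    simp only [RingHom.id_apply]
    rw [h1, h3, Pi.smul_apply, h2]
    exact h4
  left_inv f := by
    ext1
    filter_upwards [Lp.coeFn_compMeasurePreserving (Lp.compMeasurePreserving (fun x => x - α)
        (measurePreserving_sub_right volume α) f) (measurePreserving_add_right volume α),
      (measurePreserving_add_right volume α).quasiMeasurePreserving.ae
        (Lp.coeFn_compMeasurePreserving f (measurePreserving_sub_right volume α))]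
      with x h1 h2
    rw [h1, Function.comp_apply, h2]
    simp
  right_inv f := by
    ext1
    filter_upwards [Lp.coeFn_compMeasurePreserving (Lp.compMeasurePreserving (fun x => x + α)
        (measurePreserving_add_right volume α) f) (measurePreserving_sub_right volume α),
      (measurePreserving_sub_right volume α).quasiMeasurePreserving.ae
        (Lp.coeFn_compMeasurePreserving f (measurePreserving_add_right volume α))]
      with x h1 h2
    rw [h1, Function.comp_apply, h2]
    simp
  norm_map' f := Lp.norm_compMeasurePreserving f (measurePreserving_sub_right volume α)

theorem coeFn_translation (α : E d) (f : L2 d) :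
    translation α f =ᵐ[volume] fun x => f (x - α) :=
  Lp.coeFn_compMeasurePreserving f (measurePreserving_sub_right volume α)

theorem det_toEuclideanLin (M : Matrix (Fin d) (Fin d) ℝ) :
    LinearMap.det (Matrix.toEuclideanLin M) = M.det := by
  change LinearMap.det (Matrix.toLpLin 2 2 M) = M.det
  rw [Matrix.toLpLin_eq_toLin, LinearMap.det_toLin]

theorem det_toEuclideanLin_ne_zero (A : GL (Fin d) ℝ) :
    LinearMap.det (Matrix.toEuclideanLin (A : Matrix (Fin d) (Fin d) ℝ)) ≠ 0 := by
  rw [det_toEuclideanLin]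
  exact ((Matrix.isUnit_iff_isUnit_det _).mp A.isUnit).ne_zero

theorem quasiMeasurePreserving_matrix (A : GL (Fin d) ℝ) :
    Measure.QuasiMeasurePreserving
      (Matrix.toEuclideanLin (A : Matrix (Fin d) (Fin d) ℝ) : E d → E d) volume volume := by
  refine ⟨(LinearMap.continuous_of_finiteDimensional _).measurable, ?_⟩
  rw [Measure.map_linearMap_addHaar_eq_smul_addHaar _ (det_toEuclideanLin_ne_zero A)]
  exact Measure.smul_absolutelyContinuous

theorem eLpNorm_comp_matrix (A : GL (Fin d) ℝ) (f : L2 d) :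
    eLpNorm (fun x : E d => ((√|(A : Matrix (Fin d) (Fin d) ℝ).det| : ℝ) : ℂ) *
      f (Matrix.toEuclideanLin (A : Matrix (Fin d) (Fin d) ℝ) x)) 2 volume
      = eLpNorm f 2 volume := by
  have hdet := det_toEuclideanLin_ne_zero A
  set L := Matrix.toEuclideanLin (A : Matrix (Fin d) (Fin d) ℝ) with hL
  have hcont : Continuous L := L.continuous_of_finiteDimensional
  have hmap := Measure.map_linearMap_addHaar_eq_smul_addHaar (volume : Measure (E d)) hdet
  have hf : AEStronglyMeasurable f (Measure.map L volume) := by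
    rw [hmap]
    exact (Lp.aestronglyMeasurable f).smul_measure _
  have h1 : eLpNorm (fun x : E d => f (L x)) 2 volume
      = eLpNorm f 2 (Measure.map L volume) :=
    (eLpNorm_map_measure hf hcont.measurable.aemeasurable).symm
  have h2 : (fun x : E d => ((√|(A : Matrix (Fin d) (Fin d) ℝ).det| : ℝ) : ℂ) * f (L x))
      = ((√|(A : Matrix (Fin d) (Fin d) ℝ).det| : ℝ) : ℂ) • (fun x : E d => f (L x)) := rfl
  rw [h2, eLpNorm_const_smul, h1, hmap,
    eLpNorm_smul_measure_of_ne_top (by simp), smul_eq_mul, ← mul_assoc]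
  have hpos : 0 < |LinearMap.det L| := abs_pos.mpr hdet
  have h3 : ‖((√|(A : Matrix (Fin d) (Fin d) ℝ).det| : ℝ) : ℂ)‖ₑ
      * ENNReal.ofReal |(LinearMap.det L)⁻¹| ^ (1 / (2 : ℝ≥0∞)).toReal = 1 := by
    rw [← det_toEuclideanLin, ← hL]
    have : ‖((√|LinearMap.det L| : ℝ) : ℂ)‖ₑ = ENNReal.ofReal (√|LinearMap.det L|) := by
      rw [← ofReal_norm, Complex.norm_real, Real.norm_of_nonneg (Real.sqrt_nonneg _)]
    rw [this, ENNReal.ofReal_rpow_of_nonneg (abs_nonneg _) (by simp),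
      ← ENNReal.ofReal_mul (Real.sqrt_nonneg _)]
    have h4 : (1 / (2 : ℝ≥0∞)).toReal = 1 / 2 := by simp
    rw [h4, ← Real.sqrt_eq_rpow, abs_inv, Real.sqrt_inv, mul_inv_cancel₀, ENNReal.ofReal_one]
    exact (Real.sqrt_pos.mpr hpos).ne'
  rw [h3, one_mul]

theorem memLp_dilation (A : GL (Fin d) ℝ) (f : L2 d) :
    MemLp (fun x : E d => ((√|(A : Matrix (Fin d) (Fin d) ℝ).det| : ℝ) : ℂ) *
      f (Matrix.toEuclideanLin (A : Matrix (Fin d) (Fin d) ℝ) x)) 2 volume := by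
  refine ⟨?_, ?_⟩
  · exact ((Lp.aestronglyMeasurable f).comp_quasiMeasurePreserving
      (quasiMeasurePreserving_matrix A)).const_mul _
  · rw [eLpNorm_comp_matrix]
    exact Lp.eLpNorm_lt_top f

/-- The function underlying the dilation operator: `f ↦ √|det A| · f(A ·)`. -/
def dilationFun (A : GL (Fin d) ℝ) (f : L2 d) : L2 d := (memLp_dilation A f).toLp _

theorem coeFn_dilationFun (A : GL (Fin d) ℝ) (f : L2 d) :
    dilationFun A f =ᵐ[volume] fun x => ((√|(A : Matrix (Fin d) (Fin d) ℝ).det| : ℝ) : ℂ) *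
      f (Matrix.toEuclideanLin (A : Matrix (Fin d) (Fin d) ℝ) x) :=
  (memLp_dilation A f).coeFn_toLp

theorem ae_comp_matrix (A : GL (Fin d) ℝ) {p : E d → Prop} (hp : ∀ᵐ x, p x) :
    ∀ᵐ x, p (Matrix.toEuclideanLin (A : Matrix (Fin d) (Fin d) ℝ) x) :=
  (quasiMeasurePreserving_matrix A).ae hp

theorem dilationFun_inv (A B : GL (Fin d) ℝ) (hAB : A * B = 1) (f : L2 d) :
    dilationFun B (dilationFun A f) = f := by
  have hmul : (A : Matrix (Fin d) (Fin d) ℝ) * (B : Matrix (Fin d) (Fin d) ℝ) = 1 := by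
    rw [← Units.val_mul, hAB, Units.val_one]
  ext1
  filter_upwards [coeFn_dilationFun B (dilationFun A f),
    ae_comp_matrix B (coeFn_dilationFun A f)] with x h1 h2
  rw [h1, h2, ← mul_assoc, ← Complex.ofReal_mul, ← Real.sqrt_mul (abs_nonneg _), ← abs_mul,
    ← Matrix.det_mul, mul_eq_one_comm.mp hmul]
  simp [Matrix.toLpLin_apply, Matrix.mulVec_mulVec, hmul]

/-- The unitary dilation operator `(D_A f)(x) = √|det A| · f(A x)` on `L²(ℝ^d)`. -/
def dilation (A : GL (Fin d) ℝ) : L2 d ≃ₗᵢ[ℂ] L2 d where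
  toFun := dilationFun A
  invFun := dilationFun A⁻¹
  map_add' f g := by
    ext1
    filter_upwards [coeFn_dilationFun A (f + g), coeFn_dilationFun A f, coeFn_dilationFun A g,
      Lp.coeFn_add (dilationFun A f) (dilationFun A g),
      ae_comp_matrix A (Lp.coeFn_add f g)] with x h1 h2 h3 h4 h5
    rw [h1, h4, Pi.add_apply, h2, h3, h5, Pi.add_apply, mul_add]
  map_smul' c f := by
    ext1
    filter_upwards [coeFn_dilationFun A (c • f), coeFn_dilationFun A f,
      Lp.coeFn_smul c (dilationFun A f),
      ae_comp_matrix A (Lp.coeFn_smul c f)] with x h1 h2 h3 h4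
    simp only [RingHom.id_apply]
    rw [h1, h3, Pi.smul_apply, h2, h4, Pi.smul_apply, smul_eq_mul, smul_eq_mul]
    ring
  left_inv f := dilationFun_inv A A⁻¹ (mul_inv_cancel A) f
  right_inv f := dilationFun_inv A⁻¹ A (inv_mul_cancel A) f
  norm_map' f := by
    change ‖dilationFun A f‖ = ‖f‖
    rw [dilationFun, Lp.norm_toLp, eLpNorm_comp_matrix, Lp.norm_def]

theorem coeFn_dilation (A : GL (Fin d) ℝ) (f : L2 d) :
    dilation A f =ᵐ[volume] fun x => ((√|(A : Matrix (Fin d) (Fin d) ℝ).det| : ℝ) : ℂ) *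
      f (Matrix.toEuclideanLin (A : Matrix (Fin d) (Fin d) ℝ) x) :=
  coeFn_dilationFun A f

/-- The nonzero number `√|det A|`. -/
def sqrtDet (A : GL (Fin d) ℝ) : ℂˣ :=
  Units.mk0 ((√|(A : Matrix (Fin d) (Fin d) ℝ).det| : ℝ) : ℂ) (by
    rw [Complex.ofReal_ne_zero, Real.sqrt_ne_zero (abs_nonneg _), abs_ne_zero,
      ← det_toEuclideanLin]
    exact det_toEuclideanLin_ne_zero A)

/-- The renormalized dilation operator `(D̃_A f)(x) = |det A| · f(A x)` on `L²(ℝ^d)`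
(which is `√|det A|` times the unitary dilation). -/
def renormDilation (A : GL (Fin d) ℝ) : L2 d ≃L[ℂ] L2 d :=
  sqrtDet A • (dilation A).toContinuousLinearEquiv

theorem coeFn_renormDilation (A : GL (Fin d) ℝ) (f : L2 d) :
    renormDilation A f =ᵐ[volume] fun x => ((|(A : Matrix (Fin d) (Fin d) ℝ).det| : ℝ) : ℂ) *
      f (Matrix.toEuclideanLin (A : Matrix (Fin d) (Fin d) ℝ) x) := by
  filter_upwards [coeFn_dilation A f,
    Lp.coeFn_smul (((√|(A : Matrix (Fin d) (Fin d) ℝ).det| : ℝ) : ℂ)) (dilation A f)]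
    with x h1 h2
  change (((√|(A : Matrix (Fin d) (Fin d) ℝ).det| : ℝ) : ℂ) • dilation A f : L2 d) x = _
  rw [h2, Pi.smul_apply, h1, smul_eq_mul, ← mul_assoc, ← Complex.ofReal_mul,
    Real.mul_self_sqrt (abs_nonneg _)]

/-- `T̄_α = T_α ⊕ ⋯ ⊕ T_α` on `L²(ℝ^d)^r`. -/
def translationSum (r : ℕ) (α : E d) : L2Sum d r ≃ₗᵢ[ℂ] L2Sum d r :=
  LinearIsometryEquiv.piLpCongrRight 2 (fun _ => translation α)

/-- `D̄_A = D_A ⊕ ⋯ ⊕ D_A` on `L²(ℝ^d)^r`. -/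
def dilationSum (r : ℕ) (A : GL (Fin d) ℝ) : L2Sum d r ≃ₗᵢ[ℂ] L2Sum d r :=
  LinearIsometryEquiv.piLpCongrRight 2 (fun _ => dilation A)

/-- The direct sum `D̃_A ⊕ ⋯ ⊕ D̃_A` on `L²(ℝ^d)^r`
(which is `√|det A|` times `D_A ⊕ ⋯ ⊕ D_A`). -/
def renormDilationSum (r : ℕ) (A : GL (Fin d) ℝ) : L2Sum d r ≃L[ℂ] L2Sum d r :=
  sqrtDet A • (dilationSum r A).toContinuousLinearEquiv

theorem renormDilationSum_apply (r : ℕ) (A : GL (Fin d) ℝ) (F : L2Sum d r) (i : Fin r) :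
    renormDilationSum r A F i = renormDilation A (F i) := rfl

/-- The affine system `U_A(ψ) = {D_A^n T_z ψ : n ∈ ℤ, z ∈ ℤ^d}` in `L²(ℝ^d)`. -/
def affineSystem (A : GL (Fin d) ℝ) (ψ : L2 d) : ℤ × (Fin d → ℤ) → L2 d :=
  fun p => (dilation A ^ p.1) (translation (latticePt p.2) ψ)

/-- The system `{D̄_A^n T̄_z Ψ : n ∈ ℤ, z ∈ ℤ^d}` in `L²(ℝ^d)^r`. -/
def superAffineSystem {r : ℕ} (A : GL (Fin d) ℝ) (Ψ : L2Sum d r) :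
    ℤ × (Fin d → ℤ) → L2Sum d r :=
  fun p => (dilationSum r A ^ p.1) (translationSum r (latticePt p.2) Ψ)

/-- The quasi-affine system in `L²(ℝ^d)^r`: `D̄_A^n T̄_z Ψ` for `n ≥ 0`, and `T̄_z D̃_A^n Ψ`
(with `D̃_A` acting in each component) for `n < 0`, where `z ∈ ℤ^d`. -/
def superQuasiAffineSystem {r : ℕ} (A : GL (Fin d) ℝ) (Ψ : L2Sum d r) :
    ℤ × (Fin d → ℤ) → L2Sum d r :=
  fun p => if 0 ≤ p.1 then (dilationSum r A ^ p.1) (translationSum r (latticePt p.2) Ψ)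
    else translationSum r (latticePt p.2) ((renormDilationSum r A ^ p.1) Ψ)

end Operators

/-- The point `A^{*n} ξ`, where `A^*` is the transpose of `A` and `n ∈ ℤ`. -/
def adjPow {d : ℕ} (A : GL (Fin d) ℝ) (n : ℤ) (ξ : E d) : E d :=
  Matrix.toEuclideanLin ((A : Matrix (Fin d) (Fin d) ℝ).transpose ^ n) ξ

/-- For all `i, j`: `∑_{n ∈ ℤ} ψ̂_i(A^{*n} ξ) conj (ψ̂_j(A^{*n} ξ)) = δ_{i,j}` for a.e. `ξ`. -/
def DiagonalEquation {d r : ℕ} (A : GL (Fin d) ℝ) (ψ : Fin r → L2 d) : Prop :=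
  ∀ i j : Fin r, ∀ᵐ ξ : E d,
    HasSum (fun n : ℤ => (𝓕 (ψ i)) (adjPow A n ξ) * conj ((𝓕 (ψ j)) (adjPow A n ξ)))
      (if i = j then 1 else 0)

/-- For all `i, j` and all `k ∈ ℤ^d \ A^* ℤ^d`:
`∑_{n ≥ 0} ψ̂_i(A^{*n} ξ) conj (ψ̂_j(A^{*n} (ξ + k))) = 0` for a.e. `ξ`. -/
def OffDiagonalEquation {d r : ℕ} (A : GL (Fin d) ℝ) (ψ : Fin r → L2 d) : Prop :=
  ∀ i j : Fin r, ∀ k : Fin d → ℤ,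
    (¬ ∃ m : Fin d → ℤ, latticePt k = adjPow A 1 (latticePt m)) →
    ∀ᵐ ξ : E d,
      HasSum (fun n : ℕ => (𝓕 (ψ i)) (adjPow A n ξ) *
        conj ((𝓕 (ψ j)) (adjPow A n (ξ + latticePt k)))) 0

end SuperWavelet

end

open MeasureTheory
open scoped FourierTransform ComplexConjugate ENNReal

noncomputable section

namespace SuperWavelet

/-! Everything is tested on the dense space of `f`, `g` whose Fourier transforms `F`, `G` are
bounded and supported in an annulus. Write `B` for the transpose of `A`, `p = ψ̂_i`, `q = ψ̂_j`. At
level `n` the inner products with the system are Fourier coefficients on `ℝ^d/ℤ^d`. Parseval for the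
periodizations turns the level sum into integrals of `F(ξ) conj G(ξ+α) conj p(B^m ξ) q(B^m(ξ+α))`,
with `m = -n`. For the affine system the shift `α` runs over `B^{-m} ℤ^d`. For the quasi-affine
system at `n < 0` it runs over `ℤ^d` only, which is a subset of `B^{-m} ℤ^d`; for `n ≥ 0` the two
systems agree and all shifts are already integral. So both frame sums are one series (`term`) over
pairs `(m, l)` with `α = B^{-m} l`, restricted to shifts in `S`, where `S` is everything or `ℤ^d`
(`hasSum_affineSystem`, `hasSum_quasiAffineSystem`).

The Bessel hypothesis bounds `∑_m |p(B^m ξ)|²` almost everywhere (`isSquareSummable_of_isBessel`).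
Together with a lattice point count this makes the series absolutely convergent
(`tsum_lintegral_kern_ne_top`), so it can be grouped by the value of `α`. The fibre over `0` is
`{(m, 0)}` and carries the sum in equation (a). Every nonzero shift is `B^n k` with `k` outside `B
ℤ^d`; its fibre is `{(j - n, B^j k) : j ≥ 0}` and carries the sum in (b), evaluated at `B^{-n} ξ`.

If (a) and (b) hold, all fibres but the one over `0` vanish, and the series equals `δ_{ij} ⟨g, f⟩`,
whichever `S` is used (`SatisfiesDualEquations.tsum_eq`). Conversely, translating `f` and `g` by the
same `x` leaves `⟨g, f⟩` fixed and multiplies the term of shift `α` by `e^{2πi x·α}`. The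
coefficients of an absolutely convergent trigonometric series are determined by its sum, so each
fibre can be isolated, and varying `F` and `G` gives the equations almost everywhere
(`satisfiesDualEquations_of_tsum_eq`). Only integer shifts are needed for this, so the quasi-affine
system already yields the full set of equations.

Polarization (`isParsevalFrame_toLp_iff`) reduces the vector-valued statement to pairs `(i, j)`.
Dimension zero is separate, because there a single point is not a null set. -/

variable {d : ℕ}

/-! ### Translations and dilations under the Fourier transform. -/

/-- The character `ξ ↦ e^{2πi x·ξ}`. -/
def expi (x ξ : E d) : ℂ := (Real.fourierChar (inner ℝ x ξ) : ℂ)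

theorem norm_expi (x ξ : E d) : ‖expi x ξ‖ = 1 := Circle.norm_coe _

theorem expi_neg_left (x ξ : E d) : expi (-x) ξ = conj (expi x ξ) := by
  simp [expi, inner_neg_left, AddChar.map_neg_eq_inv]

theorem expi_add_right (x ξ η : E d) : expi x (ξ + η) = expi x ξ * expi x η := by
  simp [expi, inner_add_right, AddChar.map_add_eq_mul]

theorem conj_expi_mul_expi (x ξ : E d) : conj (expi x ξ) * expi x ξ = 1 := by
  rw [mul_comm, Complex.mul_conj, Complex.normSq_eq_norm_sq, norm_expi]; simp

theorem continuous_expi (x : E d) : Continuous (expi x) := by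
  unfold expi
  exact continuous_subtype_val.comp
    (Real.continuous_fourierChar.comp (continuous_const.inner continuous_id))

theorem memLp_expi_mul (x : E d) {p : ℝ≥0∞} {f : E d → ℂ} (hf : MemLp f p) :
    MemLp (fun ξ => expi x ξ * f ξ) p :=
  hf.of_le ((continuous_expi x).aestronglyMeasurable.mul hf.1)
    (.of_forall fun ξ => by simp [norm_expi])

/-- Multiplication of an `L²` function by the character `e^{2πi x·ξ}`. -/
def modulate (x : E d) (f : L2 d) : L2 d := (memLp_expi_mul x (Lp.memLp f)).toLp _

theorem coeFn_modulate (x : E d) (f : L2 d) :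
    modulate x f =ᵐ[volume] fun ξ => expi x ξ * f ξ :=
  (memLp_expi_mul x (Lp.memLp f)).coeFn_toLp

theorem isometry_modulate (x : E d) : Isometry (modulate x) := by
  refine Isometry.of_dist_eq fun f g => ?_
  rw [dist_eq_norm, dist_eq_norm, Lp.norm_def, Lp.norm_def]
  congr 1
  refine eLpNorm_congr_norm_ae ?_
  filter_upwards [Lp.coeFn_sub (modulate x f) (modulate x g), Lp.coeFn_sub f g,
    coeFn_modulate x f, coeFn_modulate x g] with ξ h1 h2 h3 h4
  rw [h1, h2, Pi.sub_apply, Pi.sub_apply, h3, h4, ← mul_sub, norm_mul, norm_expi, one_mul]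

/-- The Fourier transform turns translations into modulations. -/
theorem fourier_translation (α : E d) (f : L2 d) :
    𝓕 (translation α f) = modulate (-α) (𝓕 f) := by
  have hF : Continuous (fun f : L2 d => 𝓕 f) := (Lp.fourierTransformₗᵢ (E d) ℂ).continuous
  -- Both sides are continuous in `f` (this is what `isometry_modulate` is for), so Schwartz
  -- functions suffice, where `𝓕` is an actual integral.
  refine DenseRange.induction_on
    (p := fun f : L2 d => 𝓕 (translation α f) = modulate (-α) (𝓕 f))
    (SchwartzMap.denseRange_toLpCLM (E := E d) (F := ℂ) (p := 2) ENNReal.ofNat_ne_top) f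
    (isClosed_eq (hF.comp (translation α).continuous)
      ((isometry_modulate (-α)).continuous.comp hF)) ?_
  intro s
  change 𝓕 (translation α (s.toLp 2)) = modulate (-α) (𝓕 (s.toLp 2))
  have h1 : translation α (s.toLp 2) = (s.compSubConstCLM ℂ α).toLp 2 := by
    ext1
    filter_upwards [coeFn_translation α (s.toLp 2), (s.compSubConstCLM ℂ α).coeFn_toLp 2,
      (measurePreserving_sub_right volume α).quasiMeasurePreserving.ae
        (s.coeFn_toLp 2 volume)]
      with x h1 h2 h3
    rw [h1, h2, h3]; rfl
  rw [h1, SchwartzMap.toLp_fourier_eq, SchwartzMap.toLp_fourier_eq]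
  ext1
  filter_upwards [(𝓕 (s.compSubConstCLM ℂ α)).coeFn_toLp 2, (𝓕 s).coeFn_toLp 2,
    coeFn_modulate (-α) ((𝓕 s).toLp 2)] with ξ h1 h2 h3
  rw [h1, h3, h2, SchwartzMap.fourier_coe, SchwartzMap.fourier_coe, Real.fourier_eq,
    Real.fourier_eq, ← integral_const_mul]
  conv_rhs => rw [← integral_sub_right_eq_self _ α]
  refine integral_congr_ae (.of_forall fun x => ?_)
  simp only [SchwartzMap.compSubConstCLM_apply, Circle.smul_def, smul_eq_mul, expi]
  rw [← mul_assoc, ← Circle.coe_mul, ← AddChar.map_add_eq_mul]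
  congr 3
  rw [inner_sub_left, inner_neg_left]; ring

/-- The invertible linear map of `ℝ^d` given by an invertible matrix. -/
def matEquiv : GL (Fin d) ℝ →* (E d ≃L[ℝ] E d) where
  toFun M := LinearEquiv.toContinuousLinearEquiv
    { Matrix.toEuclideanLin (M : Matrix (Fin d) (Fin d) ℝ) with
      invFun := Matrix.toEuclideanLin ((M⁻¹ : GL (Fin d) ℝ) : Matrix (Fin d) (Fin d) ℝ)
      left_inv := fun x => by
        simp [Matrix.toLpLin_apply, Matrix.mulVec_mulVec, ← Units.val_mul, -Matrix.coe_units_inv]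
      right_inv := fun x => by
        simp [Matrix.toLpLin_apply, Matrix.mulVec_mulVec, ← Units.val_mul,
          -Matrix.coe_units_inv] }
  map_one' := by
    ext1; funext x
    change Matrix.toEuclideanLin (1 : Matrix (Fin d) (Fin d) ℝ) x = x
    simp
  map_mul' M N := by
    ext1; funext x
    change Matrix.toEuclideanLin ((M : Matrix (Fin d) (Fin d) ℝ) * (N : Matrix (Fin d) (Fin d) ℝ)) x
      = Matrix.toEuclideanLin (M : Matrix (Fin d) (Fin d) ℝ)
        (Matrix.toEuclideanLin (N : Matrix (Fin d) (Fin d) ℝ) x)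
    simp [Matrix.toLpLin_apply, Matrix.mulVec_mulVec]

theorem matEquiv_apply (M : GL (Fin d) ℝ) (x : E d) :
    matEquiv M x = Matrix.toEuclideanLin (M : Matrix (Fin d) (Fin d) ℝ) x := rfl

/-- The transpose of an invertible matrix. -/
def trGL (A : GL (Fin d) ℝ) : GL (Fin d) ℝ where
  val := (A : Matrix (Fin d) (Fin d) ℝ).transpose
  inv := ((A⁻¹ : GL (Fin d) ℝ) : Matrix (Fin d) (Fin d) ℝ).transpose
  val_inv := by rw [← Matrix.transpose_mul, ← Units.val_mul]; simp
  inv_val := by rw [← Matrix.transpose_mul, ← Units.val_mul]; simp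

theorem adjPow_eq (A : GL (Fin d) ℝ) (n : ℤ) (ξ : E d) :
    adjPow A n ξ = (matEquiv (trGL A) ^ n) ξ := by
  rw [← map_zpow, matEquiv_apply, adjPow, Matrix.coe_units_zpow]; rfl

theorem det_trGL (A : GL (Fin d) ℝ) :
    ((trGL A : GL (Fin d) ℝ) : Matrix (Fin d) (Fin d) ℝ).det
      = (A : Matrix (Fin d) (Fin d) ℝ).det :=
  Matrix.det_transpose _

theorem inner_matEquiv (A : GL (Fin d) ℝ) (x y : E d) :
    inner ℝ (matEquiv A x) y = inner ℝ x (matEquiv (trGL A) y) := by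
  simp only [matEquiv_apply, Matrix.toLpLin_apply, EuclideanSpace.inner_eq_star_dotProduct, trGL]
  simp [Matrix.dotProduct_mulVec, Matrix.vecMul_transpose, dotProduct_comm]

/-- The order reverses because dilations act by precomposition. -/
theorem dilation_mul (M N : GL (Fin d) ℝ) : dilation (M * N) = dilation N * dilation M := by
  ext1 f
  change dilation (M * N) f = dilation N (dilation M f)
  ext1
  filter_upwards [coeFn_dilation (M * N) f, coeFn_dilation N (dilation M f),
    ae_comp_matrix N (coeFn_dilation M f)] with x h1 h2 h3
  rw [h1, h2, h3, ← mul_assoc, ← Complex.ofReal_mul, ← Real.sqrt_mul (abs_nonneg _), ← abs_mul,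
    ← Matrix.det_mul, ← Matrix.GeneralLinearGroup.coe_mul, Matrix.GeneralLinearGroup.coe_mul,
    Matrix.GeneralLinearGroup.coe_mul, Matrix.det_mul_comm]
  simp [Matrix.toLpLin_apply, Matrix.mulVec_mulVec]

theorem dilation_one : dilation (1 : GL (Fin d) ℝ) = 1 := by
  ext1 f
  change dilation 1 f = f
  ext1
  filter_upwards [coeFn_dilation 1 f] with x h1
  rw [h1]; simp

theorem dilation_zpow (M : GL (Fin d) ℝ) (n : ℤ) : dilation M ^ n = dilation (M ^ n) := by
  have hnat : ∀ k : ℕ, dilation (M ^ k) = dilation M ^ k := by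
    intro k
    induction k with
    | zero => simp [dilation_one]
    | succ k ih => rw [pow_succ, dilation_mul, ih, pow_succ']
  have hinv : ∀ N : GL (Fin d) ℝ, dilation N⁻¹ = (dilation N)⁻¹ := fun N =>
    eq_inv_of_mul_eq_one_left (by rw [← dilation_mul, mul_inv_cancel, dilation_one])
  cases n with
  | ofNat k => simp [hnat]
  | negSucc k => rw [zpow_negSucc, zpow_negSucc, hinv, hnat]

/-- The Fourier transform turns the dilation by `M` into the dilation by the inverse transpose. -/
theorem fourier_dilation (M : GL (Fin d) ℝ) (f : L2 d) :
    𝓕 (dilation M f) = dilation (trGL M)⁻¹ (𝓕 f) := by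
  have hF : Continuous (fun f : L2 d => 𝓕 f) := (Lp.fourierTransformₗᵢ (E d) ℂ).continuous
  refine DenseRange.induction_on
    (p := fun f : L2 d => 𝓕 (dilation M f) = dilation (trGL M)⁻¹ (𝓕 f))
    (SchwartzMap.denseRange_toLpCLM (E := E d) (F := ℂ) (p := 2) ENNReal.ofNat_ne_top) f
    (isClosed_eq (hF.comp (dilation M).continuous)
      ((dilation (trGL M)⁻¹).continuous.comp hF)) ?_
  intro s
  change 𝓕 (dilation M (s.toLp 2)) = dilation (trGL M)⁻¹ (𝓕 (s.toLp 2))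
  set c : ℂ := ((√|(M : Matrix (Fin d) (Fin d) ℝ).det| : ℝ) : ℂ) with hc
  set s' : SchwartzMap (E d) ℂ := c • s.compCLMOfContinuousLinearEquiv ℂ (matEquiv M) with hs'
  have hs'x : ∀ x, s' x = c * s (matEquiv M x) := fun x => rfl
  have h1 : dilation M (s.toLp 2) = s'.toLp 2 := by
    ext1
    filter_upwards [coeFn_dilation M (s.toLp 2), s'.coeFn_toLp 2,
      ae_comp_matrix M (s.coeFn_toLp 2 volume)] with x h1 h2 h3
    rw [h1, h2, h3, hs'x]; rfl
  rw [h1, SchwartzMap.toLp_fourier_eq, SchwartzMap.toLp_fourier_eq]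
  ext1
  filter_upwards [(𝓕 s').coeFn_toLp 2, ae_comp_matrix (trGL M)⁻¹
      ((𝓕 s).coeFn_toLp 2 volume),
    coeFn_dilation (trGL M)⁻¹ ((𝓕 s).toLp 2)] with ξ h1 h2 h3
  rw [h1, h3, h2, SchwartzMap.fourier_coe, SchwartzMap.fourier_coe, Real.fourier_eq,
    Real.fourier_eq, ← matEquiv_apply]
  have hdet : (M : Matrix (Fin d) (Fin d) ℝ).det ≠ 0 := by
    rw [← det_toEuclideanLin]; exact det_toEuclideanLin_ne_zero M
  have hcv : ∫ v, Real.fourierChar (-inner ℝ v (matEquiv (trGL M)⁻¹ ξ)) • s v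
      = |(M : Matrix (Fin d) (Fin d) ℝ).det| *
        ∫ v, Real.fourierChar (-inner ℝ v ξ) • s (matEquiv M v) := by
    have hmap := Measure.map_linearMap_addHaar_eq_smul_addHaar (volume : Measure (E d))
      (det_toEuclideanLin_ne_zero M)
    have := (matEquiv M).toHomeomorph.measurableEmbedding.integral_map (μ := volume)
      (fun v => Real.fourierChar (-inner ℝ v (matEquiv (trGL M)⁻¹ ξ)) • s v)
    rw [show Measure.map (matEquiv M).toHomeomorph volume = _ from hmap, integral_smul_measure,
      det_toEuclideanLin] at this
    have h4 : ∀ v, inner ℝ (matEquiv M v) (matEquiv (trGL M)⁻¹ ξ) = inner ℝ v ξ := by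
      intro v
      rw [inner_matEquiv, ← ContinuousLinearEquiv.coe_coe, ← ContinuousLinearEquiv.coe_coe]
      change inner ℝ v ((matEquiv (trGL M) * matEquiv (trGL M)⁻¹) ξ) = _
      rw [← map_mul, mul_inv_cancel, map_one]; rfl
    have h5 : ∀ v, (matEquiv M).toHomeomorph v = matEquiv M v := fun v => rfl
    simp only [h5, h4] at this
    rw [← this, ENNReal.toReal_ofReal (abs_nonneg _), Complex.real_smul, ← mul_assoc,
      ← Complex.ofReal_mul, abs_inv, mul_inv_cancel₀ (abs_ne_zero.mpr hdet)]
    simp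
  rw [hcv, ← mul_assoc, ← Complex.ofReal_mul]
  have h6 : √|((trGL M)⁻¹ : GL (Fin d) ℝ).1.det| * |(M : Matrix (Fin d) (Fin d) ℝ).det|
      = √|(M : Matrix (Fin d) (Fin d) ℝ).det| := by
    rw [Matrix.coe_units_inv, Matrix.det_nonsing_inv, Ring.inverse_eq_inv', abs_inv, det_trGL,
      Real.sqrt_inv]
    have hp := Real.sqrt_pos.mpr (abs_pos.mpr hdet)
    nth_rewrite 2 [← Real.mul_self_sqrt (abs_nonneg (M : Matrix (Fin d) (Fin d) ℝ).det)]
    field_simp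
  rw [h6, ← integral_const_mul]
  refine integral_congr_ae (.of_forall fun x => ?_)
  simp only [hs'x, Circle.smul_def, smul_eq_mul]
  ring

/-! ### The unit cube as a fundamental domain for `ℤ^d`. -/

section Cube

/-- The half-open unit cube. -/
def unitCube (d : ℕ) : Set (E d) := {ξ | ∀ i, ξ i ∈ Set.Ioc (0 : ℝ) 1}

theorem measurableSet_unitCube : MeasurableSet (unitCube d) := by
  have : unitCube d = ⋂ i, (fun ξ : E d => ξ i) ⁻¹' Set.Ioc (0 : ℝ) 1 := by
    ext; simp [unitCube]
  rw [this]
  exact MeasurableSet.iInter fun i => measurableSet_Ioc.preimage (by fun_prop)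

theorem norm_le_of_mem_unitCube {ξ : E d} (h : ξ ∈ unitCube d) : ‖ξ‖ ≤ √d := by
  rw [EuclideanSpace.norm_eq]
  refine Real.sqrt_le_sqrt ?_
  calc ∑ i, ‖ξ i‖ ^ 2 ≤ ∑ _i : Fin d, (1 : ℝ) := by
        refine Finset.sum_le_sum fun i _ => ?_
        rw [Real.norm_eq_abs, sq_abs]
        have := h i
        nlinarith [this.1, this.2]
    _ = d := by simp

theorem volume_unitCube : volume (unitCube d) = 1 := by
  have h := (PiLp.volume_preserving_toLp (Fin d)).measure_preimage
    (measurableSet_unitCube (d := d)).nullMeasurableSet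
  rw [← h]
  have : (WithLp.toLp 2) ⁻¹' unitCube d = Set.univ.pi fun _ => Set.Ioc (0 : ℝ) 1 := by
    ext; simp [unitCube]
  rw [this, Real.volume_pi_Ioc]
  simp

theorem latticePt_injective : Function.Injective (latticePt (d := d)) := by
  intro z w h
  funext i
  have : latticePt z i = latticePt w i := by rw [h]
  simpa [latticePt] using this

theorem latticePt_add (z w : Fin d → ℤ) : latticePt (z + w) = latticePt z + latticePt w := by
  ext i; simp [latticePt]

theorem latticePt_neg (z : Fin d → ℤ) : latticePt (-z) = -latticePt z := by
  ext i; simp [latticePt]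

theorem latticePt_zero : latticePt (0 : Fin d → ℤ) = 0 := by
  ext i; simp [latticePt]

theorem one_le_norm_latticePt {z : Fin d → ℤ} (hz : z ≠ 0) : 1 ≤ ‖latticePt z‖ := by
  obtain ⟨i, hi⟩ := Function.ne_iff.mp hz
  refine le_trans ?_ (PiLp.norm_apply_le (latticePt z) i)
  have : (1 : ℝ) ≤ |(z i : ℝ)| := by exact_mod_cast Int.one_le_abs hi
  simpa [latticePt] using this

/-- The translates of the unit cube by lattice points. -/
def cubeAt (l : Fin d → ℤ) : Set (E d) := (fun ξ => ξ - latticePt l) ⁻¹' unitCube d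

theorem measurableSet_cubeAt (l : Fin d → ℤ) : MeasurableSet (cubeAt l) :=
  measurableSet_unitCube.preimage (by fun_prop)

/-- The cube is open below and closed above, which is why the index is the ceiling minus one and not
the floor. -/
theorem mem_cubeAt_iff {l : Fin d → ℤ} {ξ : E d} :
    ξ ∈ cubeAt l ↔ l = fun i => ⌈ξ i⌉ - 1 := by
  simp only [cubeAt, unitCube, Set.mem_preimage, Set.mem_ofPred_eq, funext_iff]
  refine forall_congr' fun i => ?_
  simp only [latticePt, PiLp.sub_apply, Set.mem_Ioc]
  rw [eq_sub_iff_add_eq, eq_comm, Int.ceil_eq_iff]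
  push_cast
  constructor <;> rintro ⟨h1, h2⟩ <;> constructor <;> linarith

theorem pairwise_disjoint_cubeAt : Pairwise (Function.onFun Disjoint (cubeAt (d := d))) := by
  intro l l' h
  rw [Function.onFun, Set.disjoint_left]
  intro ξ h1 h2
  exact h ((mem_cubeAt_iff.mp h1).trans (mem_cubeAt_iff.mp h2).symm)

theorem iUnion_cubeAt : ⋃ l, cubeAt (d := d) l = Set.univ :=
  Set.eq_univ_of_forall fun _ => Set.mem_iUnion.mpr ⟨_, mem_cubeAt_iff.mpr rfl⟩

theorem hasSum_integral_unitCube {h : E d → ℂ} (hh : Integrable h) :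
    HasSum (fun l => ∫ ξ in unitCube d, h (ξ + latticePt l)) (∫ ξ, h ξ) := by
  have h1 := hasSum_integral_iUnion (μ := volume) (f := h) measurableSet_cubeAt
    (pairwise_disjoint_cubeAt (d := d)) (by rw [iUnion_cubeAt]; exact hh.integrableOn)
  rw [iUnion_cubeAt, setIntegral_univ] at h1
  refine h1.congr_fun fun l => ?_
  have hc : cubeAt l = (fun ξ : E d => ξ - latticePt l) ⁻¹' unitCube d := rfl
  rw [hc, ← (measurePreserving_sub_right volume (latticePt l)).setIntegral_preimage_emb
    (MeasurableEquiv.subRight (latticePt l)).measurableEmbedding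
    (fun ξ => h (ξ + latticePt l)) (unitCube d)]
  simp

end Cube

/-! ### Fourier series on the torus, transported to the unit cube. -/

section Torus

/-- The measure on `ℝ / ℤ` of total mass one. -/
local instance unitAddCircleMeasureSpace : MeasureSpace UnitAddCircle :=
  ⟨AddCircle.haarAddCircle⟩

/-- The section of `ℝ^d → (ℝ/ℤ)^d` with values in the unit cube. -/
def torusSection (t : UnitAddTorus (Fin d)) : E d :=
  WithLp.toLp 2 (UnitAddTorus.measurableEquivPiIoc (fun _ => 0) t).1

theorem measurePreserving_torusSection :
    MeasurePreserving (torusSection (d := d)) volume (volume.restrict (unitCube d)) := by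
  set S : Set (Fin d → ℝ) := {x | ∀ i, x i ∈ Set.Ioc (0 : ℝ) (0 + 1)} with hS
  have hSm : MeasurableSet S := MeasurableSet.univ_pi' fun i => measurableSet_Ioc
  have h1 := UnitAddTorus.measurePreserving_equivPiIoc (d := Fin d) (fun _ => 0)
  have h2 : MeasurePreserving (Subtype.val : S → _) (Measure.comap Subtype.val volume)
      (volume.restrict S) := ⟨measurable_subtype_coe, map_comap_subtype_coe hSm volume⟩
  have h3 := (PiLp.volume_preserving_toLp (Fin d)).restrict_preimage
    (measurableSet_unitCube (d := d))
  have h4 : (WithLp.toLp 2) ⁻¹' unitCube d = S := by ext; simp [unitCube, hS]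
  rw [h4] at h3
  exact h3.comp (h2.comp h1)

theorem mFourier_torusSection (z : Fin d → ℤ) (t : UnitAddTorus (Fin d)) :
    UnitAddTorus.mFourier z t = expi (latticePt z) (torusSection t) := by
  have h : ∀ i, t i = ((torusSection t i : ℝ) : UnitAddCircle) := fun i =>
    congrFun ((UnitAddTorus.measurableEquivPiIoc (fun _ => (0 : ℝ))).symm_apply_apply t).symm i
  simp only [UnitAddTorus.mFourier, ContinuousMap.coe_mk, expi, Real.fourierChar_apply]
  simp_rw [h, fourier_coe_apply]
  rw [← Complex.exp_sum]
  congr 1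
  rw [PiLp.inner_apply]
  push_cast
  simp only [latticePt, RCLike.inner_apply, conj_trivial, Finset.mul_sum, Finset.sum_mul]
  refine Finset.sum_congr rfl fun i _ => ?_
  push_cast
  ring

/-- Parseval's identity for Fourier series on the unit cube. -/
theorem hasSum_unitCube_mul_conj {u v : E d → ℂ} (hu : MemLp u 2 (volume.restrict (unitCube d)))
    (hv : MemLp v 2 (volume.restrict (unitCube d))) :
    HasSum (fun z : Fin d → ℤ => (∫ ξ in unitCube d, expi (latticePt z) ξ * u ξ) *
      conj (∫ ξ in unitCube d, expi (latticePt z) ξ * v ξ))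
      (∫ ξ in unitCube d, u ξ * conj (v ξ)) := by
  have hp := measurePreserving_torusSection (d := d)
  have hu' := hu.comp_measurePreserving hp
  have hv' := hv.comp_measurePreserving hp
  have hint : ∀ {g : E d → ℂ}, AEStronglyMeasurable g (volume.restrict (unitCube d)) →
      ∫ ξ in unitCube d, g ξ = ∫ t, g (torusSection t) := by
    intro g hg
    rw [← hp.map_eq] at hg ⊢
    rw [integral_map hp.measurable.aemeasurable hg]
  -- `mFourierCoeff` integrates against the conjugate character, hence the index `-z`.
  have key : ∀ {w : E d → ℂ} (hw : MemLp w 2 (volume.restrict (unitCube d))) (z : Fin d → ℤ),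
      UnitAddTorus.mFourierCoeff (hw.comp_measurePreserving hp).toLp (-z)
        = ∫ ξ in unitCube d, expi (latticePt z) ξ * w ξ := by
    intro w hw z
    rw [hint (g := fun ξ => expi (latticePt z) ξ * w ξ)
      ((continuous_expi _).aestronglyMeasurable.mul hw.1), UnitAddTorus.mFourierCoeff]
    refine integral_congr_ae ?_
    filter_upwards [(hw.comp_measurePreserving hp).coeFn_toLp] with t ht
    rw [ht, neg_neg, mFourier_torusSection]; rfl
  have h := UnitAddTorus.hasSum_prod_mFourierCoeff hv'.toLp hu'.toLp
  rw [← (Equiv.neg (Fin d → ℤ)).hasSum_iff] at h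
  convert h using 1
  · funext z
    simp only [Function.comp_apply, Equiv.neg_apply]
    rw [key hu, key hv, mul_comm]
  · rw [hint (g := fun ξ => u ξ * conj (v ξ))
      (hu.1.mul (Complex.continuous_conj.comp_aestronglyMeasurable hv.1))]
    refine integral_congr_ae ?_
    filter_upwards [hu'.coeFn_toLp, hv'.coeFn_toLp] with t h1 h2
    rw [h1, h2, mul_comm]; rfl

end Torus

/-! ### Parseval for periodizations. -/

theorem finite_latticePt_norm_le (R : ℝ) : {l : Fin d → ℤ | ‖latticePt l‖ ≤ R}.Finite := by
  refine Set.Finite.subset (Set.finite_Icc (fun _ => -⌈R⌉) (fun _ => ⌈R⌉)) fun l hl => ?_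
  have h : ∀ i, |(l i : ℝ)| ≤ ⌈R⌉ := fun i => by
    have := (PiLp.norm_apply_le (latticePt l) i).trans (hl.trans (Int.le_ceil R))
    simpa [latticePt] using this
  refine ⟨fun i => ?_, fun i => ?_⟩
  · exact_mod_cast (abs_le.mp (h i)).1
  · exact_mod_cast (abs_le.mp (h i)).2

/-- Parseval's identity for the periodizations of two square integrable functions with bounded
support. -/
theorem hasSum_integral_expi_mul_conj {h k : E d → ℂ} (hh : MemLp h 2) (hk : MemLp k 2) {R : ℝ}
    (hhR : ∀ ξ, R < ‖ξ‖ → h ξ = 0) (hkR : ∀ ξ, R < ‖ξ‖ → k ξ = 0) :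
    HasSum (fun z : Fin d → ℤ => (∫ ξ, expi (latticePt z) ξ * h ξ) *
      conj (∫ ξ, expi (latticePt z) ξ * k ξ))
      (∑' l : Fin d → ℤ, ∫ ξ, h ξ * conj (k (ξ + latticePt l))) := by
  classical
  -- Points of the cube have norm at most `√d`, so a translate by `l` with `‖l‖ > R + √d` misses the
  -- support. The periodizations are therefore finite sums over `s`.
  set s := (finite_latticePt_norm_le (d := d) (R + √d)).toFinset with hs
  have hzero : ∀ {w : E d → ℂ}, (∀ ξ, R < ‖ξ‖ → w ξ = 0) → ∀ l ∉ s, ∀ ξ ∈ unitCube d,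
      w (ξ + latticePt l) = 0 := by
    intro w hw l hl ξ hξ
    apply hw
    have h1 : R + √d < ‖latticePt l‖ := by simpa [hs] using hl
    have h2 := norm_le_of_mem_unitCube hξ
    have h3 : ‖latticePt l‖ ≤ ‖ξ + latticePt l‖ + ‖ξ‖ := by
      simpa using norm_sub_le (ξ + latticePt l) ξ
    linarith
  have hmem : ∀ {w : E d → ℂ}, MemLp w 2 → ∀ l : Fin d → ℤ,
      MemLp (fun ξ => w (ξ + latticePt l)) 2 := fun hw l =>
    hw.comp_measurePreserving (measurePreserving_add_right volume (latticePt l))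
  have hint : ∀ {w : E d → ℂ}, MemLp w 2 → (∀ ξ, R < ‖ξ‖ → w ξ = 0) → Integrable w := by
    intro w hw hwR
    have hb : w = (Metric.closedBall (0 : E d) R).indicator w := by
      funext ξ
      by_cases hξ : ξ ∈ Metric.closedBall (0 : E d) R
      · rw [Set.indicator_of_mem hξ]
      · rw [Set.indicator_of_notMem hξ, hwR]
        simpa using hξ
    rw [hb, integrable_indicator_iff Metric.isClosed_closedBall.measurableSet]
    have hfin : IsFiniteMeasure (volume.restrict (Metric.closedBall (0 : E d) R)) :=
      ⟨by simpa using measure_closedBall_lt_top⟩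
    exact (hw.restrict _).integrable one_le_two
  have hper : ∀ {w : E d → ℂ}, MemLp w 2 → (∀ ξ, R < ‖ξ‖ → w ξ = 0) → ∀ z : Fin d → ℤ,
      ∫ ξ in unitCube d, expi (latticePt z) ξ * ∑ l ∈ s, w (ξ + latticePt l)
        = ∫ ξ, expi (latticePt z) ξ * w ξ := by
    intro w hw hwR z
    have hI : Integrable (fun ξ => expi (latticePt z) ξ * w ξ) :=
      (hint hw hwR).bdd_mul (continuous_expi _).aestronglyMeasurable
        (.of_forall fun ξ => (norm_expi _ _).le)
    have h1 := hasSum_integral_unitCube hI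
    have h2 : ∀ ξ l, expi (latticePt z) (ξ + latticePt l) = expi (latticePt z) ξ := by
      intro ξ l
      rw [expi_add_right]
      have : expi (latticePt z) (latticePt l) = 1 := by
        have h3 : inner ℝ (latticePt z) (latticePt l) = ((∑ i, l i * z i : ℤ) : ℝ) := by
          simp [PiLp.inner_apply, latticePt]
        rw [expi, h3, Real.fourierChar_apply, mul_assoc, mul_comm, Complex.exp_eq_one_iff]
        exact ⟨∑ i, l i * z i, by push_cast; ring⟩
      rw [this, mul_one]
    simp_rw [h2] at h1
    rw [← h1.tsum_eq, tsum_eq_sum (s := s)]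
    · rw [← integral_finsetSum]
      · simp_rw [Finset.mul_sum]
      · intro l _
        have := (hI.comp_add_right (latticePt l)).integrableOn (s := unitCube d)
        simp only [h2] at this
        exact this
    · intro l hl
      refine setIntegral_eq_zero_of_forall_eq_zero fun ξ hξ => ?_
      rw [hzero hwR l hl ξ hξ, mul_zero]
  have hPh : MemLp (fun ξ => ∑ l ∈ s, h (ξ + latticePt l)) 2 (volume.restrict (unitCube d)) :=
    (memLp_finsetSum s fun l _ => hmem hh l).restrict _
  have hPk : MemLp (fun ξ => ∑ l ∈ s, k (ξ + latticePt l)) 2 (volume.restrict (unitCube d)) :=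
    (memLp_finsetSum s fun l _ => hmem hk l).restrict _
  have main := hasSum_unitCube_mul_conj hPh hPk
  simp_rw [hper hh hhR, hper hk hkR] at main
  have hprod : ∀ l l' : Fin d → ℤ,
      Integrable (fun ξ => h (ξ + latticePt l) * conj (k (ξ + latticePt l'))) := fun l l' =>
    (hmem hh l).integrable_mul (hmem hk l').star
  -- The product of the two periodizations is a double sum over `l`, `l'`. Putting `l' = l + j` and
  -- summing over `l` first reassembles the cubes into all of `ℝ^d`.
  have hsum : HasSum (fun j : Fin d → ℤ => ∫ ξ, h ξ * conj (k (ξ + latticePt j)))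
      (∫ ξ in unitCube d, (∑ l ∈ s, h (ξ + latticePt l)) *
        conj (∑ l ∈ s, k (ξ + latticePt l))) := by
    have e1 : ∀ j : Fin d → ℤ, ∫ ξ, h ξ * conj (k (ξ + latticePt j))
        = ∑ l ∈ s, ∫ ξ in unitCube d, h (ξ + latticePt l) *
          conj (k (ξ + latticePt (l + j))) := by
      intro j
      have hI : Integrable (fun ξ => h ξ * conj (k (ξ + latticePt j))) := by
        simpa [latticePt_zero] using hprod 0 j
      rw [← (hasSum_integral_unitCube hI).tsum_eq, tsum_eq_sum (s := s)]
      · simp_rw [add_assoc, ← latticePt_add]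
      · intro l hl
        refine setIntegral_eq_zero_of_forall_eq_zero fun ξ hξ => ?_
        rw [hzero hhR l hl ξ hξ, zero_mul]
    have e2 : ∫ ξ in unitCube d, (∑ l ∈ s, h (ξ + latticePt l)) *
          conj (∑ l ∈ s, k (ξ + latticePt l))
        = ∑ l ∈ s, ∑ l' ∈ s, ∫ ξ in unitCube d, h (ξ + latticePt l) *
          conj (k (ξ + latticePt l')) := by
      simp_rw [map_sum, Finset.sum_mul_sum]
      rw [integral_finsetSum _ fun l _ =>
        integrable_finsetSum _ fun l' _ => (hprod l l').integrableOn]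
      refine Finset.sum_congr rfl fun l _ => ?_
      rw [integral_finsetSum _ fun l' _ => (hprod l l').integrableOn]
    rw [e2]
    simp_rw [e1]
    refine hasSum_sum fun l _ => ?_
    have h3 : HasSum (fun l' : Fin d → ℤ => ∫ ξ in unitCube d, h (ξ + latticePt l) *
        conj (k (ξ + latticePt l')))
        (∑ l' ∈ s, ∫ ξ in unitCube d, h (ξ + latticePt l) * conj (k (ξ + latticePt l'))) := by
      refine hasSum_sum_of_ne_finset_zero fun l' hl' => ?_
      refine setIntegral_eq_zero_of_forall_eq_zero fun ξ hξ => ?_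
      rw [hzero hkR l' hl' ξ hξ, map_zero, mul_zero]
    exact ((Equiv.addLeft l).hasSum_iff).mpr h3
  rw [hsum.tsum_eq]
  exact main

/-! ### Expanding lattice maps, and how often orbits and shifts meet an annulus. -/

section Expanding

open Filter Topology

/-- An invertible linear map that preserves the integer lattice and whose inverse powers tend to
zero in norm. -/
structure IsExpandingLattice (B : E d ≃L[ℝ] E d) : Prop where
  exists_latticePt : ∀ l : Fin d → ℤ, ∃ l' : Fin d → ℤ, B (latticePt l) = latticePt l'
  tendsto_norm : Tendsto (fun m : ℕ => ‖((B ^ (-(m : ℤ)) : E d ≃L[ℝ] E d) : E d →L[ℝ] E d)‖)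
    atTop (𝓝 0)

/-- Gelfand's formula: for `r` strictly between the spectral radius and `1`, eventually `‖a ^ n‖ ≤ r
^ n`. -/
theorem tendsto_pow_of_spectralRadius_lt_one {R : Type*} [NormedRing R] [NormedAlgebra ℂ R]
    [CompleteSpace R] {a : R} (ha : spectralRadius ℂ a < 1) :
    Tendsto (fun n : ℕ => a ^ n) atTop (𝓝 0) := by
  obtain ⟨r, hr1, hr2⟩ := ENNReal.lt_iff_exists_nnreal_btwn.mp ha
  have hr : r < 1 := by exact_mod_cast hr2
  have h := spectrum.pow_nnnorm_pow_one_div_tendsto_nhds_spectralRadius a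
  rw [tendsto_zero_iff_norm_tendsto_zero]
  refine squeeze_zero' (.of_forall fun _ => norm_nonneg _) ?_
    (tendsto_pow_atTop_nhds_zero_of_lt_one r.2 (by exact_mod_cast hr))
  filter_upwards [h.eventually_lt_const hr1, eventually_gt_atTop 0] with n h1 h2
  have h3 : (‖a ^ n‖₊ : ℝ≥0∞) ≤ (r : ℝ≥0∞) ^ n := by
    have h4 := ENNReal.rpow_le_rpow h1.le (z := (n : ℝ)) (by positivity)
    rwa [← ENNReal.rpow_mul, one_div_mul_cancel (by positivity), ENNReal.rpow_one,
      ENNReal.rpow_natCast] at h4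
  exact_mod_cast h3

-- Over `ℂ` the spectrum of the inverse consists of inverses of eigenvalues of `A`, so it lies in
-- the open unit disc and Gelfand's formula applies. Real parts of the entries then bring the limit
-- back to real matrices.
open scoped Matrix.Norms.L2Operator in
theorem IsExpansive.tendsto_inv_pow {A : GL (Fin d) ℝ} (hd : d ≠ 0)
    (hA : IsExpansive (A : Matrix (Fin d) (Fin d) ℝ)) :
    Tendsto (fun n : ℕ => (((A⁻¹ : GL (Fin d) ℝ) : Matrix (Fin d) (Fin d) ℝ) ^ n))
      atTop (𝓝 0) := by
  have : Nonempty (Fin d) := ⟨⟨0, Nat.pos_of_ne_zero hd⟩⟩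
  let φ : Matrix (Fin d) (Fin d) ℝ →+* Matrix (Fin d) (Fin d) ℂ := Complex.ofRealHom.mapMatrix
  let AC : (Matrix (Fin d) (Fin d) ℂ)ˣ := Units.map φ.toMonoidHom A
  have hsp : spectralRadius ℂ ((AC⁻¹ : (Matrix (Fin d) (Fin d) ℂ)ˣ) : Matrix (Fin d) (Fin d) ℂ)
      < 1 := by
    refine spectrum.spectralRadius_lt_of_forall_lt _ (r := 1) fun z hz => ?_
    have h0 : z ≠ 0 := spectrum.ne_zero_of_mem_of_unit hz
    have h1 : z⁻¹ ∈ spectrum ℂ (AC : Matrix (Fin d) (Fin d) ℂ) := by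
      have := (spectrum.inv_mem_iff (r := Units.mk0 z h0) (a := AC⁻¹)).mp hz
      simpa using this
    have h2 : Module.End.HasEigenvalue
        (Matrix.toLin' ((A : Matrix (Fin d) (Fin d) ℝ).map ((↑) : ℝ → ℂ))) z⁻¹ := by
      rw [Module.End.hasEigenvalue_iff_mem_spectrum, Matrix.spectrum_toLin']
      exact h1
    have h3 := hA _ h2
    rw [norm_inv] at h3
    exact_mod_cast (one_lt_inv₀ (norm_pos_iff.mpr h0)).mp h3
  have h := tendsto_pow_of_spectralRadius_lt_one hsp
  have hval : ((AC⁻¹ : (Matrix (Fin d) (Fin d) ℂ)ˣ) : Matrix (Fin d) (Fin d) ℂ)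
      = φ ((A⁻¹ : GL (Fin d) ℝ) : Matrix (Fin d) (Fin d) ℝ) := by
    rw [← map_inv]; rfl
  simp_rw [hval, ← map_pow] at h
  refine tendsto_pi_nhds.mpr fun i => tendsto_pi_nhds.mpr fun j => ?_
  have h5 := (tendsto_pi_nhds.mp (tendsto_pi_nhds.mp h i) j)
  have h6 := (Complex.continuous_re.tendsto _).comp h5
  simpa [φ, Function.comp_def] using h6

theorem isExpandingLattice_of_isExpansive {A : GL (Fin d) ℝ} (hd : d ≠ 0)
    (hA : IsExpansive (A : Matrix (Fin d) (Fin d) ℝ))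
    (hint : IsIntegralMatrix (A : Matrix (Fin d) (Fin d) ℝ)) :
    IsExpandingLattice (matEquiv (trGL A)) where
  exists_latticePt l := by
    choose m hm using hint
    refine ⟨fun i => ∑ j, m j i * l j, ?_⟩
    ext i
    rw [matEquiv_apply]
    simp [trGL, Matrix.toLpLin_apply, Matrix.mulVec, dotProduct, latticePt, hm]
  tendsto_norm := by
    have h1 : Tendsto (fun n : ℕ =>
        (((A⁻¹ : GL (Fin d) ℝ) : Matrix (Fin d) (Fin d) ℝ) ^ n).transpose) atTop (𝓝 0) := by
      have := (Continuous.matrix_transpose continuous_id).tendsto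
        (0 : Matrix (Fin d) (Fin d) ℝ) |>.comp (hA.tendsto_inv_pow hd)
      simpa only [id, Matrix.transpose_zero, Function.comp_def] using this
    have hcont : Continuous (fun M : Matrix (Fin d) (Fin d) ℝ =>
        Matrix.toEuclideanCLM (n := Fin d) (𝕜 := ℝ) M) :=
      LinearMap.continuous_of_finiteDimensional
        (Matrix.toEuclideanCLM (n := Fin d) (𝕜 := ℝ)).toAlgEquiv.toLinearMap
    have h2 := (hcont.norm.tendsto 0).comp h1
    simp only [map_zero, norm_zero] at h2
    refine h2.congr fun n => ?_
    simp only [Function.comp_apply]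
    congr 1
    ext1 x
    rw [← map_zpow, zpow_neg, ← inv_zpow, zpow_natCast]
    change _ = matEquiv ((trGL A)⁻¹ ^ n) x
    rw [matEquiv_apply, Matrix.transpose_pow, Units.val_pow_eq_pow_val]
    rfl

namespace IsExpandingLattice

variable {B : E d ≃L[ℝ] E d}

theorem exists_latticePt_pow (hB : IsExpandingLattice B) (n : ℕ) (l : Fin d → ℤ) :
    ∃ l' : Fin d → ℤ, (B ^ n) (latticePt l) = latticePt l' := by
  induction n with
  | zero => exact ⟨l, rfl⟩
  | succ n ih =>
    obtain ⟨l', h⟩ := ih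
    obtain ⟨l'', h'⟩ := hB.exists_latticePt l'
    exact ⟨l'', by rw [pow_succ']; change B ((B ^ n) (latticePt l)) = _; rw [h, h']⟩

theorem zpow_add_apply (B : E d ≃L[ℝ] E d) (m n : ℤ) (x : E d) :
    (B ^ (m + n)) x = (B ^ m) ((B ^ n) x) := by
  rw [zpow_add]; rfl

theorem zpow_neg_zpow_apply (B : E d ≃L[ℝ] E d) (m : ℤ) (x : E d) :
    (B ^ (-m)) ((B ^ m) x) = x := by
  rw [← zpow_add_apply, neg_add_cancel]; rfl

theorem zpow_zpow_neg_apply (B : E d ≃L[ℝ] E d) (m : ℤ) (x : E d) :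
    (B ^ m) ((B ^ (-m)) x) = x := by
  rw [← zpow_add_apply, add_neg_cancel]; rfl

theorem exists_norm_le (hB : IsExpandingLattice B) {c : ℝ} (hc : 0 < c) :
    ∃ m₀ : ℕ, ∀ j : ℤ, m₀ ≤ j → ∀ x, ‖(B ^ (-j)) x‖ ≤ c * ‖x‖ := by
  obtain ⟨m₀, h⟩ := eventually_atTop.mp (hB.tendsto_norm.eventually_lt_const hc)
  refine ⟨m₀, fun j hj x => ?_⟩
  lift j to ℕ using by omega
  refine (ContinuousLinearMap.le_opNorm
    ((B ^ (-(j : ℤ)) : E d ≃L[ℝ] E d) : E d →L[ℝ] E d) x).trans ?_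
  gcongr
  exact (h j (by exact_mod_cast hj)).le

theorem exists_norm_le_of_ge (hB : IsExpandingLattice B) (m₀ : ℤ) :
    ∃ C : ℝ, 0 ≤ C ∧ ∀ m : ℤ, m₀ ≤ m → ∀ x, ‖(B ^ (-m)) x‖ ≤ C * ‖x‖ := by
  obtain ⟨C, hC⟩ := hB.tendsto_norm.bddAbove_range
  have hC0 : 0 ≤ C := (norm_nonneg _).trans (hC ⟨0, rfl⟩)
  refine ⟨‖((B ^ (-m₀) : E d ≃L[ℝ] E d) : E d →L[ℝ] E d)‖ * C, by positivity, fun m hm x => ?_⟩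
  obtain ⟨j, hj⟩ := Int.eq_ofNat_of_zero_le (sub_nonneg.mpr hm)
  have h1 : -m = -m₀ + -(j : ℤ) := by omega
  rw [h1, zpow_add_apply, mul_assoc]
  refine (ContinuousLinearMap.le_opNorm
    ((B ^ (-m₀) : E d ≃L[ℝ] E d) : E d →L[ℝ] E d) _).trans ?_
  gcongr
  refine (ContinuousLinearMap.le_opNorm
    ((B ^ (-(j : ℤ)) : E d ≃L[ℝ] E d) : E d →L[ℝ] E d) _).trans ?_
  gcongr
  exact hC ⟨j, rfl⟩

end IsExpandingLattice

/-- A closed annulus centred at the origin. -/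
def annulus (d : ℕ) (a b : ℝ) : Set (E d) := {ξ | a ≤ ‖ξ‖ ∧ ‖ξ‖ ≤ b}

theorem measurableSet_annulus {a b : ℝ} : MeasurableSet (annulus d a b) :=
  (measurableSet_le measurable_const measurable_norm).inter
    (measurableSet_le measurable_norm measurable_const)

theorem volume_annulus_lt_top {a b : ℝ} : volume (annulus d a b) < ∞ :=
  (measure_mono fun ξ h => by simpa using h.2).trans_lt
    (measure_closedBall_lt_top (x := (0 : E d)) (r := b))

/-- The indicator function of an annulus, with values in `[0, ∞]`. -/
def annulusInd (d : ℕ) (a b : ℝ) : E d → ℝ≥0∞ := (annulus d a b).indicator 1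

theorem measurable_annulusInd {a b : ℝ} : Measurable (annulusInd d a b) :=
  measurable_one.indicator measurableSet_annulus

theorem annulusInd_le_one {a b : ℝ} (ξ : E d) : annulusInd d a b ξ ≤ 1 :=
  Set.indicator_le_self' (fun _ _ => zero_le) ξ

theorem annulusInd_of_mem {a b : ℝ} {ξ : E d} (h : ξ ∈ annulus d a b) : annulusInd d a b ξ = 1 :=
  Set.indicator_of_mem h _

theorem annulusInd_of_notMem {a b : ℝ} {ξ : E d} (h : ξ ∉ annulus d a b) :
    annulusInd d a b ξ = 0 :=
  Set.indicator_of_notMem h _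

/-- If `B^m η` and `B^n η` both lie in the annulus and `n - m ≥ m₀`, then `‖B^m η‖ ≤ a / (|b| + 1) *
‖B^n η‖ < a`, which is impossible. So an orbit visits the annulus only inside a window of bounded
length. -/
theorem IsExpandingLattice.exists_tsum_annulusInd_le {B : E d ≃L[ℝ] E d}
    (hB : IsExpandingLattice B) {a b : ℝ} (ha : 0 < a) :
    ∃ M : ℕ, ∀ η, ∑' m : ℤ, annulusInd d a b ((B ^ m) η) ≤ M := by
  obtain ⟨m₀, hm₀⟩ := hB.exists_norm_le (c := a / (|b| + 1)) (by positivity)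
  have key : ∀ η (m n : ℤ), (B ^ m) η ∈ annulus d a b → (B ^ n) η ∈ annulus d a b →
      n - m < m₀ := by
    intro η m n h1 h2
    by_contra! hlt
    have h3 := hm₀ (n - m) hlt ((B ^ n) η)
    rw [← IsExpandingLattice.zpow_add_apply, show -(n - m) + n = m by ring] at h3
    have h4 : a / (|b| + 1) * ‖(B ^ n) η‖ < a := by
      rw [div_mul_eq_mul_div, div_lt_iff₀ (by positivity)]
      have : ‖(B ^ n) η‖ < |b| + 1 := (h2.2.trans (le_abs_self b)).trans_lt (by linarith)
      nlinarith
    linarith [h1.1]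
  refine ⟨2 * m₀, fun η => ?_⟩
  by_cases hne : ∃ m₁ : ℤ, (B ^ m₁) η ∈ annulus d a b
  · obtain ⟨m₁, h1⟩ := hne
    rw [tsum_eq_sum (s := Finset.Ioo (m₁ - m₀) (m₁ + m₀))]
    · calc _ ≤ ∑ _m ∈ Finset.Ioo (m₁ - m₀) (m₁ + m₀), (1 : ℝ≥0∞) :=
            Finset.sum_le_sum fun m _ => annulusInd_le_one _
        _ ≤ _ := by
            rw [Finset.sum_const, Int.card_Ioo, nsmul_one]
            exact_mod_cast (by omega : (m₁ + m₀ - (m₁ - m₀) - 1).toNat ≤ 2 * m₀)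
    · intro m hm
      refine annulusInd_of_notMem fun h => hm ?_
      rw [Finset.mem_Ioo]
      have := key η m m₁ h h1
      have := key η m₁ m h1 h
      constructor <;> linarith
  · push Not at hne
    simp [annulusInd_of_notMem (hne _)]

section Scale

/-- The factor by which an invertible linear map scales Lebesgue measure. -/
def scale (e : E d ≃L[ℝ] E d) : ℝ := |LinearMap.det (e.toLinearEquiv : E d →ₗ[ℝ] E d)|

theorem scale_pos (e : E d ≃L[ℝ] E d) : 0 < scale e :=
  abs_pos.mpr e.toLinearEquiv.isUnit_det'.ne_zero

theorem map_volume (e : E d ≃L[ℝ] E d) :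
    Measure.map e volume = ENNReal.ofReal (scale e)⁻¹ • (volume : Measure (E d)) := by
  have := Measure.map_linearMap_addHaar_eq_smul_addHaar (volume : Measure (E d))
    (f := (e.toLinearEquiv : E d →ₗ[ℝ] E d)) e.toLinearEquiv.isUnit_det'.ne_zero
  rw [abs_inv] at this
  exact this

theorem lintegral_comp_equiv (e : E d ≃L[ℝ] E d) (f : E d → ℝ≥0∞) :
    ENNReal.ofReal (scale e) * ∫⁻ ξ, f (e ξ) = ∫⁻ ξ, f ξ := by
  have h := lintegral_map_equiv (μ := volume) f e.toHomeomorph.toMeasurableEquiv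
  change ∫⁻ a, f a ∂(Measure.map e volume) = ∫⁻ ξ, f (e ξ) at h
  rw [← h, map_volume, lintegral_smul_measure, smul_eq_mul, ← mul_assoc,
    ← ENNReal.ofReal_mul (scale_pos e).le, mul_inv_cancel₀ (scale_pos e).ne']
  simp

theorem integral_comp_equiv (e : E d ≃L[ℝ] E d) (f : E d → ℂ) :
    (scale e : ℂ) * ∫ ξ, f (e ξ) = ∫ ξ, f ξ := by
  have h := e.toHomeomorph.measurableEmbedding.integral_map (μ := volume) f
  change ∫ a, f a ∂(Measure.map e volume) = ∫ ξ, f (e ξ) at h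
  rw [← h, map_volume, integral_smul_measure,
    ENNReal.toReal_ofReal (inv_nonneg.mpr (scale_pos e).le), Complex.real_smul, ← mul_assoc,
    ← Complex.ofReal_mul, mul_inv_cancel₀ (scale_pos e).ne']
  simp

theorem quasiMeasurePreserving_equiv (e : E d ≃L[ℝ] E d) :
    Measure.QuasiMeasurePreserving e volume volume :=
  ⟨e.continuous.measurable, by rw [map_volume]; exact Measure.smul_absolutelyContinuous⟩

theorem volume_preimage_equiv (e : E d ≃L[ℝ] E d) {s : Set (E d)} (hs : MeasurableSet s) :
    ENNReal.ofReal (scale e) * volume (e ⁻¹' s) = volume s := by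
  have h := lintegral_comp_equiv e (s.indicator 1)
  rw [lintegral_indicator_one hs] at h
  rw [← h, ← lintegral_indicator_one (e.continuous.measurable hs)]
  rfl

end Scale

theorem volume_cubeAt (l : Fin d → ℤ) : volume (cubeAt l) = 1 := by
  rw [cubeAt, (measurePreserving_sub_right volume (latticePt l)).measure_preimage
    measurableSet_unitCube.nullMeasurableSet, volume_unitCube]

/-- A volume count. A shift joining two points of the annulus has norm at most `2|b|`. For `m ≥ -m₀`
the cells `B^{-m}(l + cube)` are disjoint, have volume `1 / scale (B ^ m)`, and stay within `C₀ √d`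
of `B^{-m} l`; those that count lie in one fixed ball. For `m < -m₀` every nonzero `B^{-m} l` is
already longer than `2|b|`. The index `l = 0` is excluded because it contributes at every `m`. -/
theorem IsExpandingLattice.exists_tsum_annulusInd_add_le {B : E d ≃L[ℝ] E d}
    (hB : IsExpandingLattice B) {a b : ℝ} :
    ∃ C : ℝ≥0∞, C ≠ ∞ ∧ ∀ (m : ℤ) (ξ : E d), ∑' l : Fin d → ℤ, (if l = 0 then 0 else
      annulusInd d a b ξ * annulusInd d a b (ξ + (B ^ (-m)) (latticePt l)))
        ≤ C * ENNReal.ofReal (scale (B ^ m)) * annulusInd d a b ξ := by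
  obtain ⟨m₀, hm₀⟩ := hB.exists_norm_le (c := 1 / (2 * |b| + 1)) (by positivity)
  obtain ⟨C₀, hC₀, hC⟩ := hB.exists_norm_le_of_ge (-m₀)
  refine ⟨volume (Metric.closedBall (0 : E d) (C₀ * √d + 2 * |b|)),
    measure_closedBall_lt_top.ne, fun m ξ => ?_⟩
  by_cases hξ : ξ ∈ annulus d a b
  swap
  · have : annulusInd d a b ξ = 0 := annulusInd_of_notMem hξ
    simp [this]
  have h1 : annulusInd d a b ξ = 1 := annulusInd_of_mem hξ
  have hsub : ∀ l : Fin d → ℤ, ξ + (B ^ (-m)) (latticePt l) ∈ annulus d a b →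
      ‖(B ^ (-m)) (latticePt l)‖ ≤ 2 * |b| := by
    intro l hl
    have := norm_sub_le (ξ + (B ^ (-m)) (latticePt l)) ξ
    rw [add_sub_cancel_left] at this
    linarith [hl.2, hξ.2, le_abs_self b]
  rw [h1]
  simp only [one_mul, mul_one]
  by_cases hm : -(m₀ : ℤ) ≤ m
  · calc _ ≤ ∑' l : Fin d → ℤ, ENNReal.ofReal (scale (B ^ m)) *
          volume ((B ^ m) ⁻¹' cubeAt l ∩ Metric.closedBall (0 : E d) (C₀ * √d + 2 * |b|)) := by
          refine ENNReal.tsum_le_tsum fun l => ?_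
          by_cases hl : ξ + (B ^ (-m)) (latticePt l) ∈ annulus d a b
          · rw [Set.inter_eq_left.mpr, volume_preimage_equiv _ (measurableSet_cubeAt l),
              volume_cubeAt]
            · split_ifs
              · simp
              · exact annulusInd_le_one _
            · intro y hy
              have h2 := norm_le_of_mem_unitCube (show _ ∈ unitCube d from hy)
              have h3 := hC m hm ((B ^ m) y - latticePt l)
              rw [map_sub, IsExpandingLattice.zpow_neg_zpow_apply] at h3
              have h4 := norm_le_norm_sub_add y ((B ^ (-m)) (latticePt l))
              have h5 := mul_le_mul_of_nonneg_left h2 hC₀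
              have h6 := hsub l hl
              rw [mem_closedBall_zero_iff]
              linarith
          · rw [annulusInd_of_notMem hl, ite_self]
            exact zero_le
      _ ≤ _ := by
          rw [ENNReal.tsum_mul_left, mul_comm]
          gcongr
          rw [← measure_iUnion]
          · exact measure_mono (Set.iUnion_subset fun l => Set.inter_subset_right)
          · intro l l' h
            exact ((pairwise_disjoint_cubeAt h).preimage _).mono Set.inter_subset_left
              Set.inter_subset_left
          · intro l
            exact ((B ^ m).continuous.measurable (measurableSet_cubeAt l)).inter
              Metric.isClosed_closedBall.measurableSet
  · rw [ENNReal.tsum_eq_zero.mpr]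
    · exact zero_le
    · intro l
      split_ifs with hl
      · rfl
      · refine annulusInd_of_notMem fun h => ?_
        have h2 := hsub l h
        have h3 := hm₀ (-m) (by omega) ((B ^ (-m)) (latticePt l))
        rw [IsExpandingLattice.zpow_neg_zpow_apply] at h3
        have h4 := one_le_norm_latticePt hl
        have h5 : 1 / (2 * |b| + 1) * ‖(B ^ (-m)) (latticePt l)‖ < 1 := by
          rw [div_mul_eq_mul_div, div_lt_iff₀ (by positivity)]
          linarith
        linarith

end Expanding

/-! ### Absolute convergence of the expansion. -/

section Summability

/-- A bounded measurable function supported in an annulus around the origin. -/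
structure IsBandLimited (F : E d → ℂ) : Prop where
  measurable : Measurable F
  exists_le : ∃ a b : ℝ, 0 < a ∧ ∃ M : NNReal, ∀ ξ, ‖F ξ‖ₑ ≤ M * annulusInd d a b ξ

theorem annulusInd_mono {a b a' b' : ℝ} (ha : a' ≤ a) (hb : b ≤ b') (ξ : E d) :
    annulusInd d a b ξ ≤ annulusInd d a' b' ξ :=
  Set.indicator_le_indicator_of_subset
    (show annulus d a b ⊆ annulus d a' b' from fun _ h => ⟨ha.trans h.1, h.2.trans hb⟩)
    (fun _ => zero_le) ξ

theorem IsBandLimited.exists_common {F G : E d → ℂ} (hF : IsBandLimited F)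
    (hG : IsBandLimited G) :
    ∃ a b : ℝ, 0 < a ∧ ∃ M : NNReal, (∀ ξ, ‖F ξ‖ₑ ≤ M * annulusInd d a b ξ) ∧
      ∀ ξ, ‖G ξ‖ₑ ≤ M * annulusInd d a b ξ := by
  obtain ⟨a, b, ha, M, h⟩ := hF.exists_le
  obtain ⟨a', b', ha', M', h'⟩ := hG.exists_le
  refine ⟨min a a', max b b', lt_min ha ha', max M M', fun ξ => (h ξ).trans ?_,
    fun ξ => (h' ξ).trans ?_⟩
  · gcongr
    · exact le_max_left _ _
    · exact annulusInd_mono (min_le_left _ _) (le_max_left _ _) ξ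
  · gcongr
    · exact le_max_right _ _
    · exact annulusInd_mono (min_le_right _ _) (le_max_right _ _) ξ

/-- A square integrable function whose dilates are locally square summable away from the origin. -/
structure IsSquareSummable (B : E d ≃L[ℝ] E d) (p : E d → ℂ) : Prop where
  measurable : Measurable p
  lintegral_ne_top : ∫⁻ ξ, ‖p ξ‖ₑ ^ 2 ≠ ∞
  annulus_ne_top : ∀ a b : ℝ, 0 < a →
    ∫⁻ ξ, annulusInd d a b ξ * ∑' m : ℤ, ‖p ((B ^ m) ξ)‖ₑ ^ 2 ≠ ∞

/-- The integrand of the `(m, α)` term in the expansion of the frame operator. -/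
def kern (B : E d ≃L[ℝ] E d) (F G p q : E d → ℂ) (m : ℤ) (α ξ : E d) : ℂ :=
  F ξ * conj (G (ξ + α)) * (conj (p ((B ^ m) ξ)) * q ((B ^ m) (ξ + α)))

variable {B : E d ≃L[ℝ] E d} {F G p q : E d → ℂ}

theorem measurable_kern (hF : Measurable F) (hG : Measurable G) (hp : Measurable p)
    (hq : Measurable q) (m : ℤ) (α : E d) : Measurable (kern B F G p q m α) := by
  have h1 : Measurable (fun ξ : E d => ξ + α) := by fun_prop
  have h2 : Measurable (B ^ m) := (B ^ m).continuous.measurable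
  exact (hF.mul (Complex.continuous_conj.measurable.comp (hG.comp h1))).mul
    ((Complex.continuous_conj.measurable.comp (hp.comp h2)).mul (hq.comp (h2.comp h1)))

/-- The terms with `l = 0` are controlled by `annulus_ne_top`. For `l ≠ 0` the lattice count
produces the factor `scale (B ^ m)`, exactly the Jacobian of `ξ ↦ B^m ξ`. After substitution the sum
over `m` falls on the indicator alone, where bounded orbit visits leave a multiple of `∫ |p|²`. -/
theorem tsum_lintegral_annulusInd_ne_top (hB : IsExpandingLattice B)
    (hp : IsSquareSummable B p) {a b : ℝ} (ha : 0 < a) :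
    ∑' x : ℤ × (Fin d → ℤ), ∫⁻ ξ, annulusInd d a b ξ *
      annulusInd d a b (ξ + (B ^ (-x.1)) (latticePt x.2)) * ‖p ((B ^ x.1) ξ)‖ₑ ^ 2 ≠ ∞ := by
  obtain ⟨C, hC, hcount⟩ := hB.exists_tsum_annulusInd_add_le (a := a) (b := b)
  obtain ⟨M, hM⟩ := hB.exists_tsum_annulusInd_le (b := b) ha
  have hBm : ∀ m : ℤ, Measurable (B ^ m) := fun m => (B ^ m).continuous.measurable
  have hpm : ∀ m : ℤ, Measurable fun ξ => ‖p ((B ^ m) ξ)‖ₑ ^ 2 := fun m =>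
    ((hp.measurable.comp (hBm m)).enorm).pow_const 2
  have hadd : ∀ α : E d, Measurable fun ξ => annulusInd d a b ξ * annulusInd d a b (ξ + α) :=
    fun α => measurable_annulusInd.mul (measurable_annulusInd.comp (by fun_prop))
  have hoff : ∑' m : ℤ, ∫⁻ ξ, (∑' l : Fin d → ℤ, (if l = 0 then 0 else
      annulusInd d a b ξ * annulusInd d a b (ξ + (B ^ (-m)) (latticePt l)))) *
        ‖p ((B ^ m) ξ)‖ₑ ^ 2 ≤ C * (M * ∫⁻ ξ, ‖p ξ‖ₑ ^ 2) := by
    calc _ ≤ ∑' m : ℤ, C * ∫⁻ η, annulusInd d a b ((B ^ (-m)) η) * ‖p η‖ₑ ^ 2 := by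
          refine ENNReal.tsum_le_tsum fun m => ?_
          rw [← lintegral_comp_equiv (B ^ m)
            (fun η => annulusInd d a b ((B ^ (-m)) η) * ‖p η‖ₑ ^ 2), ← mul_assoc,
            ← lintegral_const_mul]
          · refine lintegral_mono fun ξ => ?_
            simp only [IsExpandingLattice.zpow_neg_zpow_apply]
            rw [← mul_assoc]
            gcongr
            exact hcount m ξ
          · simp only [IsExpandingLattice.zpow_neg_zpow_apply]
            exact measurable_annulusInd.mul (hpm m)
      _ = C * ∫⁻ η, (∑' m : ℤ, annulusInd d a b ((B ^ (-m)) η)) * ‖p η‖ₑ ^ 2 := by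
          rw [ENNReal.tsum_mul_left, ← lintegral_tsum]
          · simp_rw [ENNReal.tsum_mul_right]
          · exact fun m => ((measurable_annulusInd.comp (hBm _)).mul
              (hp.measurable.enorm.pow_const 2)).aemeasurable
      _ ≤ _ := by
          gcongr
          rw [← lintegral_const_mul _ (hp.measurable.enorm.pow_const 2)]
          refine lintegral_mono fun η => ?_
          gcongr
          exact ((Equiv.neg ℤ).tsum_eq (fun m => annulusInd d a b ((B ^ m) η))).trans_le (hM η)
  have hdiag : ∑' m : ℤ, ∫⁻ ξ, annulusInd d a b ξ * ‖p ((B ^ m) ξ)‖ₑ ^ 2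
      = ∫⁻ ξ, annulusInd d a b ξ * ∑' m : ℤ, ‖p ((B ^ m) ξ)‖ₑ ^ 2 := by
    simp_rw [← ENNReal.tsum_mul_left]
    exact (lintegral_tsum fun m => (measurable_annulusInd.mul (hpm m)).aemeasurable).symm
  refine ne_top_of_le_ne_top (ENNReal.add_ne_top.mpr ⟨hp.annulus_ne_top a b ha,
    ENNReal.mul_ne_top hC (ENNReal.mul_ne_top (ENNReal.natCast_ne_top M)
      hp.lintegral_ne_top)⟩) (le_trans ?_ (add_le_add hdiag.le hoff))
  rw [ENNReal.tsum_prod', ← ENNReal.tsum_add]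
  refine ENNReal.tsum_le_tsum fun m => ?_
  simp_rw [← ENNReal.tsum_mul_right]
  rw [lintegral_tsum]
  · rw [ENNReal.tsum_eq_add_tsum_ite (0 : Fin d → ℤ)]
    refine add_le_add (lintegral_mono fun ξ => ?_) (ENNReal.tsum_le_tsum fun l => ?_)
    · gcongr
      exact mul_le_of_le_one_right' (annulusInd_le_one _)
    · split_ifs <;> simp
  · intro l
    split_ifs
    · simp
    · exact ((hadd _).mul (hpm m)).aemeasurable

theorem tsum_lintegral_kern_ne_top (hB : IsExpandingLattice B) (hF : IsBandLimited F)
    (hG : IsBandLimited G) (hp : IsSquareSummable B p) (hq : IsSquareSummable B q) :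
    ∑' x : ℤ × (Fin d → ℤ), ∫⁻ ξ, ‖kern B F G p q x.1 ((B ^ (-x.1)) (latticePt x.2)) ξ‖ₑ
      ≠ ∞ := by
  obtain ⟨a, b, ha, M, hFM, hGM⟩ := hF.exists_common hG
  have hp' := tsum_lintegral_annulusInd_ne_top hB hp (b := b) ha
  have hq' := tsum_lintegral_annulusInd_ne_top hB hq (b := b) ha
  -- The bound `|pq| ≤ |p|² + |q|²` leaves `q` evaluated at `B^m(ξ + α)`. Translating by `α` brings
  -- it to the form already bounded, but with shift `-α`, hence the reindexing `l ↦ -l`.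
  rw [← ((Equiv.refl ℤ).prodCongr (Equiv.neg (Fin d → ℤ))).tsum_eq] at hq'
  refine ne_top_of_le_ne_top (ENNReal.mul_ne_top (a := (M : ℝ≥0∞) ^ 2) (by simp)
    (ENNReal.add_ne_top.mpr ⟨hp', hq'⟩)) ?_
  rw [← ENNReal.tsum_add, ← ENNReal.tsum_mul_left]
  refine ENNReal.tsum_le_tsum fun ⟨m, l⟩ => ?_
  simp only [Equiv.prodCongr_apply, Prod.map_apply, Equiv.refl_apply, Equiv.neg_apply,
    latticePt_neg, map_neg]
  set α := (B ^ (-m)) (latticePt l)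
  have hBm : Measurable (B ^ m) := (B ^ m).continuous.measurable
  have hsq : ∀ x y : ℝ≥0∞, x * y ≤ x ^ 2 + y ^ 2 := by
    intro x y
    rcases le_total x y with h | h
    · calc x * y ≤ y * y := by gcongr
        _ ≤ _ := by rw [sq y]; exact le_add_self
    · calc x * y ≤ x * x := by gcongr
        _ ≤ _ := by rw [sq x]; exact le_self_add
  have htr : ∫⁻ ξ, annulusInd d a b ξ * annulusInd d a b (ξ + -α) * ‖q ((B ^ m) ξ)‖ₑ ^ 2
      = ∫⁻ ξ, annulusInd d a b ξ * annulusInd d a b (ξ + α) * ‖q ((B ^ m) (ξ + α))‖ₑ ^ 2 := by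
    rw [← lintegral_add_right_eq_self _ α]
    simp only [add_neg_cancel_right]
    refine lintegral_congr fun ξ => ?_
    ring
  rw [htr, ← lintegral_add_left, ← lintegral_const_mul]
  · refine lintegral_mono fun ξ => ?_
    simp only [kern, enorm_mul, RCLike.enorm_conj]
    calc _ ≤ (M * annulusInd d a b ξ) * (M * annulusInd d a b (ξ + α)) *
          (‖p ((B ^ m) ξ)‖ₑ ^ 2 + ‖q ((B ^ m) (ξ + α))‖ₑ ^ 2) := by
          gcongr
          · exact hFM ξ
          · exact hGM _
          · exact hsq _ _
      _ = _ := by ring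
  · have h1 : Measurable (fun ξ : E d => ξ + α) := by fun_prop
    exact ((measurable_annulusInd.mul (measurable_annulusInd.comp h1)).mul
      ((hp.measurable.comp hBm).enorm.pow_const 2)).add
      ((measurable_annulusInd.mul (measurable_annulusInd.comp h1)).mul
      ((hq.measurable.comp (hBm.comp h1)).enorm.pow_const 2))
  · exact (measurable_annulusInd.mul (measurable_annulusInd.comp (by fun_prop))).mul
      ((hp.measurable.comp hBm).enorm.pow_const 2)

theorem integrable_kern (hB : IsExpandingLattice B) (hF : IsBandLimited F)
    (hG : IsBandLimited G) (hp : IsSquareSummable B p) (hq : IsSquareSummable B q)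
    (m : ℤ) (l : Fin d → ℤ) : Integrable (kern B F G p q m ((B ^ (-m)) (latticePt l))) := by
  refine ⟨(measurable_kern hF.measurable hG.measurable hp.measurable hq.measurable _ _
    ).aestronglyMeasurable, ?_⟩
  exact (ENNReal.ne_top_of_tsum_ne_top (tsum_lintegral_kern_ne_top hB hF hG hp hq)
    (m, l)).lt_top

theorem summable_integral_kern (hB : IsExpandingLattice B) (hF : IsBandLimited F)
    (hG : IsBandLimited G) (hp : IsSquareSummable B p) (hq : IsSquareSummable B q) :
    Summable fun x : ℤ × (Fin d → ℤ) =>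
      ∫ ξ, kern B F G p q x.1 ((B ^ (-x.1)) (latticePt x.2)) ξ := by
  have h := tsum_lintegral_kern_ne_top hB hF hG hp hq
  refine Summable.of_norm_bounded (ENNReal.summable_toReal h) fun x => ?_
  rw [← integral_norm_eq_lintegral_enorm
    (integrable_kern hB hF hG hp hq x.1 x.2).aestronglyMeasurable]
  exact norm_integral_le_integral_norm _

end Summability

/-! ### Band-limited test functions. -/

section BandLimited

theorem IsBandLimited.norm_le {F : E d → ℂ} (hF : IsBandLimited F) : ∃ M : ℝ, ∀ ξ, ‖F ξ‖ ≤ M := by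
  obtain ⟨a, b, ha, M, h⟩ := hF.exists_le
  refine ⟨M, fun ξ => ?_⟩
  have h1 : ‖F ξ‖ₑ ≤ M := (h ξ).trans (mul_le_of_le_one_right' (annulusInd_le_one ξ))
  rw [enorm_le_coe] at h1
  exact_mod_cast h1

theorem IsBandLimited.exists_eq_zero {F : E d → ℂ} (hF : IsBandLimited F) :
    ∃ R : ℝ, 0 < R ∧ ∀ ξ, R < ‖ξ‖ → F ξ = 0 := by
  obtain ⟨a, b, ha, M, h⟩ := hF.exists_le
  refine ⟨max b 1, by positivity, fun ξ hξ => ?_⟩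
  have h1 := h ξ
  rw [annulusInd_of_notMem fun h' =>
    absurd (h'.2.trans (le_max_left b 1)) (not_le.mpr hξ), mul_zero] at h1
  simpa using h1

theorem IsBandLimited.memLp {F : E d → ℂ} (hF : IsBandLimited F) : MemLp F 2 := by
  obtain ⟨a, b, ha, M, h⟩ := hF.exists_le
  refine ⟨hF.measurable.aestronglyMeasurable, ?_⟩
  rw [eLpNorm_lt_top_iff_lintegral_rpow_enorm_lt_top (by simp) (by simp)]
  simp only [ENNReal.toReal_ofNat, ENNReal.rpow_ofNat]
  calc ∫⁻ ξ, ‖F ξ‖ₑ ^ 2 ≤ ∫⁻ ξ, (M : ℝ≥0∞) ^ 2 * annulusInd d a b ξ := by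
        refine lintegral_mono fun ξ => ?_
        calc ‖F ξ‖ₑ ^ 2 ≤ (M * annulusInd d a b ξ) ^ 2 := by gcongr; exact h ξ
          _ ≤ _ := by
            rw [mul_pow, sq (annulusInd d a b ξ)]
            gcongr
            exact mul_le_of_le_one_right' (annulusInd_le_one ξ)
    _ < ∞ := by
        rw [lintegral_const_mul _ measurable_annulusInd, annulusInd,
          lintegral_indicator_one measurableSet_annulus]
        exact ENNReal.mul_lt_top (by simp) volume_annulus_lt_top

/-- Every square integrable function is a Fourier transform. -/
theorem exists_fourier_ae_eq {F : E d → ℂ} (hF : MemLp F 2) :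
    ∃ f : L2 d, (𝓕 f : L2 d) =ᵐ[volume] F := by
  refine ⟨(Lp.fourierTransformₗᵢ (E d) ℂ).symm hF.toLp, ?_⟩
  have h : 𝓕 ((Lp.fourierTransformₗᵢ (E d) ℂ).symm hF.toLp) = hF.toLp :=
    LinearIsometryEquiv.apply_symm_apply _ _
  rw [h]
  exact hF.coeFn_toLp

theorem inner_eq_integral_fourier (f g : L2 d) :
    inner ℂ f g = ∫ ξ, conj ((𝓕 f) ξ) * (𝓕 g) ξ := by
  rw [← Lp.inner_fourier_eq, L2.inner_def]
  simp only [RCLike.inner_apply']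

end BandLimited

/-! ### The sum over one dilation level. -/

section Levels

theorem trGL_zpow (A : GL (Fin d) ℝ) (n : ℤ) : trGL (A ^ n) = trGL A ^ n := by
  ext1
  rw [Matrix.coe_units_zpow]
  change ((A ^ n : GL (Fin d) ℝ) : Matrix (Fin d) (Fin d) ℝ).transpose = _
  rw [Matrix.coe_units_zpow, Matrix.transpose_zpow]
  rfl

theorem scale_matEquiv (M : GL (Fin d) ℝ) :
    scale (matEquiv M) = |(M : Matrix (Fin d) (Fin d) ℝ).det| := by
  rw [← det_toEuclideanLin]; rfl

/-- The Fourier transform of the integer powers of the dilation by `A`. -/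
theorem coeFn_fourier_dilation_zpow (A : GL (Fin d) ℝ) (n : ℤ) (f : L2 d) :
    (𝓕 ((dilation A ^ (-n)) f) : L2 d) =ᵐ[volume] fun ξ =>
      ((√(scale (matEquiv (trGL A) ^ n)) : ℝ) : ℂ) * (𝓕 f) ((matEquiv (trGL A) ^ n) ξ) := by
  rw [dilation_zpow, fourier_dilation, trGL_zpow, ← zpow_neg, neg_neg, ← map_zpow, scale_matEquiv]
  exact coeFn_dilation _ _

/-- The unitary dilation is moved onto `f`, so that `z` enters only through the character of `ℤ^d`
and the values are Fourier coefficients of a periodization. -/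
theorem inner_affineSystem (A : GL (Fin d) ℝ) (ψ f : L2 d) {F : E d → ℂ}
    (hf : (𝓕 f : L2 d) =ᵐ[volume] F) (n : ℤ) (z : Fin d → ℤ) :
    inner ℂ (affineSystem A ψ (n, z)) f = ∫ ξ, expi (latticePt z) ξ *
      (((√(scale (matEquiv (trGL A) ^ n)) : ℝ) : ℂ) * F ((matEquiv (trGL A) ^ n) ξ) *
        conj ((𝓕 ψ) ξ)) := by
  have h1 : f = (dilation A ^ n) ((dilation A ^ (-n)) f) := by
    change f = (dilation A ^ n * dilation A ^ (-n)) f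
    rw [← zpow_add, add_neg_cancel]; rfl
  have h2 : inner ℂ (affineSystem A ψ (n, z)) f
      = inner ℂ (translation (latticePt z) ψ) ((dilation A ^ (-n)) f) := by
    conv_lhs => rw [h1]
    exact LinearIsometryEquiv.inner_map_map _ _ _
  rw [h2, inner_eq_integral_fourier, fourier_translation]
  refine integral_congr_ae ?_
  filter_upwards [coeFn_fourier_dilation_zpow A n f, coeFn_modulate (-latticePt z) (𝓕 ψ),
    (quasiMeasurePreserving_equiv (matEquiv (trGL A) ^ n)).ae hf] with ξ h2 h3 h4
  rw [h2, h3, h4, map_mul, expi_neg_left, RCLike.conj_conj]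
  ring

/-- The quasi-affine system of a single function. -/
def quasiAffineSystem (A : GL (Fin d) ℝ) (ψ : L2 d) : ℤ × (Fin d → ℤ) → L2 d :=
  fun x => if 0 ≤ x.1 then affineSystem A ψ x
    else translation (latticePt x.2) (((sqrtDet A ^ x.1 : ℂˣ) : ℂ) • (dilation A ^ x.1) ψ)

theorem scale_mul (e e' : E d ≃L[ℝ] E d) : scale (e * e') = scale e * scale e' := by
  rw [scale, scale, scale, ← abs_mul, ← LinearMap.det_comp]; rfl

theorem scale_one : scale (1 : E d ≃L[ℝ] E d) = 1 := by
  have : (((1 : E d ≃L[ℝ] E d).toLinearEquiv : E d →ₗ[ℝ] E d)) = LinearMap.id := rfl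
  rw [scale, this, LinearMap.det_id, abs_one]

/-- The renormalization in the quasi-affine system cancels the normalizing factor of the unitary
dilation on the Fourier side, leaving plain `ψ̂(B^{-n} ξ)`. -/
theorem sqrt_scale_zpow (A : GL (Fin d) ℝ) (n : ℤ) :
    ((sqrtDet A ^ n : ℂˣ) : ℂ) * ((√(scale (matEquiv (trGL A) ^ (-n))) : ℝ) : ℂ) = 1 := by
  let φ : (E d ≃L[ℝ] E d) →* ℝ :=
    { toFun := fun e => √(scale e)
      map_one' := by rw [scale_one, Real.sqrt_one]
      map_mul' := fun e e' => by rw [scale_mul, Real.sqrt_mul (scale_pos e).le] }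
  have h1 : √(scale (matEquiv (trGL A) ^ (-n))) = √(scale (matEquiv (trGL A))) ^ (-n) :=
    map_zpow' φ (fun e => eq_inv_of_mul_eq_one_left (by rw [← map_mul]; simp)) _ _
  have h2 : ((sqrtDet A : ℂˣ) : ℂ) = ((√(scale (matEquiv (trGL A))) : ℝ) : ℂ) := by
    rw [scale_matEquiv, det_trGL]; rfl
  rw [h1, Units.val_zpow_eq_zpow_val, Complex.ofReal_zpow, ← h2, ← zpow_add₀ (Units.ne_zero _),
    add_neg_cancel, zpow_zero]

theorem inner_quasiAffineSystem_of_neg (A : GL (Fin d) ℝ) (ψ f : L2 d) {F : E d → ℂ}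
    (hf : (𝓕 f : L2 d) =ᵐ[volume] F) {n : ℤ} (hn : n < 0) (z : Fin d → ℤ) :
    inner ℂ (quasiAffineSystem A ψ (n, z)) f = ∫ ξ, expi (latticePt z) ξ *
      (F ξ * conj ((𝓕 ψ) ((matEquiv (trGL A) ^ (-n)) ξ))) := by
  rw [quasiAffineSystem, if_neg (not_le.mpr hn), inner_eq_integral_fourier, fourier_translation]
  have h5 := coeFn_fourier_dilation_zpow A (-n) ψ
  rw [neg_neg] at h5
  refine integral_congr_ae ?_
  have h0 : 𝓕 ((((sqrtDet A ^ n : ℂˣ) : ℂ)) • (dilation A ^ n) ψ)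
      = (((sqrtDet A ^ n : ℂˣ) : ℂ)) • 𝓕 ((dilation A ^ n) ψ) :=
    (Lp.fourierTransformₗᵢ (E d) ℂ).map_smul _ _
  filter_upwards [hf, coeFn_modulate (-latticePt z)
    (𝓕 ((((sqrtDet A ^ n : ℂˣ) : ℂ)) • (dilation A ^ n) ψ)), h5,
    Lp.coeFn_smul (((sqrtDet A ^ n : ℂˣ) : ℂ)) (𝓕 ((dilation A ^ n) ψ))] with ξ h2 h3 h4 h6
  rw [h2, h3, h0, h6, Pi.smul_apply, h4, smul_eq_mul, ← mul_assoc (((sqrtDet A ^ n : ℂˣ) : ℂ)),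
    sqrt_scale_zpow, one_mul, map_mul, expi_neg_left, RCLike.conj_conj]
  ring

variable {A : GL (Fin d) ℝ} {ψ φ f g : L2 d} {F G : E d → ℂ}

theorem memLp_mul_of_bound {u v : E d → ℂ} (hu : Measurable u) {M : ℝ} (hM : ∀ ξ, ‖u ξ‖ ≤ M)
    (hv : MemLp v 2) : MemLp (fun ξ => u ξ * v ξ) 2 :=
  MemLp.of_le_mul (c := M) hv (hu.aestronglyMeasurable.mul hv.1) (.of_forall fun ξ => by
    rw [norm_mul]; gcongr; exact hM ξ)

theorem memLp_comp_equiv (e : E d ≃L[ℝ] E d) {v : E d → ℂ} (hv : MemLp v 2) :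
    MemLp (fun ξ => v (e ξ)) 2 := by
  have h : MemLp v 2 (Measure.map e volume) := by
    rw [map_volume]
    exact hv.smul_measure ENNReal.ofReal_ne_top
  exact h.comp_of_map e.continuous.measurable.aemeasurable

/-- The sum over one level of the affine system. -/
theorem hasSum_affineSystem_level (hF : IsBandLimited F) (hG : IsBandLimited G)
    (hf : (𝓕 f : L2 d) =ᵐ[volume] F) (hg : (𝓕 g : L2 d) =ᵐ[volume] G) (n : ℤ) :
    HasSum (fun z => inner ℂ (affineSystem A ψ (n, z)) f *
      conj (inner ℂ (affineSystem A φ (n, z)) g))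
      (∑' l : Fin d → ℤ, ∫ ξ, kern (matEquiv (trGL A)) F G (𝓕 ψ : L2 d) (𝓕 φ : L2 d) (-n)
        ((matEquiv (trGL A) ^ n) (latticePt l)) ξ) := by
  simp only [inner_affineSystem A _ _ hf, inner_affineSystem A _ _ hg]
  set B := matEquiv (trGL A)
  have hmem : ∀ {F : E d → ℂ} (ψ : L2 d), IsBandLimited F → MemLp (fun ξ =>
      ((√(scale (B ^ n)) : ℝ) : ℂ) * F ((B ^ n) ξ) * conj ((𝓕 ψ) ξ)) 2 := by
    intro F ψ hF
    obtain ⟨M, hM⟩ := hF.norm_le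
    refine memLp_mul_of_bound (M := √(scale (B ^ n)) * M)
      ((hF.measurable.comp (B ^ n).continuous.measurable).const_mul _) (fun ξ => ?_)
      (Lp.memLp (𝓕 ψ)).star
    rw [norm_mul, Complex.norm_real, Real.norm_of_nonneg (Real.sqrt_nonneg _)]
    gcongr
    exact hM _
  have hsupp : ∀ {F : E d → ℂ}, IsBandLimited F → ∃ R, 0 < R ∧ ∀ ξ, R < ‖ξ‖ →
      F ((B ^ n) ξ) = 0 := by
    intro F hF
    obtain ⟨R, hR, h⟩ := hF.exists_eq_zero
    refine ⟨(‖((B ^ (-n) : E d ≃L[ℝ] E d) : E d →L[ℝ] E d)‖ + 1) * R, by positivity,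
      fun ξ hξ => h _ ?_⟩
    by_contra! hle
    have h1 := ContinuousLinearMap.le_opNorm ((B ^ (-n) : E d ≃L[ℝ] E d) : E d →L[ℝ] E d)
      ((B ^ n) ξ)
    rw [ContinuousLinearEquiv.coe_coe, IsExpandingLattice.zpow_neg_zpow_apply] at h1
    have h2 := mul_le_mul_of_nonneg_left hle
      (norm_nonneg ((B ^ (-n) : E d ≃L[ℝ] E d) : E d →L[ℝ] E d))
    linarith
  obtain ⟨R, hR, h1⟩ := hsupp hF
  obtain ⟨R', hR', h2⟩ := hsupp hG
  have key := hasSum_integral_expi_mul_conj (hmem ψ hF) (hmem φ hG) (R := max R R')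
    (fun ξ hξ => by rw [h1 ξ ((le_max_left _ _).trans_lt hξ)]; simp)
    (fun ξ hξ => by rw [h2 ξ ((le_max_right _ _).trans_lt hξ)]; simp)
  convert key using 1
  refine tsum_congr fun l => ?_
  -- The Jacobian of `ξ ↦ B^n ξ` accounts for the two factors `√(scale (B ^ n))`, and the
  -- substitution matches the shift `B^n l` with the integer shift `l`.
  rw [← integral_comp_equiv (B ^ n), ← integral_const_mul]
  refine integral_congr_ae (.of_forall fun ξ => ?_)
  have h3 : (scale (B ^ n) : ℂ) = ((√(scale (B ^ n)) : ℝ) : ℂ) * ((√(scale (B ^ n)) : ℝ) : ℂ) := by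
    rw [← Complex.ofReal_mul, Real.mul_self_sqrt (scale_pos _).le]
  simp only [kern, ← map_add (B ^ n), IsExpandingLattice.zpow_neg_zpow_apply, map_mul,
    RCLike.conj_conj, Complex.conj_ofReal, h3]
  ring

/-- The sum over one negative level of the quasi-affine system. -/
theorem hasSum_quasiAffineSystem_level_of_neg (hF : IsBandLimited F) (hG : IsBandLimited G)
    (hf : (𝓕 f : L2 d) =ᵐ[volume] F) (hg : (𝓕 g : L2 d) =ᵐ[volume] G) {n : ℤ} (hn : n < 0) :
    HasSum (fun z => inner ℂ (quasiAffineSystem A ψ (n, z)) f *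
      conj (inner ℂ (quasiAffineSystem A φ (n, z)) g))
      (∑' l : Fin d → ℤ, ∫ ξ, kern (matEquiv (trGL A)) F G (𝓕 ψ : L2 d) (𝓕 φ : L2 d) (-n)
        (latticePt l) ξ) := by
  simp only [inner_quasiAffineSystem_of_neg A _ _ hf hn,
    inner_quasiAffineSystem_of_neg A _ _ hg hn]
  set B := matEquiv (trGL A)
  have hmem : ∀ {F : E d → ℂ} (ψ : L2 d), IsBandLimited F → MemLp (fun ξ =>
      F ξ * conj ((𝓕 ψ) ((B ^ (-n)) ξ))) 2 := by
    intro F ψ hF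
    obtain ⟨M, hM⟩ := hF.norm_le
    exact memLp_mul_of_bound hF.measurable hM (memLp_comp_equiv _ (Lp.memLp (𝓕 ψ))).star
  obtain ⟨R, hR, h1⟩ := hF.exists_eq_zero
  obtain ⟨R', hR', h2⟩ := hG.exists_eq_zero
  have key := hasSum_integral_expi_mul_conj (hmem ψ hF) (hmem φ hG) (R := max R R')
    (fun ξ hξ => by rw [h1 ξ ((le_max_left _ _).trans_lt hξ)]; simp)
    (fun ξ hξ => by rw [h2 ξ ((le_max_right _ _).trans_lt hξ)]; simp)
  convert key using 1
  refine tsum_congr fun l => integral_congr_ae (.of_forall fun ξ => ?_)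
  simp only [kern, map_mul, RCLike.conj_conj]
  ring

end Levels

/-! ### Uniqueness of coefficients of absolutely convergent trigonometric series. -/

section AlmostPeriodic

open Filter Topology

theorem integral_gaussian_mul_expi {b : ℝ} (hb : 0 < b) (w : E d) :
    ∫ x : E d, Complex.exp (-b * ‖x‖ ^ 2) * expi x w
      = (Real.pi / b : ℂ) ^ ((d : ℂ) / 2) * (Real.exp (-(Real.pi ^ 2 * ‖w‖ ^ 2 / b)) : ℝ) := by
  have h := GaussianFourier.integral_cexp_neg_mul_sq_norm_add (V := E d) (b := (b : ℂ))
    (by simpa using hb) (2 * Real.pi * Complex.I) w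
  rw [finrank_euclideanSpace_fin] at h
  convert h using 1
  · refine integral_congr_ae (.of_forall fun x => ?_)
    simp only [expi, Real.fourierChar_apply]
    rw [← Complex.exp_add, real_inner_comm]
    congr 1
    push_cast
    ring
  · rw [Complex.ofReal_exp]
    congr 2
    have : (b : ℂ) ≠ 0 := by exact_mod_cast hb.ne'
    push_cast
    rw [mul_pow, Complex.I_sq]
    field_simp
    ring

theorem integrable_gaussian {b : ℝ} (hb : 0 < b) :
    Integrable fun x : E d => Complex.exp (-b * ‖x‖ ^ 2) := by
  simpa using GaussianFourier.integrable_cexp_neg_mul_sq_norm_add (V := E d) (b := (b : ℂ))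
    (by simpa using hb) 0 0

/-- Integrate the series termwise against a Gaussian times `e^{-2πi x·β}`: each frequency `α i` is
weighted by a Gaussian in `α i - β`, and the common constant cancels. -/
theorem tsum_mul_gaussian {ι : Type*} [Countable ι] {t : ι → ℂ} {α : ι → E d} {s : ℂ}
    (ht : Summable t) (hs : ∀ x : E d, ∑' i, t i * expi x (α i) = s) (β : E d) {b : ℝ}
    (hb : 0 < b) :
    ∑' i, t i * (Real.exp (-(Real.pi ^ 2 * ‖α i - β‖ ^ 2 / b)) : ℝ)
      = s * (Real.exp (-(Real.pi ^ 2 * ‖β‖ ^ 2 / b)) : ℝ) := by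
  have hpi : (Real.pi / b : ℂ) ^ ((d : ℂ) / 2) ≠ 0 := by
    rw [Complex.cpow_ne_zero_iff]
    left
    exact_mod_cast (div_pos Real.pi_pos hb).ne'
  have hint : ∀ w : E d, Integrable fun x => Complex.exp (-b * ‖x‖ ^ 2) * expi x w := fun w =>
    (integrable_gaussian hb).mul_bdd (c := 1) (by
      have : Continuous fun x : E d => expi x w := by
        unfold expi
        exact continuous_subtype_val.comp
          (Real.continuous_fourierChar.comp (continuous_id.inner continuous_const))
      exact this.aestronglyMeasurable) (.of_forall fun x => (norm_expi x w).le)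
  have h1 := hasSum_integral_of_summable_integral_norm (μ := (volume : Measure (E d)))
    (F := fun i x => t i * (Complex.exp (-b * ‖x‖ ^ 2) * expi x (α i - β)))
    (fun i => (hint _).const_mul _) (by
      simp only [norm_mul, norm_expi, mul_one, integral_const_mul]
      exact ht.norm.mul_right _)
  have h2 : ∀ x : E d, ∑' i, t i * (Complex.exp (-b * ‖x‖ ^ 2) * expi x (α i - β))
      = s * (Complex.exp (-b * ‖x‖ ^ 2) * expi x (-β)) := by
    intro x
    rw [← hs x, ← tsum_mul_right]
    refine tsum_congr fun i => ?_
    rw [sub_eq_add_neg, expi_add_right]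
    ring
  simp_rw [h2, integral_const_mul, integral_gaussian_mul_expi hb, norm_neg] at h1
  have h3 := h1.tsum_eq
  refine mul_left_cancel₀ hpi ?_
  rw [← tsum_mul_left]
  calc _ = _ := tsum_congr fun i => by ring
    _ = _ := h3
    _ = _ := by ring

/-- The coefficients of an absolutely convergent trigonometric series are determined by its sum. -/
theorem tsum_fiber_eq_of_tsum_mul_expi_eq {ι : Type*} [Countable ι] {t : ι → ℂ} {α : ι → E d}
    {s : ℂ} (ht : Summable t) (hs : ∀ x : E d, ∑' i, t i * expi x (α i) = s) (β : E d) :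
    ∑' i : α ⁻¹' {β}, t i = if β = 0 then s else 0 := by
  classical
  have hg : ∀ w : E d, Tendsto (fun n : ℕ =>
      ((Real.exp (-(Real.pi ^ 2 * ‖w‖ ^ 2 / (1 / ((n : ℝ) + 1)))) : ℝ) : ℂ)) atTop
      (𝓝 (if w = 0 then 1 else 0)) := by
    intro w
    split_ifs with hw
    · simp [hw]
    · rw [← Complex.ofReal_zero]
      refine (Complex.continuous_ofReal.tendsto _).comp ?_
      refine Real.tendsto_exp_neg_atTop_nhds_zero.comp ?_
      have hp : 0 < Real.pi ^ 2 * ‖w‖ ^ 2 := by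
        have := norm_pos_iff.mpr hw
        have := Real.pi_pos
        positivity
      simp_rw [div_div_eq_mul_div, div_one]
      exact (tendsto_natCast_atTop_atTop.atTop_add tendsto_const_nhds).const_mul_atTop hp
  -- With `b = 1 / (n + 1)` tending to `0`, the weights tend to the indicator of `α i = β`, so the
  -- limit is the sum over the fibre.
  have h1 := tendsto_tsum_of_dominated_convergence (bound := fun i => ‖t i‖)
    (f := fun (n : ℕ) i => t i *
      ((Real.exp (-(Real.pi ^ 2 * ‖α i - β‖ ^ 2 / (1 / ((n : ℝ) + 1)))) : ℝ) : ℂ))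
    ht.norm (fun i => (hg (α i - β)).const_mul (t i)) (.of_forall fun n i => by
      rw [norm_mul, Complex.norm_real, Real.norm_of_nonneg (Real.exp_nonneg _)]
      refine mul_le_of_le_one_right (norm_nonneg _) (Real.exp_le_one_iff.mpr ?_)
      rw [neg_nonpos]
      positivity)
  have h2 : ∀ n : ℕ, ∑' i, t i *
      ((Real.exp (-(Real.pi ^ 2 * ‖α i - β‖ ^ 2 / (1 / ((n : ℝ) + 1)))) : ℝ) : ℂ)
      = s * ((Real.exp (-(Real.pi ^ 2 * ‖β‖ ^ 2 / (1 / ((n : ℝ) + 1)))) : ℝ) : ℂ) := fun n =>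
    tsum_mul_gaussian ht hs β (by positivity)
  simp_rw [h2] at h1
  have h3 := tendsto_nhds_unique h1 ((hg β).const_mul s)
  rw [tsum_subtype, mul_ite, mul_one, mul_zero] at *
  rw [← h3]
  refine tsum_congr fun i => ?_
  simp only [Set.indicator_apply, Set.mem_preimage, Set.mem_singleton_iff, sub_eq_zero, mul_ite,
    mul_one, mul_zero]

end AlmostPeriodic

/-! ### The pairs `(m, l)` sharing a given shift. -/

section Fibers

variable {B : E d ≃L[ℝ] E d}

/-- The shift `B^{-m} l` attached to the index `(m, l)`. -/
def shift (B : E d ≃L[ℝ] E d) (x : ℤ × (Fin d → ℤ)) : E d := (B ^ (-x.1)) (latticePt x.2)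

/-- The integer vector `B^j k`. -/
def latPow (hB : IsExpandingLattice B) (j : ℕ) (k : Fin d → ℤ) : Fin d → ℤ :=
  (hB.exists_latticePt_pow j k).choose

theorem latticePt_latPow (hB : IsExpandingLattice B) (j : ℕ) (k : Fin d → ℤ) :
    latticePt (latPow hB j k) = (B ^ (j : ℤ)) (latticePt k) := by
  rw [zpow_natCast]
  exact (hB.exists_latticePt_pow j k).choose_spec.symm

theorem shift_eq_zero_iff {x : ℤ × (Fin d → ℤ)} : shift B x = 0 ↔ x.2 = 0 := by
  rw [shift, map_eq_zero_iff _ (B ^ (-x.1)).injective, ← latticePt_zero,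
    latticePt_injective.eq_iff]

theorem shift_preimage_zero :
    shift B ⁻¹' {0} = Set.range fun m : ℤ => (m, (0 : Fin d → ℤ)) := by
  ext ⟨m, l⟩
  rw [Set.mem_preimage, Set.mem_singleton_iff, shift_eq_zero_iff]
  simp [eq_comm]

theorem shift_latPow (hB : IsExpandingLattice B) (n : ℤ) (k : Fin d → ℤ) (j : ℕ) :
    shift B (j - n, latPow hB j k) = (B ^ n) (latticePt k) := by
  rw [shift, latticePt_latPow, ← IsExpandingLattice.zpow_add_apply]
  congr 2
  ring

/-- `B^{-m} l = B^n k` means `l = B^{m+n} k`. If `m + n` were negative, `k` would be a positive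
power of `B` applied to `l`, contrary to `hk`; so `j = m + n` is a natural number. -/
theorem shift_preimage_singleton (hB : IsExpandingLattice B) (n : ℤ) {k : Fin d → ℤ}
    (hk : ¬ ∃ l, latticePt k = B (latticePt l)) :
    shift B ⁻¹' {(B ^ n) (latticePt k)}
      = Set.range fun j : ℕ => ((j : ℤ) - n, latPow hB j k) := by
  ext ⟨m, l⟩
  constructor
  · intro h
    replace h : (B ^ (-m)) (latticePt l) = (B ^ n) (latticePt k) := h
    have hl : latticePt l = (B ^ (m + n)) (latticePt k) := by
      rw [IsExpandingLattice.zpow_add_apply, ← h, IsExpandingLattice.zpow_zpow_neg_apply]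
    have hmn : 0 ≤ m + n := by
      by_contra! hlt
      obtain ⟨j, hj⟩ := Int.eq_ofNat_of_zero_le (show 0 ≤ -(m + n) - 1 by omega)
      refine hk ⟨latPow hB j l, ?_⟩
      rw [latticePt_latPow, hl, ← IsExpandingLattice.zpow_add_apply]
      have : B ((B ^ ((j : ℤ) + (m + n))) (latticePt k))
          = (B ^ (1 + ((j : ℤ) + (m + n)))) (latticePt k) := by
        rw [IsExpandingLattice.zpow_add_apply B 1, zpow_one,
          IsExpandingLattice.zpow_add_apply]
      rw [this, show 1 + ((j : ℤ) + (m + n)) = 0 by omega]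
      rfl
    obtain ⟨j, hj⟩ := Int.eq_ofNat_of_zero_le hmn
    refine ⟨j, Prod.ext (by simp only; omega) (latticePt_injective ?_)⟩
    rw [latticePt_latPow, hl, hj]
  · rintro ⟨j, hj⟩
    rw [Set.mem_preimage, ← hj, shift_latPow]
    rfl

/-- Extract from `l` the largest power of `B`. It exists because `B^{-j} l` becomes shorter than `1`
for large `j`, while nonzero lattice points have norm at least `1`. -/
theorem exists_shift_eq (hB : IsExpandingLattice B) {x : ℤ × (Fin d → ℤ)}
    (hx : shift B x ≠ 0) :
    ∃ (n : ℤ) (k : Fin d → ℤ), (¬ ∃ l, latticePt k = B (latticePt l)) ∧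
      shift B x = (B ^ n) (latticePt k) := by
  obtain ⟨m, l⟩ := x
  have hl : l ≠ 0 := by simpa [shift_eq_zero_iff] using hx
  obtain ⟨m₀, hm₀⟩ := hB.exists_norm_le (c := 1 / (‖latticePt l‖ + 1)) (by positivity)
  have hbound : ∀ j : ℕ, (∃ k, latticePt l = (B ^ (j : ℤ)) (latticePt k)) → j ≤ m₀ := by
    rintro j ⟨k, hk⟩
    by_contra! hlt
    have h1 := hm₀ j (by exact_mod_cast hlt.le) (latticePt l)
    have hk0 : k ≠ 0 := by
      rintro rfl
      rw [latticePt_zero, map_zero, ← latticePt_zero] at hk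
      exact hl (latticePt_injective hk)
    have h2 := one_le_norm_latticePt hk0
    have h3 : (B ^ (-(j : ℤ))) (latticePt l) = latticePt k := by
      rw [hk, IsExpandingLattice.zpow_neg_zpow_apply]
    rw [h3, div_mul_eq_mul_div, le_div_iff₀ (by positivity)] at h1
    nlinarith [norm_nonneg (latticePt l)]
  classical
  let P : ℕ → Prop := fun j => ∃ k, latticePt l = (B ^ (j : ℤ)) (latticePt k)
  have hP0 : P 0 := ⟨l, rfl⟩
  obtain ⟨k, hk⟩ : P (Nat.findGreatest P m₀) := Nat.findGreatest_spec (Nat.zero_le _) hP0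
  set j := Nat.findGreatest P m₀
  refine ⟨-m + j, k, ?_, ?_⟩
  · rintro ⟨l', hl'⟩
    have h4 : P (j + 1) := by
      refine ⟨l', ?_⟩
      rw [hk, hl']
      push_cast
      rw [IsExpandingLattice.zpow_add_apply, zpow_one]
    have := Nat.le_findGreatest (hbound _ h4) h4
    omega
  · rw [shift, hk, ← IsExpandingLattice.zpow_add_apply]

end Fibers

/-! ### From fibre sums to pointwise multipliers. -/

section Multipliers

variable {B : E d ≃L[ℝ] E d} {F G p q : E d → ℂ} {c : ℂ}

theorem ae_summable_of_tsum_lintegral_ne_top {ι : Type*} [Countable ι] {f : ι → E d → ℂ}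
    (hf : ∀ i, Measurable (f i)) (h : ∑' i, ∫⁻ ξ, ‖f i ξ‖ₑ ≠ ∞) :
    ∀ᵐ ξ, Summable fun i => f i ξ := by
  rw [← lintegral_tsum fun i => (hf i).enorm.aemeasurable] at h
  filter_upwards [ae_lt_top' (AEMeasurable.tsum fun i => (hf i).enorm.aemeasurable) h]
    with ξ hξ
  refine Summable.of_norm ((ENNReal.summable_toReal hξ.ne).congr fun i => ?_)
  simp

theorem integrable_tsum_of_tsum_lintegral_ne_top {ι : Type*} [Countable ι] {f : ι → E d → ℂ}
    (hf : ∀ i, Measurable (f i)) (h : ∑' i, ∫⁻ ξ, ‖f i ξ‖ₑ ≠ ∞) :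
    Integrable fun ξ => ∑' i, f i ξ := by
  constructor
  · exact (Measurable.tsum hf).aestronglyMeasurable
  · refine lt_of_le_of_lt (lintegral_mono fun ξ => enorm_tsum_le_tsum_enorm) ?_
    rw [lintegral_tsum fun i => (hf i).enorm.aemeasurable]
    exact h.lt_top

/-- The terms of the expansion of the frame operator for shifts in `S`. -/
def term (B : E d ≃L[ℝ] E d) (S : Set (E d)) (F G p q : E d → ℂ) (x : ℤ × (Fin d → ℤ)) : ℂ :=
  S.indicator (fun α => ∫ ξ, kern B F G p q x.1 α ξ) (shift B x)

theorem summable_term (hB : IsExpandingLattice B) (S : Set (E d)) (hF : IsBandLimited F)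
    (hG : IsBandLimited G) (hp : IsSquareSummable B p) (hq : IsSquareSummable B q) :
    Summable (term B S F G p q) :=
  Summable.of_norm_bounded (summable_integral_kern hB hF hG hp hq).norm fun _ =>
    norm_indicator_le_norm_self
      (fun α => ∫ ξ, kern B F G p q _ α ξ) _

variable {N : Type*} {e : N → ℤ × (Fin d → ℤ)} {β : E d}

theorem kern_eq_mul (m : ℤ) (α ξ : E d) : kern B F G p q m α ξ
    = F ξ * conj (G (ξ + α)) * (conj (p ((B ^ m) ξ)) * q ((B ^ m) (ξ + α))) := rfl

theorem tsum_lintegral_kern_fiber_ne_top (hB : IsExpandingLattice B) (hF : IsBandLimited F)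
    (hG : IsBandLimited G) (hp : IsSquareSummable B p) (hq : IsSquareSummable B q)
    (he : Function.Injective e) (hβ : ∀ j, shift B (e j) = β) :
    ∑' j, ∫⁻ ξ, ‖kern B F G p q (e j).1 β ξ‖ₑ ≠ ∞ := by
  refine ne_top_of_le_ne_top (tsum_lintegral_kern_ne_top hB hF hG hp hq)
    (le_trans (le_of_eq (tsum_congr fun j => ?_)) (ENNReal.tsum_comp_le_tsum_of_injective he _))
  rw [← hβ j]; rfl

theorem integrable_tsum_kern_fiber [Countable N] (hB : IsExpandingLattice B) (hF : IsBandLimited F)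
    (hG : IsBandLimited G) (hp : IsSquareSummable B p) (hq : IsSquareSummable B q)
    (he : Function.Injective e) (hβ : ∀ j, shift B (e j) = β) :
    Integrable fun ξ => ∑' j, kern B F G p q (e j).1 β ξ :=
  integrable_tsum_of_tsum_lintegral_ne_top
    (fun _ => measurable_kern hF.measurable hG.measurable hp.measurable hq.measurable _ _)
    (tsum_lintegral_kern_fiber_ne_top hB hF hG hp hq he hβ)

/-- Absolute convergence along the fibre allows sum and integral to be exchanged, so the whole fibre
acts through a single multiplier function. -/
theorem tsum_term_fiber [Countable N] (hB : IsExpandingLattice B) {S : Set (E d)}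
    (hF : IsBandLimited F)
    (hG : IsBandLimited G) (hp : IsSquareSummable B p) (hq : IsSquareSummable B q)
    (he : Function.Injective e) (hrange : shift B ⁻¹' {β} = Set.range e) (hS : β ∈ S) :
    ∑' x : shift B ⁻¹' {β}, term B S F G p q x
      = ∫ ξ, F ξ * conj (G (ξ + β)) *
        ∑' j, conj (p ((B ^ (e j).1) ξ)) * q ((B ^ (e j).1) (ξ + β)) := by
  have hβ : ∀ j, shift B (e j) = β := fun j => by
    have : e j ∈ shift B ⁻¹' {β} := hrange ▸ Set.mem_range_self j
    exact this
  rw [hrange, tsum_range _ he]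
  simp_rw [← tsum_mul_left, ← kern_eq_mul]
  rw [integral_tsum (fun j => (measurable_kern hF.measurable hG.measurable hp.measurable
    hq.measurable _ _).aestronglyMeasurable)
    (tsum_lintegral_kern_fiber_ne_top hB hF hG hp hq he hβ)]
  refine tsum_congr fun j => ?_
  rw [term, hβ, Set.indicator_of_mem hS]

theorem isBandLimited_indicator {s : Set (E d)} (hs : MeasurableSet s) {a b : ℝ} (ha : 0 < a)
    (hsub : s ⊆ annulus d a b) : IsBandLimited (s.indicator 1) where
  measurable := measurable_one.indicator hs
  exists_le := by
    refine ⟨a, b, ha, 1, fun ξ => ?_⟩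
    by_cases hξ : ξ ∈ s
    · simp [hξ, annulusInd_of_mem (hsub hξ)]
    · simp [hξ]

/-- The annulus with radii `1 / (n + 1)` and `n + 1`. -/
def exhaustion (d : ℕ) (n : ℕ) : Set (E d) := annulus d (1 / ((n : ℝ) + 1)) (n + 1)

theorem eventually_mem_exhaustion {x : E d} (hx : x ≠ 0) :
    ∀ᶠ n : ℕ in Filter.atTop, x ∈ exhaustion d n := by
  have h1 := (tendsto_one_div_add_atTop_nhds_zero_nat (𝕜 := ℝ)).eventually_le_const
    (norm_pos_iff.mpr hx)
  have h2 := (tendsto_natCast_atTop_atTop (R := ℝ)).eventually_ge_atTop ‖x‖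
  filter_upwards [h1, h2] with n h1 h2
  exact ⟨h1, by linarith⟩

theorem exists_mem_exhaustion {x y : E d} (hx : x ≠ 0) (hy : y ≠ 0) :
    ∃ n, x ∈ exhaustion d n ∧ y ∈ exhaustion d n :=
  ((eventually_mem_exhaustion hx).and (eventually_mem_exhaustion hy)).exists

/-- Take `F` the indicator of `s ∩ K` and `G` that of `K`, with `K` an annulus: the multiplier and
the constant `c` then have equal integrals over every measurable part of `K ∩ (K - β)`, hence agree
there almost everywhere. As `K` grows only `ξ = 0` and `ξ = -β` are missed, and these are null
because `d ≠ 0`. -/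
theorem ae_hasSum_of_forall_integral_eq [Countable N] (hd : d ≠ 0) (hB : IsExpandingLattice B)
    (hp : IsSquareSummable B p) (hq : IsSquareSummable B q)
    (he : Function.Injective e) (hβ : ∀ j, shift B (e j) = β)
    (h : ∀ F G : E d → ℂ, IsBandLimited F → IsBandLimited G → ∫ ξ, F ξ * conj (G (ξ + β)) *
        ∑' j, conj (p ((B ^ (e j).1) ξ)) * q ((B ^ (e j).1) (ξ + β))
        = c * ∫ ξ, F ξ * conj (G (ξ + β))) :
    ∀ᵐ ξ, HasSum (fun j => conj (p ((B ^ (e j).1) ξ)) * q ((B ^ (e j).1) (ξ + β))) c := by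
  have : Nonempty (Fin d) := ⟨⟨0, Nat.pos_of_ne_zero hd⟩⟩
  have : Nontrivial (E d) := inferInstance
  have hK : ∀ n, MeasurableSet (exhaustion d n) := fun n => measurableSet_annulus
  have hn : ∀ n : ℕ, (0 : ℝ) < 1 / (n + 1) := fun n => by positivity
  have hbl : ∀ n, IsBandLimited ((exhaustion d n).indicator (1 : E d → ℂ)) := fun n =>
    isBandLimited_indicator (hK n) (hn n) subset_rfl
  have hadd : Measurable fun ξ : E d => ξ + β := by fun_prop
  have key : ∀ n : ℕ, ∀ᵐ ξ, ξ ∈ exhaustion d n → ξ + β ∈ exhaustion d n →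
      HasSum (fun j => conj (p ((B ^ (e j).1) ξ)) * q ((B ^ (e j).1) (ξ + β))) c := by
    intro n
    set D : Set (E d) := exhaustion d n ∩ (fun ξ => ξ + β) ⁻¹' exhaustion d n
    have hD : MeasurableSet D := (hK n).inter (hadd (hK n))
    have hprod : ∀ ξ, (exhaustion d n).indicator (1 : E d → ℂ) ξ *
        conj ((exhaustion d n).indicator (1 : E d → ℂ) (ξ + β)) = D.indicator 1 ξ := by
      intro ξ
      by_cases h1 : ξ ∈ exhaustion d n <;> by_cases h2 : ξ + β ∈ exhaustion d n <;>
        simp [h1, h2, D]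
    have hint1 := integrable_tsum_kern_fiber hB (hbl n) (hbl n) hp hq he hβ
    simp_rw [kern_eq_mul, tsum_mul_left, hprod] at hint1
    have hint2 : Integrable fun ξ => c * D.indicator (1 : E d → ℂ) ξ := by
      refine Integrable.const_mul ?_ c
      rw [integrable_indicator_iff hD]
      exact integrableOn_const
        ((measure_mono Set.inter_subset_left).trans_lt volume_annulus_lt_top).ne
    have heq := hint1.ae_eq_of_forall_setIntegral_eq _ _ hint2 fun s hs _ => by
      have hs' : MeasurableSet (s ∩ exhaustion d n) := hs.inter (hK n)
      have h1 := h _ _ (isBandLimited_indicator hs' (hn n) Set.inter_subset_right) (hbl n)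
      have h2 : ∀ ξ, (s ∩ exhaustion d n).indicator (1 : E d → ℂ) ξ *
          conj ((exhaustion d n).indicator (1 : E d → ℂ) (ξ + β))
          = s.indicator (D.indicator 1) ξ := by
        intro ξ
        by_cases h1 : ξ ∈ s
        · rw [Set.indicator_of_mem h1, ← hprod, ← Set.indicator_indicator,
            Set.indicator_of_mem h1]
        · simp [h1]
      simp_rw [h2, ← integral_const_mul] at h1
      rw [← integral_indicator hs, ← integral_indicator hs]
      convert h1 using 1 <;>
      · refine integral_congr_ae (.of_forall fun ξ => ?_)
        by_cases h1 : ξ ∈ s <;> simp [h1]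
    filter_upwards [heq, ae_summable_of_tsum_lintegral_ne_top
      (fun j => measurable_kern (hbl n).measurable (hbl n).measurable hp.measurable hq.measurable
        (e j).1 β) (tsum_lintegral_kern_fiber_ne_top hB (hbl n) (hbl n) hp hq he hβ)]
      with ξ h1 h2 h3 h4
    have h5 : ξ ∈ D := ⟨h3, h4⟩
    simp only [kern_eq_mul, hprod, Set.indicator_of_mem h5, Pi.one_apply, one_mul, mul_one]
      at h1 h2
    rw [← h1]
    exact h2.hasSum
  have h0 : ∀ x : E d, ∀ᵐ ξ, ξ ≠ x := fun x => by
    simp [ae_iff, measure_singleton]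
  filter_upwards [ae_all_iff.mpr key, h0 0, h0 (-β)] with ξ h1 h2 h3
  obtain ⟨n, h4, h5⟩ := exists_mem_exhaustion h2
    (show ξ + β ≠ 0 from fun h => h3 (eq_neg_of_add_eq_zero_left h))
  exact h1 n h4 h5

end Multipliers

/-! ### The equations are equivalent to the identity for the series. -/

section Characterization

variable {B : E d ≃L[ℝ] E d} {p q : E d → ℂ} {c : ℂ} {S : Set (E d)}

theorem IsBandLimited.expi_mul {F : E d → ℂ} (hF : IsBandLimited F) (x : E d) :
    IsBandLimited fun ξ => expi x ξ * F ξ where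
  measurable := (continuous_expi x).measurable.mul hF.measurable
  exists_le := by
    obtain ⟨a, b, ha, M, h⟩ := hF.exists_le
    refine ⟨a, b, ha, M, fun ξ => ?_⟩
    have h1 : ‖expi x ξ‖ₑ = 1 := by rw [← ofReal_norm, norm_expi, ENNReal.ofReal_one]
    rw [enorm_mul, h1, one_mul]
    exact h ξ

theorem conj_expi_mul_expi_add (x ξ α : E d) (u v : ℂ) :
    expi (-x) ξ * u * conj (expi (-x) (ξ + α) * v) = u * conj v * expi x α := by
  simp only [expi_neg_left, map_mul, RCLike.conj_conj, expi_add_right]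
  linear_combination u * conj v * expi x α * conj_expi_mul_expi x ξ

/-- Modulating `F` and `G` by the same character amounts to translating `f` and `g` by `x`. The
characters cancel except for their values at the shift, which is what separates the fibres. -/
theorem term_expi (F G : E d → ℂ) (x : E d) (y : ℤ × (Fin d → ℤ)) :
    term B S (fun ξ => expi (-x) ξ * F ξ) (fun ξ => expi (-x) ξ * G ξ) p q y
      = term B S F G p q y * expi x (shift B y) := by
  by_cases hy : shift B y ∈ S
  · rw [term, term, Set.indicator_of_mem hy, Set.indicator_of_mem hy, ← integral_mul_const]
    refine integral_congr_ae (.of_forall fun ξ => ?_)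
    simp only [kern_eq_mul, conj_expi_mul_expi_add]
    ring
  · simp [term, hy]

/-- The characterizing equations for a dual pair, on the Fourier side. -/
structure SatisfiesDualEquations (B : E d ≃L[ℝ] E d) (p q : E d → ℂ) (c : ℂ) : Prop where
  diagonal : ∀ᵐ ξ, HasSum (fun m : ℤ => conj (p ((B ^ m) ξ)) * q ((B ^ m) ξ)) c
  offDiagonal : ∀ k : Fin d → ℤ, (¬ ∃ l, latticePt k = B (latticePt l)) → ∀ᵐ ξ,
    HasSum (fun n : ℕ => conj (p ((B ^ (n : ℤ)) ξ)) * q ((B ^ (n : ℤ)) (ξ + latticePt k))) 0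

theorem injective_fiber_zero : Function.Injective fun m : ℤ => (m, (0 : Fin d → ℤ)) :=
  fun _ _ h => congrArg Prod.fst h

theorem injective_fiber (hB : IsExpandingLattice B) (n : ℤ) (k : Fin d → ℤ) :
    Function.Injective fun j : ℕ => ((j : ℤ) - n, latPow hB j k) := by
  intro i j h
  have := congrArg Prod.fst h
  simp only at this
  omega

/-- The right-hand side does not change when `F` and `G` are modulated together, so by `term_expi` a
trigonometric series in `x` is constant and its coefficients are known. Only the fibres over `0` and
over integer vectors `k` are read off, hence the weak requirement on `S`. -/
theorem satisfiesDualEquations_of_tsum_eq (hd : d ≠ 0) (hB : IsExpandingLattice B)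
    (hp : IsSquareSummable B p) (hq : IsSquareSummable B q) (hS : Set.range latticePt ⊆ S)
    (h : ∀ F G : E d → ℂ, IsBandLimited F → IsBandLimited G →
      ∑' x, term B S F G p q x = c * ∫ ξ, F ξ * conj (G ξ)) :
    SatisfiesDualEquations B p q c := by
  have hfib : ∀ F G : E d → ℂ, IsBandLimited F → IsBandLimited G → ∀ β,
      ∑' x : shift B ⁻¹' {β}, term B S F G p q x
        = if β = 0 then c * ∫ ξ, F ξ * conj (G ξ) else 0 := by
    intro F G hF hG
    refine tsum_fiber_eq_of_tsum_mul_expi_eq (summable_term hB S hF hG hp hq) fun x => ?_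
    simp_rw [← term_expi]
    rw [h _ _ (hF.expi_mul _) (hG.expi_mul _)]
    congr 1
    refine integral_congr_ae (.of_forall fun ξ => ?_)
    have := conj_expi_mul_expi_add x ξ 0 (F ξ) (G ξ)
    simpa [expi] using this
  constructor
  · have h0 : (0 : E d) ∈ S := hS ⟨0, latticePt_zero⟩
    have := ae_hasSum_of_forall_integral_eq (c := c) (β := 0) hd hB hp hq
      (injective_fiber_zero (d := d)) (fun m => shift_eq_zero_iff.mpr rfl) fun F G hF hG => by
        rw [← tsum_term_fiber hB hF hG hp hq injective_fiber_zero shift_preimage_zero h0,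
          hfib F G hF hG, if_pos rfl]
        simp
    simpa using this
  · intro k hk
    have hk0 : latticePt k ≠ 0 := fun h0 => hk ⟨0, by rw [h0, latticePt_zero, map_zero]⟩
    have h1 := shift_preimage_singleton hB 0 hk
    have h2 : (B ^ (0 : ℤ)) (latticePt k) = latticePt k := rfl
    rw [h2] at h1
    have := ae_hasSum_of_forall_integral_eq (c := 0) (β := latticePt k) hd hB hp hq
      (injective_fiber hB 0 k) (fun j => shift_latPow hB 0 k j) fun F G hF hG => by
        rw [← tsum_term_fiber hB hF hG hp hq (injective_fiber hB 0 k) h1 (hS ⟨k, rfl⟩),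
          hfib F G hF hG, if_neg hk0, zero_mul]
    simpa using this

/-- Sum fibre by fibre. The fibre over `0` gives `c`; the one over `B^n k` vanishes by the
off-diagonal equation at the point `B^{-n} ξ`. Each fibre vanishes on its own, so discarding some of
them by means of `S` is harmless. -/
theorem SatisfiesDualEquations.tsum_eq (hB : IsExpandingLattice B)
    (hp : IsSquareSummable B p) (hq : IsSquareSummable B q) (hS : (0 : E d) ∈ S)
    (h : SatisfiesDualEquations B p q c) {F G : E d → ℂ} (hF : IsBandLimited F)
    (hG : IsBandLimited G) : ∑' x, term B S F G p q x = c * ∫ ξ, F ξ * conj (G ξ) := by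
  have h1 := (summable_term hB S hF hG hp hq).hasSum.tsum_fiberwise (shift B)
  rw [← h1.tsum_eq, tsum_eq_single (0 : E d)]
  · rw [tsum_term_fiber hB hF hG hp hq injective_fiber_zero shift_preimage_zero hS,
      ← integral_const_mul]
    refine integral_congr_ae ?_
    filter_upwards [h.diagonal] with ξ hξ
    simp only [add_zero]
    rw [hξ.tsum_eq, mul_comm]
  · intro β hβ
    by_cases hβS : β ∈ S
    swap
    · refine (tsum_congr fun x => ?_).trans tsum_zero
      rw [term, show shift B x = β from x.2, Set.indicator_of_notMem hβS]
    by_cases hne : (shift B ⁻¹' {β}).Nonempty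
    swap
    · rw [Set.not_nonempty_iff_eq_empty] at hne
      have : IsEmpty (shift B ⁻¹' {β}) := Set.isEmpty_coe_sort.mpr hne
      exact tsum_empty
    obtain ⟨x, hx⟩ := hne
    replace hx : shift B x = β := hx
    obtain ⟨n, k, hk, hβk⟩ := exists_shift_eq hB (hx.trans_ne hβ)
    rw [hx] at hβk
    subst hβk
    rw [tsum_term_fiber hB hF hG hp hq (injective_fiber hB n k)
      (shift_preimage_singleton hB n hk) hβS, ← integral_zero (E d) ℂ]
    refine integral_congr_ae ?_
    filter_upwards [(quasiMeasurePreserving_equiv (B ^ (-n))).ae (h.offDiagonal k hk)] with ξ hξ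
    have h3 : ∀ j : ℕ, conj (p ((B ^ ((j : ℤ) - n)) ξ)) *
        q ((B ^ ((j : ℤ) - n)) (ξ + (B ^ n) (latticePt k)))
        = conj (p ((B ^ (j : ℤ)) ((B ^ (-n)) ξ))) *
        q ((B ^ (j : ℤ)) ((B ^ (-n)) ξ + latticePt k)) := by
      intro j
      rw [sub_eq_add_neg, IsExpandingLattice.zpow_add_apply, IsExpandingLattice.zpow_add_apply,
        map_add (B ^ (-n)), IsExpandingLattice.zpow_neg_zpow_apply]
    simp only [h3, hξ.tsum_eq, mul_zero]

end Characterization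

/-! ### The Bessel condition bounds `∑_m |ψ̂(B^m ξ)|²`. -/

section Bessel

open Topology

variable {A : GL (Fin d) ℝ} {ψ φ : L2 d}

theorem measurable_coeFn (f : L2 d) : Measurable (f : E d → ℂ) :=
  (Lp.stronglyMeasurable f).measurable

theorem mul_conj_eq_ofReal (z : ℂ) : z * conj z = ((‖z‖ ^ 2 : ℝ) : ℂ) := by
  rw [Complex.mul_conj, Complex.normSq_eq_norm_sq]

/-- On balls of radius `ρ` no nonzero shift from finitely many levels joins two points, so only `l =
0` survives there. -/
theorem exists_pos_forall_le_norm_shift (B : E d ≃L[ℝ] E d) (s : Finset ℤ) :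
    ∃ ρ : ℝ, 0 < ρ ∧ ∀ m ∈ s, ∀ l : Fin d → ℤ, l ≠ 0 →
      2 * ρ ≤ ‖(B ^ (-m)) (latticePt l)‖ := by
  set N : ℤ → ℝ := fun m => ‖((B ^ m : E d ≃L[ℝ] E d) : E d →L[ℝ] E d)‖
  have hN : 0 ≤ ∑ m ∈ s, N m := Finset.sum_nonneg fun m _ => norm_nonneg _
  refine ⟨1 / (2 * (∑ m ∈ s, N m + 1)), by positivity, fun m hm l hl => ?_⟩
  have h1 : N m ≤ ∑ m ∈ s, N m := Finset.single_le_sum (f := N) (fun m _ => norm_nonneg _) hm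
  have h2 := ContinuousLinearMap.le_opNorm ((B ^ m : E d ≃L[ℝ] E d) : E d →L[ℝ] E d)
    ((B ^ (-m)) (latticePt l))
  rw [ContinuousLinearEquiv.coe_coe, IsExpandingLattice.zpow_zpow_neg_apply] at h2
  have h3 := one_le_norm_latticePt hl
  have h4 : 2 * (1 / (2 * (∑ m ∈ s, N m + 1))) = 1 / (∑ m ∈ s, N m + 1) := by
    field_simp
  rw [h4, div_le_iff₀ (by positivity)]
  have h5 := mul_le_mul_of_nonneg_right h1 (norm_nonneg ((B ^ (-m)) (latticePt l)))
  have h6 : 1 ≤ N m * ‖(B ^ (-m)) (latticePt l)‖ := h3.trans h2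
  nlinarith [norm_nonneg ((B ^ (-m)) (latticePt l))]

/-- Test the Bessel inequality on `f` with `f̂` the indicator of `u`. Points of `u` are less than
`2ρ` apart, so the level corresponding to `m` contributes exactly `∫_u |ψ̂(B^m ξ)|²`, while `‖f‖²`
is the volume of `u`. -/
theorem lintegral_sum_le_of_isBessel {C : ℝ} (hC : ∀ v : L2 d,
      Summable (fun j => ‖inner ℂ (affineSystem A ψ j) v‖ ^ 2) ∧
        ∑' j, ‖inner ℂ (affineSystem A ψ j) v‖ ^ 2 ≤ C * ‖v‖ ^ 2)
    {a b : ℝ} (ha : 0 < a) (s : Finset ℤ) {ρ : ℝ}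
    (hρ : ∀ m ∈ s, ∀ l : Fin d → ℤ, l ≠ 0 →
      2 * ρ ≤ ‖(matEquiv (trGL A) ^ (-m)) (latticePt l)‖)
    {x : E d} {u : Set (E d)} (hu : MeasurableSet u) (hua : u ⊆ annulus d a b)
    (hux : u ⊆ Metric.ball x ρ) :
    ∫⁻ ξ in u, ∑ m ∈ s, ‖(𝓕 ψ : L2 d) ((matEquiv (trGL A) ^ m) ξ)‖ₑ ^ 2
      ≤ ENNReal.ofReal C * volume u := by
  set B := matEquiv (trGL A)
  set p : E d → ℂ := ⇑(𝓕 ψ : L2 d) with hp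
  have hF : IsBandLimited (u.indicator (1 : E d → ℂ)) := isBandLimited_indicator hu ha hua
  have hvol : volume u ≠ ∞ := ((measure_mono hua).trans_lt volume_annulus_lt_top).ne
  obtain ⟨f, hf⟩ := exists_fourier_ae_eq hF.memLp
  have hpm : ∀ m : ℤ, MemLp (fun ξ => p ((B ^ m) ξ)) 2 := fun m =>
    memLp_comp_equiv _ (Lp.memLp (𝓕 ψ))
  have hint : ∀ m : ℤ, IntegrableOn (fun ξ => ‖p ((B ^ m) ξ)‖ ^ 2) u := fun m =>
    (hpm m).norm.integrable_sq.integrableOn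
  have hlev : ∀ m ∈ s, HasSum (fun z => ‖inner ℂ (affineSystem A ψ (-m, z)) f‖ ^ 2)
      (∫ ξ in u, ‖p ((B ^ m) ξ)‖ ^ 2) := by
    intro m hm
    have h1 := hasSum_affineSystem_level (A := A) (ψ := ψ) (φ := ψ) hF hF hf hf (-m)
    rw [tsum_eq_single (0 : Fin d → ℤ)] at h1
    · have h2 : ∫ ξ, kern B (u.indicator 1) (u.indicator 1) p p (-(-m))
          ((B ^ (-m)) (latticePt 0)) ξ = ((∫ ξ in u, ‖p ((B ^ m) ξ)‖ ^ 2 : ℝ) : ℂ) := by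
        rw [← integral_complex_ofReal, ← integral_indicator hu]
        refine integral_congr_ae (.of_forall fun ξ => ?_)
        by_cases hξ : ξ ∈ u
        · simp [kern, latticePt_zero, hξ, mul_comm (conj (p _)), mul_conj_eq_ofReal]
        · simp [kern, latticePt_zero, hξ]
      rw [h2] at h1
      simp_rw [mul_conj_eq_ofReal] at h1
      exact Complex.hasSum_ofReal.mp h1
    · intro l hl
      rw [← integral_zero (E d) ℂ]
      refine integral_congr_ae (.of_forall fun ξ => ?_)
      simp only [kern]
      by_cases h2 : ξ ∈ u
      · by_cases h3 : ξ + (B ^ (-m)) (latticePt l) ∈ u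
        · exfalso
          have h4 := dist_triangle_right (ξ + (B ^ (-m)) (latticePt l)) ξ x
          rw [dist_eq_norm (ξ + _) ξ, add_sub_cancel_left] at h4
          have := hρ m hm l hl
          have := Metric.mem_ball.mp (hux h2)
          have := Metric.mem_ball.mp (hux h3)
          linarith
        · rw [Set.indicator_of_notMem h3]; simp
      · simp [h2]
  have hnorm : ‖f‖ ^ 2 = (volume u).toReal := by
    have h1 : inner ℂ f f = (((volume u).toReal : ℝ) : ℂ) := by
      rw [inner_eq_integral_fourier]
      have : ∫ ξ, u.indicator (fun _ => (1 : ℂ)) ξ = (((volume u).toReal : ℝ) : ℂ) := by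
        rw [integral_indicator hu, setIntegral_const]
        simp [Measure.real]
      rw [← this]
      refine integral_congr_ae ?_
      filter_upwards [hf] with ξ hξ
      rw [hξ]
      by_cases h : ξ ∈ u <;> simp [h]
    rw [inner_self_eq_norm_sq_to_K] at h1
    exact Complex.ofReal_injective (by rw [← h1]; norm_cast)
  obtain ⟨hsum, hle⟩ := hC f
  have hreal : ∑ m ∈ s, ∫ ξ in u, ‖p ((B ^ m) ξ)‖ ^ 2 ≤ C * (volume u).toReal := by
    rw [← hnorm]
    refine le_trans ?_ hle
    rw [hsum.tsum_prod, ← (Equiv.neg ℤ).tsum_eq]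
    rw [Finset.sum_congr rfl fun m hm => (hlev m hm).tsum_eq.symm]
    exact Summable.sum_le_tsum (f := fun m : ℤ => ∑' z, ‖inner ℂ (affineSystem A ψ (-m, z)) f‖ ^ 2)
      s (fun m _ => tsum_nonneg fun z => by positivity)
      ((Equiv.neg ℤ).summable_iff.mpr hsum.prod)
  have hmeas : ∀ m : ℤ, Measurable fun ξ => ‖p ((B ^ m) ξ)‖ₑ ^ 2 := fun m =>
    (((measurable_coeFn _).comp (B ^ m).continuous.measurable).enorm).pow_const 2
  rw [lintegral_finsetSum _ fun m _ => hmeas m]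
  have h3 : ∀ m : ℤ, ∫⁻ ξ in u, ‖p ((B ^ m) ξ)‖ₑ ^ 2
      = ENNReal.ofReal (∫ ξ in u, ‖p ((B ^ m) ξ)‖ ^ 2) := by
    intro m
    rw [ofReal_integral_eq_lintegral_ofReal (hint m) (.of_forall fun ξ => by positivity)]
    refine lintegral_congr fun ξ => ?_
    rw [ENNReal.ofReal_pow (norm_nonneg _), ofReal_norm]
  simp_rw [h3]
  rw [← ENNReal.ofReal_sum_of_nonneg fun m _ => integral_nonneg fun ξ => by positivity]
  calc _ ≤ ENNReal.ofReal (C * (volume u).toReal) := ENNReal.ofReal_le_ofReal hreal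
    _ = _ := by rw [ENNReal.ofReal_mul' ENNReal.toReal_nonneg, ENNReal.ofReal_toReal hvol]

/-- The integral bound on small sets gives, for each finite set of levels, the pointwise bound `C`
almost everywhere near every point, hence on the annulus. There are countably many finite sets of
levels, so the full sum is bounded by `C` as well. The radius `ρ` depends on the finite set, but `C`
does not. -/
theorem isSquareSummable_of_isBessel (hψ : IsBessel (affineSystem A ψ)) :
    IsSquareSummable (matEquiv (trGL A)) (𝓕 ψ : L2 d) where
  measurable := measurable_coeFn _
  lintegral_ne_top := by
    have := (Lp.memLp (𝓕 ψ : L2 d)).2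
    rw [eLpNorm_lt_top_iff_lintegral_rpow_enorm_lt_top (by simp) (by simp)] at this
    simpa using this.ne
  annulus_ne_top a b ha := by
    obtain ⟨C, hC⟩ := hψ
    set B := matEquiv (trGL A)
    have hmeas : ∀ m : ℤ, Measurable fun ξ => ‖(𝓕 ψ : L2 d) ((B ^ m) ξ)‖ₑ ^ 2 := fun m =>
      (((measurable_coeFn _).comp (B ^ m).continuous.measurable).enorm).pow_const 2
    have key : ∀ s : Finset ℤ, ∀ᵐ ξ, ξ ∈ annulus d a b →
        ∑ m ∈ s, ‖(𝓕 ψ : L2 d) ((B ^ m) ξ)‖ₑ ^ 2 ≤ ENNReal.ofReal C := by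
      intro s
      obtain ⟨ρ, hρ, hs⟩ := exists_pos_forall_le_norm_shift B s
      refine measure_null_of_locally_null _ fun x _ =>
        ⟨Metric.ball x ρ ∩ {ξ | ¬ (ξ ∈ annulus d a b →
          ∑ m ∈ s, ‖(𝓕 ψ : L2 d) ((B ^ m) ξ)‖ₑ ^ 2 ≤ ENNReal.ofReal C)}, ?_, ?_⟩
      · exact Filter.inter_mem (mem_nhdsWithin_of_mem_nhds (Metric.ball_mem_nhds x hρ))
          self_mem_nhdsWithin
      · have hU : MeasurableSet (annulus d a b ∩ Metric.ball x ρ) :=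
          measurableSet_annulus.inter Metric.isOpen_ball.measurableSet
        have h1 := ae_le_of_forall_setLIntegral_le_of_sigmaFinite
          (μ := volume.restrict (annulus d a b ∩ Metric.ball x ρ))
          (f := fun ξ => ∑ m ∈ s, ‖(𝓕 ψ : L2 d) ((B ^ m) ξ)‖ₑ ^ 2)
          (g := fun _ => ENNReal.ofReal C)
          (Finset.measurable_sum s fun m _ => hmeas m) fun t ht _ => by
            rw [Measure.restrict_restrict ht, setLIntegral_const]
            exact lintegral_sum_le_of_isBessel hC ha s hs (ht.inter hU)
              (Set.inter_subset_right.trans Set.inter_subset_left)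
              (Set.inter_subset_right.trans Set.inter_subset_right)
        have h2 := (ae_restrict_iff' hU).mp h1
        refine measure_mono_null ?_ h2
        rintro ξ ⟨h3, h4⟩ h5
        exact h4 fun h6 => h5 ⟨h6, h3⟩
    refine ne_top_of_le_ne_top (ENNReal.mul_ne_top (ENNReal.ofReal_ne_top (r := C))
      (volume_annulus_lt_top (d := d) (a := a) (b := b)).ne) ?_
    have hvol : volume (annulus d a b) = ∫⁻ ξ, annulusInd d a b ξ :=
      (lintegral_indicator_one measurableSet_annulus).symm
    rw [hvol, ← lintegral_const_mul _ measurable_annulusInd]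
    refine lintegral_mono_ae ?_
    filter_upwards [ae_all_iff.mpr key] with ξ hξ
    by_cases h : ξ ∈ annulus d a b
    · rw [annulusInd_of_mem h, ENNReal.tsum_eq_iSup_sum]
      simpa using fun s => hξ s h
    · rw [annulusInd_of_notMem h, zero_mul]
      exact zero_le

end Bessel

/-! ### The frame sums as the series `term`. -/

section Systems

theorem summable_norm_sq_of_levels {ι κ : Type*} {a : ℤ × ι → ℂ} {t : ℤ × κ → ℂ}
    (ht : Summable t)
    (ha : ∀ n, HasSum (fun z => a (n, z) * conj (a (n, z))) (∑' l, t (n, l))) :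
    Summable fun x => ‖a x‖ ^ 2 := by
  simp_rw [mul_conj_eq_ofReal] at ha
  have hre : ∀ n, HasSum (fun z => ‖a (n, z)‖ ^ 2) (∑' l, t (n, l)).re := fun n => by
    simpa only [Complex.ofReal_re] using Complex.hasSum_re (ha n)
  rw [summable_prod_of_nonneg fun x => by positivity]
  refine ⟨fun n => (hre n).summable, ?_⟩
  simp_rw [(hre _).tsum_eq]
  exact (Complex.hasSum_re ht.prod.hasSum).summable

/-- Sums within levels do not by themselves give joint unconditional summability. The diagonal cases
have nonnegative terms and do; the mixed products are dominated by them. -/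
theorem hasSum_mul_conj_of_levels {ι κ : Type*} {a b : ℤ × ι → ℂ} {ta tb t : ℤ × κ → ℂ}
    (hta : Summable ta) (htb : Summable tb) (ht : Summable t)
    (ha : ∀ n, HasSum (fun z => a (n, z) * conj (a (n, z))) (∑' l, ta (n, l)))
    (hb : ∀ n, HasSum (fun z => b (n, z) * conj (b (n, z))) (∑' l, tb (n, l)))
    (hab : ∀ n, HasSum (fun z => a (n, z) * conj (b (n, z))) (∑' l, t (n, l))) :
    HasSum (fun x => a x * conj (b x)) (∑' x, t x) := by
  have hs : Summable fun x => a x * conj (b x) := by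
    refine Summable.of_norm_bounded ((summable_norm_sq_of_levels hta ha).add
      (summable_norm_sq_of_levels htb hb)) fun x => ?_
    rw [norm_mul, RCLike.norm_conj]
    nlinarith [sq_nonneg (‖a x‖ - ‖b x‖), sq_nonneg ‖a x‖, sq_nonneg ‖b x‖]
  have h : ∑' x, a x * conj (b x) = ∑' x, t x := by
    rw [hs.tsum_prod, ht.tsum_prod]
    exact tsum_congr fun n => (hab n).tsum_eq
  rw [← h]
  exact hs.hasSum

theorem hasSum_of_negLevels {ι κ : Type*} {a b : ℤ × ι → ℂ} {ta tb t : ℤ × κ → ℂ}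
    (hta : Summable ta) (htb : Summable tb) (ht : Summable t)
    (ha : ∀ n, HasSum (fun z => a (n, z) * conj (a (n, z))) (∑' l, ta (-n, l)))
    (hb : ∀ n, HasSum (fun z => b (n, z) * conj (b (n, z))) (∑' l, tb (-n, l)))
    (hab : ∀ n, HasSum (fun z => a (n, z) * conj (b (n, z))) (∑' l, t (-n, l))) :
    HasSum (fun x => a x * conj (b x)) (∑' x, t x) := by
  have e : ∀ {u : ℤ × κ → ℂ}, Summable u → Summable fun x : ℤ × κ => u (-x.1, x.2) :=
    fun hu => ((Equiv.neg ℤ).prodCongr (Equiv.refl κ)).summable_iff.mpr hu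
  rw [← ((Equiv.neg ℤ).prodCongr (Equiv.refl κ)).tsum_eq]
  exact hasSum_mul_conj_of_levels (e hta) (e htb) (e ht) ha hb hab

variable {A : GL (Fin d) ℝ} {ψ φ f g : L2 d} {F G : E d → ℂ}

theorem hasSum_affineSystem_level_term (hF : IsBandLimited F) (hG : IsBandLimited G)
    (hf : (𝓕 f : L2 d) =ᵐ[volume] F) (hg : (𝓕 g : L2 d) =ᵐ[volume] G) (n : ℤ) :
    HasSum (fun z => inner ℂ (affineSystem A ψ (n, z)) f *
      conj (inner ℂ (affineSystem A φ (n, z)) g))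
      (∑' l, term (matEquiv (trGL A)) Set.univ F G (𝓕 ψ : L2 d) (𝓕 φ : L2 d) (-n, l)) := by
  have h := hasSum_affineSystem_level (A := A) (ψ := ψ) (φ := φ) hF hG hf hg n
  have h1 : ∀ l, term (matEquiv (trGL A)) Set.univ F G (𝓕 ψ : L2 d) (𝓕 φ : L2 d) (-n, l)
      = ∫ ξ, kern (matEquiv (trGL A)) F G (𝓕 ψ : L2 d) (𝓕 φ : L2 d) (-n)
        ((matEquiv (trGL A) ^ n) (latticePt l)) ξ := fun l => by
    rw [term, Set.indicator_of_mem (Set.mem_univ _), shift, neg_neg]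
  rw [tsum_congr h1]
  exact h

theorem hasSum_affineSystem (hB : IsExpandingLattice (matEquiv (trGL A)))
    (hψ : IsSquareSummable (matEquiv (trGL A)) (𝓕 ψ : L2 d))
    (hφ : IsSquareSummable (matEquiv (trGL A)) (𝓕 φ : L2 d))
    (hF : IsBandLimited F) (hG : IsBandLimited G)
    (hf : (𝓕 f : L2 d) =ᵐ[volume] F) (hg : (𝓕 g : L2 d) =ᵐ[volume] G) :
    HasSum (fun x => inner ℂ (affineSystem A ψ x) f * conj (inner ℂ (affineSystem A φ x) g))
      (∑' x, term (matEquiv (trGL A)) Set.univ F G (𝓕 ψ : L2 d) (𝓕 φ : L2 d) x) :=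
  hasSum_of_negLevels (summable_term hB Set.univ hF hF hψ hψ)
    (summable_term hB Set.univ hG hG hφ hφ) (summable_term hB Set.univ hF hG hψ hφ)
    (hasSum_affineSystem_level_term hF hF hf hf) (hasSum_affineSystem_level_term hG hG hg hg)
    (hasSum_affineSystem_level_term hF hG hf hg)

/-- For `n ≥ 0`, the shift `B^{-n} l'` is integral exactly when `l' = B^n l`. Restricting the affine
level to integer shifts therefore gives the quasi-affine level. -/
theorem tsum_term_range_latticePt {B : E d ≃L[ℝ] E d} (hB : IsExpandingLattice B)
    {p q : E d → ℂ} {n : ℤ} (hn : 0 ≤ n) :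
    ∑' l, term B (Set.range latticePt) F G p q (n, l)
      = ∑' l, ∫ ξ, kern B F G p q n (latticePt l) ξ := by
  obtain ⟨j, rfl⟩ := Int.eq_ofNat_of_zero_le hn
  have hshift : ∀ l, shift B ((j : ℤ), latPow hB j l) = latticePt l := fun l => by
    have := shift_latPow hB 0 l j
    rwa [sub_zero] at this
  have hinj : Function.Injective (latPow hB j) := fun l l' h => latticePt_injective (by
    rw [← hshift l, ← hshift l', h])
  rw [← hinj.tsum_eq]
  · refine tsum_congr fun l => ?_
    rw [term, hshift, Set.indicator_of_mem (Set.mem_range_self l)]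
  · intro l hl
    have h1 : shift B ((j : ℤ), l) ∈ Set.range latticePt :=
      Set.mem_of_indicator_ne_zero hl
    obtain ⟨l', h2⟩ := h1
    refine ⟨l', latticePt_injective ?_⟩
    rw [latticePt_latPow, h2, shift, IsExpandingLattice.zpow_zpow_neg_apply]

/-- At a level `n ≥ 0` the shifts `B^n l` are integral already, so the restriction removes nothing,
in accordance with the two systems agreeing there. -/
theorem hasSum_quasiAffineSystem_level_term (hB : IsExpandingLattice (matEquiv (trGL A)))
    (hF : IsBandLimited F) (hG : IsBandLimited G)
    (hf : (𝓕 f : L2 d) =ᵐ[volume] F) (hg : (𝓕 g : L2 d) =ᵐ[volume] G) (n : ℤ) :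
    HasSum (fun z => inner ℂ (quasiAffineSystem A ψ (n, z)) f *
      conj (inner ℂ (quasiAffineSystem A φ (n, z)) g))
      (∑' l, term (matEquiv (trGL A)) (Set.range latticePt) F G
        (𝓕 ψ : L2 d) (𝓕 φ : L2 d) (-n, l)) := by
  rcases lt_or_ge n 0 with hn | hn
  · rw [tsum_term_range_latticePt hB (Left.nonneg_neg_iff.mpr hn.le)]
    exact hasSum_quasiAffineSystem_level_of_neg hF hG hf hg hn
  · have h0 : ∀ (ψ : L2 d) z, quasiAffineSystem A ψ (n, z) = affineSystem A ψ (n, z) :=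
      fun ψ z => if_pos hn
    have h1 : ∀ l, term (matEquiv (trGL A)) (Set.range latticePt) F G
        (𝓕 ψ : L2 d) (𝓕 φ : L2 d) (-n, l)
        = term (matEquiv (trGL A)) Set.univ F G (𝓕 ψ : L2 d) (𝓕 φ : L2 d) (-n, l) := fun l => by
      obtain ⟨j, rfl⟩ := Int.eq_ofNat_of_zero_le hn
      have h2 : shift (matEquiv (trGL A)) (-(j : ℤ), l) ∈ Set.range latticePt :=
        ⟨latPow hB j l, by rw [latticePt_latPow, shift, neg_neg]⟩
      rw [term, term, Set.indicator_of_mem h2, Set.indicator_of_mem (Set.mem_univ _)]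
    rw [tsum_congr h1]
    simp_rw [h0]
    exact hasSum_affineSystem_level_term hF hG hf hg n

theorem hasSum_quasiAffineSystem (hB : IsExpandingLattice (matEquiv (trGL A)))
    (hψ : IsSquareSummable (matEquiv (trGL A)) (𝓕 ψ : L2 d))
    (hφ : IsSquareSummable (matEquiv (trGL A)) (𝓕 φ : L2 d))
    (hF : IsBandLimited F) (hG : IsBandLimited G)
    (hf : (𝓕 f : L2 d) =ᵐ[volume] F) (hg : (𝓕 g : L2 d) =ᵐ[volume] G) :
    HasSum (fun x => inner ℂ (quasiAffineSystem A ψ x) f *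
      conj (inner ℂ (quasiAffineSystem A φ x) g))
      (∑' x, term (matEquiv (trGL A)) (Set.range latticePt) F G
        (𝓕 ψ : L2 d) (𝓕 φ : L2 d) x) :=
  hasSum_of_negLevels (summable_term hB _ hF hF hψ hψ)
    (summable_term hB _ hG hG hφ hφ) (summable_term hB _ hF hG hψ hφ)
    (hasSum_quasiAffineSystem_level_term hB hF hF hf hf)
    (hasSum_quasiAffineSystem_level_term hB hG hG hg hg)
    (hasSum_quasiAffineSystem_level_term hB hF hG hf hg)

end Systems

/-! ### Parseval frames: density, polarization and direct sums. -/

section ParsevalFrames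

theorem dense_setOf_forall_mem {H : Type*} [NormedAddCommGroup H] {r : ℕ} {D : Set H}
    (hD : Dense D) :
    Dense {v : PiLp 2 fun _ : Fin r => H | ∀ i, v i ∈ D} := by
  have h := dense_pi (Set.univ : Set (Fin r)) (s := fun _ => D) fun _ _ => hD
  have := h.preimage (PiLp.homeomorph 2 fun _ : Fin r => H).isOpenMap
  convert this using 1
  ext v
  simp [PiLp.homeomorph]

variable {H J : Type*} [NormedAddCommGroup H] [InnerProductSpace ℂ H]

/-- Finite partial sums are continuous, so their bound by `‖v‖²` extends from `D` to all of `H`. The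
analysis operator `T` is then bounded, and `‖T v‖ = ‖v‖` is a closed condition. -/
theorem isParsevalFrame_of_dense {x : J → H} {D : Set H} (hD : Dense D)
    (h : ∀ v ∈ D, HasSum (fun j => ‖inner ℂ (x j) v‖ ^ 2) (‖v‖ ^ 2)) : IsParsevalFrame x := by
  have hbound : ∀ (s : Finset J) (v : H), ∑ j ∈ s, ‖inner ℂ (x j) v‖ ^ 2 ≤ ‖v‖ ^ 2 := by
    intro s v
    have hc : IsClosed {v : H | ∑ j ∈ s, ‖inner ℂ (x j) v‖ ^ 2 ≤ ‖v‖ ^ 2} :=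
      isClosed_le (by fun_prop) (by fun_prop)
    exact hc.closure_subset_iff.mpr
      (fun w hw => sum_le_hasSum s (fun _ _ => by positivity) (h w hw)) (hD v)
  have hsum : ∀ v, Summable fun j => ‖inner ℂ (x j) v‖ ^ 2 := fun v =>
    summable_of_sum_le (fun _ => by positivity) (hbound · v)
  let T : H →ₗ[ℂ] lp (fun _ : J => ℂ) 2 :=
    { toFun := fun v => ⟨fun j => inner ℂ (x j) v,
        (memℓp_gen_iff (by simp)).mpr (by simpa using hsum v)⟩
      map_add' := fun v w => by ext j; exact inner_add_right _ _ _
      map_smul' := fun c v => by ext j; exact inner_smul_right _ _ _ }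
  have hT : ∀ v, ‖T v‖ ^ 2 = ∑' j, ‖inner ℂ (x j) v‖ ^ 2 := fun v => by
    have := lp.norm_rpow_eq_tsum (p := 2) (by simp) (T v)
    have h2 : ‖T v‖ ^ 2 = ∑' j, ‖(T v : J → ℂ) j‖ ^ 2 := by simpa using this
    exact h2
  have hle : ∀ v, ‖T v‖ ≤ 1 * ‖v‖ := fun v => by
    rw [one_mul]
    refine le_of_sq_le_sq ?_ (norm_nonneg v)
    rw [hT]
    exact (hsum v).tsum_le_of_sum_le (hbound · v)
  have hTc : Continuous T := (T.mkContinuous 1 hle).continuous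
  have hc : IsClosed {v : H | ‖T v‖ ^ 2 = ‖v‖ ^ 2} :=
    isClosed_eq (hTc.norm.pow 2) (continuous_norm.pow 2)
  intro v
  have hv : ‖T v‖ ^ 2 = ‖v‖ ^ 2 := hc.closure_subset_iff.mpr
    (fun w hw => (hT w).trans (h w hw).tsum_eq) (hD v)
  rw [← hv, hT]
  exact (hsum v).hasSum

theorem IsParsevalFrame.hasSum_mul_conj {x : J → H} (h : IsParsevalFrame x) (v w : H) :
    HasSum (fun j => inner ℂ (x j) v * conj (inner ℂ (x j) w)) (inner ℂ w v) := by
  have hc : ∀ u : H, HasSum (fun j => ((‖inner ℂ (x j) u‖ : ℂ)) ^ 2) ((‖u‖ : ℂ) ^ 2) := fun u => by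
    exact_mod_cast Complex.hasSum_ofReal.mpr (h u)
  have key := ((((hc (w + v)).sub (hc (w - v))).add
    (((hc (w - Complex.I • v)).sub (hc (w + Complex.I • v))).mul_right Complex.I)).div_const 4)
  rw [inner_eq_sum_norm_sq_div_four]
  refine (congrArg (HasSum · _ _) (funext fun j => ?_)).mpr key
  have := inner_eq_sum_norm_sq_div_four (𝕜 := ℂ) (inner ℂ (x j) w) (inner ℂ (x j) v)
  rw [RCLike.inner_apply'] at this
  rw [mul_comm, this]
  simp

variable {r : ℕ}

theorem inner_toLp_single (u : PiLp 2 fun _ : Fin r => H) (i : Fin r) (f : H) :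
    inner ℂ u (WithLp.toLp 2 (Pi.single i f)) = inner ℂ (u i) f := by
  rw [PiLp.inner_apply, Finset.sum_eq_single i]
  · simp
  · intro j _ hj
    simp [hj]
  · simp

/-- A vector of systems is a Parseval frame for the direct sum if and only if its components are
Parseval frames that are pairwise strongly disjoint; it suffices to test on a dense subset. -/
theorem isParsevalFrame_toLp_iff {x : Fin r → J → H} {D : Set H} (hD : Dense D) :
    IsParsevalFrame (fun j => (WithLp.toLp 2 fun i => x i j : PiLp 2 fun _ : Fin r => H)) ↔
      ∀ i i', ∀ f ∈ D, ∀ g ∈ D, HasSum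
        (fun j => inner ℂ (x i j) f * conj (inner ℂ (x i' j) g))
        ((if i = i' then 1 else 0) * inner ℂ g f) := by
  constructor
  · intro h i i' f _ g _
    have := h.hasSum_mul_conj (WithLp.toLp 2 (Pi.single i f)) (WithLp.toLp 2 (Pi.single i' g))
    simp only [inner_toLp_single] at this
    convert this using 1
    by_cases hi : i = i'
    · subst hi; simp
    · simp [hi]
  · intro h
    refine isParsevalFrame_of_dense (dense_setOf_forall_mem hD) fun v hv => ?_
    rw [← Complex.hasSum_ofReal]
    have key := hasSum_sum (s := Finset.univ) fun i _ => hasSum_sum (s := Finset.univ)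
      fun i' _ => h i i' (v i) (hv i) (v i') (hv i')
    convert key using 1
    · funext j
      rw [← mul_conj_eq_ofReal, PiLp.inner_apply, map_sum, Finset.sum_mul_sum]
    · rw [PiLp.norm_sq_eq_of_L2]
      simp [inner_self_eq_norm_sq_to_K]

end ParsevalFrames

/-! ### The super-systems in coordinates. -/

section Coordinates

theorem zpow_apply_toLp {r : ℕ} (e : L2 d ≃ₗᵢ[ℂ] L2 d) (n : ℤ) (v : L2Sum d r) :
    ((LinearIsometryEquiv.piLpCongrRight 2 fun _ => e : L2Sum d r ≃ₗᵢ[ℂ] L2Sum d r) ^ n) v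
      = WithLp.toLp 2 fun i => (e ^ n) (v i) := by
  let φ : (L2 d ≃ₗᵢ[ℂ] L2 d) →* (L2Sum d r ≃ₗᵢ[ℂ] L2Sum d r) :=
    { toFun := fun e => LinearIsometryEquiv.piLpCongrRight 2 fun _ => e
      map_one' := rfl
      map_mul' := fun _ _ => rfl }
  exact DFunLike.congr_fun (map_zpow φ e n).symm v

theorem smul_toContinuousLinearEquiv_zpow {V : Type*} [NormedAddCommGroup V] [NormedSpace ℂ V]
    (c : ℂˣ) (e : V ≃ₗᵢ[ℂ] V) (n : ℤ) (v : V) :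
    ((c • e.toContinuousLinearEquiv) ^ n) v = ((c ^ n : ℂˣ) : ℂ) • (e ^ n) v := by
  let φ : ℂˣ × (V ≃ₗᵢ[ℂ] V) →* (V ≃L[ℂ] V) :=
    { toFun := fun x => x.1 • x.2.toContinuousLinearEquiv
      map_one' := by ext v; exact one_smul _ v
      map_mul' := fun x y => by
        ext v
        change ((x.1 * y.1 : ℂˣ) : ℂ) • x.2 (y.2 v) = (x.1 : ℂ) • x.2 ((y.1 : ℂ) • y.2 v)
        rw [map_smul, smul_smul, Units.val_mul] }
  exact DFunLike.congr_fun (map_zpow φ (c, e) n).symm v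

variable {r : ℕ} (A : GL (Fin d) ℝ) (ψ : Fin r → L2 d)

theorem superAffineSystem_eq : superAffineSystem A (WithLp.toLp 2 ψ)
    = fun x => WithLp.toLp 2 fun i => affineSystem A (ψ i) x := by
  funext x
  exact zpow_apply_toLp _ _ _

theorem superQuasiAffineSystem_eq : superQuasiAffineSystem A (WithLp.toLp 2 ψ)
    = fun x => WithLp.toLp 2 fun i => quasiAffineSystem A (ψ i) x := by
  funext x
  simp only [superQuasiAffineSystem, quasiAffineSystem]
  split_ifs
  · exact zpow_apply_toLp _ _ _
  · rw [renormDilationSum, smul_toContinuousLinearEquiv_zpow, dilationSum, zpow_apply_toLp]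
    rfl

end Coordinates

/-! ### Density of band-limited functions. -/

section Density

theorem IsBandLimited.add {F G : E d → ℂ} (hF : IsBandLimited F) (hG : IsBandLimited G) :
    IsBandLimited (F + G) where
  measurable := hF.measurable.add hG.measurable
  exists_le := by
    obtain ⟨a, b, ha, M, h1, h2⟩ := hF.exists_common hG
    refine ⟨a, b, ha, M + M, fun ξ => (enorm_add_le _ _).trans ?_⟩
    rw [ENNReal.coe_add, add_mul]
    exact add_le_add (h1 ξ) (h2 ξ)

theorem IsBandLimited.const_smul {F : E d → ℂ} (hF : IsBandLimited F) (c : ℂ) :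
    IsBandLimited (c • F) where
  measurable := hF.measurable.const_smul c
  exists_le := by
    obtain ⟨a, b, ha, M, h⟩ := hF.exists_le
    refine ⟨a, b, ha, ‖c‖₊ * M, fun ξ => ?_⟩
    rw [Pi.smul_apply, enorm_smul, ENNReal.coe_mul, mul_assoc]
    exact mul_le_mul_right (h ξ) _

theorem isBandLimited_zero : IsBandLimited (0 : E d → ℂ) where
  measurable := measurable_zero
  exists_le := ⟨1, 1, one_pos, 0, fun ξ => by simp⟩

/-- The functions whose Fourier transform is bounded and supported in an annulus. -/
def bandLimited (d : ℕ) : Submodule ℂ (L2 d) where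
  carrier := {f | ∃ F, IsBandLimited F ∧ (𝓕 f : L2 d) =ᵐ[volume] F}
  add_mem' := by
    rintro f g ⟨F, hF, hf⟩ ⟨G, hG, hg⟩
    refine ⟨F + G, hF.add hG, ?_⟩
    have h : (𝓕 (f + g) : L2 d) = 𝓕 f + 𝓕 g := (Lp.fourierTransformₗᵢ (E d) ℂ).map_add f g
    rw [h]
    exact (Lp.coeFn_add _ _).trans (hf.add hg)
  zero_mem' := by
    refine ⟨0, isBandLimited_zero, ?_⟩
    have h : (𝓕 (0 : L2 d) : L2 d) = 0 := (Lp.fourierTransformₗᵢ (E d) ℂ).map_zero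
    rw [h]
    exact Lp.coeFn_zero _ _ _
  smul_mem' := by
    rintro c f ⟨F, hF, hf⟩
    refine ⟨c • F, hF.const_smul c, ?_⟩
    have h : (𝓕 (c • f) : L2 d) = c • 𝓕 f := (Lp.fourierTransformₗᵢ (E d) ℂ).map_smul c f
    rw [h]
    exact (Lp.coeFn_smul _ _).trans (hf.const_smul c)

/-- For `g` orthogonal to the subspace, test against `ĝ` itself cut off to a set where it is bounded
and `ξ` lies in an annulus: its square integral there is zero. These sets exhaust `ℝ^d` up to the
origin. -/
theorem dense_bandLimited (hd : d ≠ 0) : Dense (bandLimited d : Set (L2 d)) := by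
  rw [Submodule.dense_iff_topologicalClosure_eq_top, Submodule.topologicalClosure_eq_top_iff,
    Submodule.eq_bot_iff]
  intro g hg
  have : Nonempty (Fin d) := ⟨⟨0, Nat.pos_of_ne_zero hd⟩⟩
  have hgm := measurable_coeFn (𝓕 g : L2 d)
  have key : ∀ n : ℕ, ∀ᵐ ξ, ξ ∈ exhaustion d n → ‖(𝓕 g : L2 d) ξ‖ ≤ n → (𝓕 g : L2 d) ξ = 0 := by
    intro n
    set s : Set (E d) := exhaustion d n ∩ {ξ | ‖(𝓕 g : L2 d) ξ‖ ≤ n}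
    have hs : MeasurableSet s :=
      measurableSet_annulus.inter (measurableSet_le hgm.norm measurable_const)
    have hF : IsBandLimited (s.indicator ⇑(𝓕 g : L2 d)) :=
      ⟨hgm.indicator hs, 1 / ((n : ℝ) + 1), n + 1, by positivity, n, fun ξ => by
        by_cases h : ξ ∈ s
        · rw [Set.indicator_of_mem h, annulusInd_of_mem h.1, mul_one, enorm_le_coe]
          exact_mod_cast h.2
        · simp [Set.indicator_of_notMem h]⟩
    obtain ⟨f, hf⟩ := exists_fourier_ae_eq hF.memLp
    have h1 : inner ℂ f g = 0 := hg f ⟨_, hF, hf⟩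
    have h2 : ∫ ξ, s.indicator (fun ξ => ‖(𝓕 g : L2 d) ξ‖ ^ 2) ξ = 0 := by
      rw [inner_eq_integral_fourier] at h1
      apply Complex.ofReal_injective
      rw [← integral_complex_ofReal, Complex.ofReal_zero, ← h1]
      refine integral_congr_ae ?_
      filter_upwards [hf] with ξ hξ
      rw [hξ]
      by_cases h : ξ ∈ s
      · rw [Set.indicator_of_mem h, Set.indicator_of_mem h, mul_comm, mul_conj_eq_ofReal]
      · simp [Set.indicator_of_notMem h]
    rw [integral_eq_zero_iff_of_nonneg
      (fun ξ => Set.indicator_nonneg (fun _ _ => by positivity) ξ)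
      ((Lp.memLp (𝓕 g : L2 d)).norm.integrable_sq.indicator hs)] at h2
    filter_upwards [h2] with ξ hξ h3 h4
    rw [Set.indicator_of_mem (show ξ ∈ s from ⟨h3, h4⟩)] at hξ
    simpa using hξ
  have h0 : (𝓕 g : L2 d) = 0 := by
    refine (Lp.eq_zero_iff_ae_eq_zero).mpr ?_
    filter_upwards [ae_all_iff.mpr key, volume.ae_ne 0] with ξ h1 h2
    obtain ⟨M, hM⟩ := exists_nat_ge ‖(𝓕 g : L2 d) ξ‖
    obtain ⟨n, hn, hMn⟩ :=
      ((eventually_mem_exhaustion h2).and (Filter.eventually_ge_atTop M)).exists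
    exact h1 n hn (hM.trans (by exact_mod_cast hMn))
  exact (Lp.fourierTransformₗᵢ (E d) ℂ).injective (h0.trans (map_zero _).symm)

end Density

/-! ### Frame identities and the equations (a), (b). -/

section DualEquations

variable {A : GL (Fin d) ℝ} {ψ φ : L2 d} {c : ℂ}

theorem inner_eq_integral_mul_conj {f g : L2 d} {F G : E d → ℂ}
    (hf : (𝓕 f : L2 d) =ᵐ[volume] F) (hg : (𝓕 g : L2 d) =ᵐ[volume] G) :
    inner ℂ g f = ∫ ξ, F ξ * conj (G ξ) := by
  rw [inner_eq_integral_fourier]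
  refine integral_congr_ae ?_
  filter_upwards [hf, hg] with ξ h1 h2
  rw [h1, h2, mul_comm]

theorem forall_hasSum_iff_satisfiesDualEquations {B : E d ≃L[ℝ] E d} {p q : E d → ℂ} {J : Type*}
    {x y : J → L2 d} {S : Set (E d)} (hd : d ≠ 0) (hB : IsExpandingLattice B)
    (hp : IsSquareSummable B p) (hq : IsSquareSummable B q) (hS : Set.range latticePt ⊆ S)
    (h : ∀ {f g : L2 d} {F G : E d → ℂ}, IsBandLimited F → IsBandLimited G →
      (𝓕 f : L2 d) =ᵐ[volume] F → (𝓕 g : L2 d) =ᵐ[volume] G →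
      HasSum (fun j => inner ℂ (x j) f * conj (inner ℂ (y j) g)) (∑' z, term B S F G p q z)) :
    (∀ f ∈ bandLimited d, ∀ g ∈ bandLimited d,
      HasSum (fun j => inner ℂ (x j) f * conj (inner ℂ (y j) g)) (c * inner ℂ g f)) ↔
      SatisfiesDualEquations B p q c := by
  constructor
  · intro h1
    refine satisfiesDualEquations_of_tsum_eq hd hB hp hq hS fun F G hF hG => ?_
    obtain ⟨f, hf⟩ := exists_fourier_ae_eq hF.memLp
    obtain ⟨g, hg⟩ := exists_fourier_ae_eq hG.memLp
    rw [← inner_eq_integral_mul_conj hf hg]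
    exact (h hF hG hf hg).unique (h1 f ⟨F, hF, hf⟩ g ⟨G, hG, hg⟩)
  · rintro h1 f ⟨F, hF, hf⟩ g ⟨G, hG, hg⟩
    rw [inner_eq_integral_mul_conj hf hg, ← h1.tsum_eq hB hp hq (hS ⟨0, latticePt_zero⟩) hF hG]
    exact h hF hG hf hg

/-- The two forms differ by complex conjugation, and the prescribed sums `0` and `1` are real. -/
theorem satisfiesDualEquations_iff {r : ℕ} {ψ : Fin r → L2 d} :
    (∀ i j, SatisfiesDualEquations (matEquiv (trGL A)) (𝓕 (ψ i) : L2 d) (𝓕 (ψ j) : L2 d)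
      (if i = j then 1 else 0)) ↔ DiagonalEquation A ψ ∧ OffDiagonalEquation A ψ := by
  have h1 : ∀ ξ, adjPow A 1 ξ = matEquiv (trGL A) ξ := fun ξ => by rw [adjPow_eq, zpow_one]
  have hstar : ∀ {ι : Type} (u v : ι → ℂ) (s : ℂ), HasSum (fun n => conj (u n) * v n) s ↔
      HasSum (fun n => u n * conj (v n)) (conj s) := fun u v s => by
    rw [← Complex.hasSum_conj]
    simp only [map_mul, RCLike.conj_conj]
  have hif : ∀ i j : Fin r, conj (if i = j then (1 : ℂ) else 0) = if i = j then 1 else 0 :=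
    fun i j => by split_ifs <;> simp
  simp only [DiagonalEquation, OffDiagonalEquation, h1, adjPow_eq]
  constructor
  · refine fun h => ⟨fun i j => ?_, fun i j k hk => ?_⟩
    · filter_upwards [(h i j).diagonal] with ξ hξ
      rwa [hstar, hif] at hξ
    · filter_upwards [(h i j).offDiagonal k hk] with ξ hξ
      rwa [hstar, map_zero] at hξ
  · refine fun h i j => ⟨?_, fun k hk => ?_⟩
    · filter_upwards [h.1 i j] with ξ hξ
      rwa [hstar, hif]
    · filter_upwards [h.2 i j k hk] with ξ hξ
      rwa [hstar, map_zero]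

end DualEquations

/-! ### Both equivalences in positive dimension. -/

section Main

variable {r : ℕ} {A : GL (Fin d) ℝ} {ψ : Fin r → L2 d}

theorem isParsevalFrame_superAffineSystem_iff (hd : d ≠ 0)
    (hB : IsExpandingLattice (matEquiv (trGL A)))
    (hψ : ∀ i, IsBessel (affineSystem A (ψ i))) :
    IsParsevalFrame (superAffineSystem A (WithLp.toLp 2 ψ)) ↔
      DiagonalEquation A ψ ∧ OffDiagonalEquation A ψ := by
  have hs := fun i => isSquareSummable_of_isBessel (hψ i)
  rw [superAffineSystem_eq, isParsevalFrame_toLp_iff (dense_bandLimited hd),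
    ← satisfiesDualEquations_iff]
  exact forall₂_congr fun i j => forall_hasSum_iff_satisfiesDualEquations hd hB (hs i) (hs j)
    (Set.subset_univ _) (hasSum_affineSystem hB (hs i) (hs j))

theorem isParsevalFrame_superQuasiAffineSystem_iff (hd : d ≠ 0)
    (hB : IsExpandingLattice (matEquiv (trGL A)))
    (hψ : ∀ i, IsBessel (affineSystem A (ψ i))) :
    IsParsevalFrame (superQuasiAffineSystem A (WithLp.toLp 2 ψ)) ↔
      DiagonalEquation A ψ ∧ OffDiagonalEquation A ψ := by
  have hs := fun i => isSquareSummable_of_isBessel (hψ i)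
  rw [superQuasiAffineSystem_eq, isParsevalFrame_toLp_iff (dense_bandLimited hd),
    ← satisfiesDualEquations_iff]
  exact forall₂_congr fun i j => forall_hasSum_iff_satisfiesDualEquations hd hB (hs i) (hs j)
    subset_rfl (hasSum_quasiAffineSystem hB (hs i) (hs j))

end Main

/-! ### Dimension zero. -/

section DimensionZero

theorem affineSystem_of_dimension_zero (A : GL (Fin 0) ℝ) (ψ : L2 0) (x : ℤ × (Fin 0 → ℤ)) :
    affineSystem A ψ x = ψ := by
  have h1 : translation (latticePt x.2) ψ = ψ := by
    ext1
    filter_upwards [coeFn_translation (latticePt x.2) ψ] with ξ hξ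
    rw [hξ, Subsingleton.elim (ξ - latticePt x.2) ξ]
  rw [affineSystem, h1, Subsingleton.elim A 1, dilation_one, one_zpow]
  rfl

/-- The affine system repeats `ψ` for every `n : ℤ`, so testing on `ψ` makes a constant series over
an infinite index set summable. -/
theorem eq_zero_of_isBessel_of_dimension_zero {A : GL (Fin 0) ℝ} {ψ : L2 0}
    (h : IsBessel (affineSystem A ψ)) : ψ = 0 := by
  obtain ⟨C, hC⟩ := h
  have h1 := (hC ψ).1
  simp only [affineSystem_of_dimension_zero] at h1
  rw [summable_const_iff] at h1
  simpa using h1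

theorem isParsevalFrame_zero_iff {H J : Type*} [NormedAddCommGroup H] [InnerProductSpace ℂ H] :
    IsParsevalFrame (fun _ : J => (0 : H)) ↔ Subsingleton H := by
  constructor
  · intro h
    refine subsingleton_of_forall_eq 0 fun v => ?_
    have h1 := h v
    simp only [inner_zero_left, norm_zero, ne_eq, OfNat.ofNat_ne_zero, not_false_eq_true,
      zero_pow] at h1
    simpa using h1.unique hasSum_zero
  · intro h v
    rw [Subsingleton.elim v 0]
    simp

theorem nontrivial_L2_of_dimension_zero : Nontrivial (L2 0) := by
  have h1 : MemLp (fun _ : E 0 => (1 : ℂ)) 2 volume := memLp_const 1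
  refine ⟨h1.toLp, 0, fun h => ?_⟩
  have h2 : ∀ᵐ _ : E 0, False := by
    filter_upwards [h1.coeFn_toLp, Lp.coeFn_zero ℂ 2 (volume : Measure (E 0))] with ξ h3 h4
    rw [h, h4] at h3
    exact one_ne_zero h3.symm
  exact h2.exists.elim fun _ => id

theorem subsingleton_L2Sum_iff_of_dimension_zero {r : ℕ} :
    Subsingleton (L2Sum 0 r) ↔ IsEmpty (Fin r) := by
  have := nontrivial_L2_of_dimension_zero
  constructor
  · intro h
    refine ⟨fun i => ?_⟩
    obtain ⟨f, hf⟩ := exists_ne (0 : L2 0)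
    refine hf ?_
    have h1 := congrArg (fun v : L2Sum 0 r => v i)
      (Subsingleton.elim (WithLp.toLp 2 fun _ => f : L2Sum 0 r) 0)
    exact h1
  · exact fun h => ⟨fun v w => by ext i; exact h.elim i⟩

/-- Since every `ψ i` is zero, each of the three conditions amounts to `r = 0`. -/
theorem tfae_of_dimension_zero {r : ℕ} {A : GL (Fin 0) ℝ} {ψ : Fin r → L2 0}
    (hψ : ∀ i, IsBessel (affineSystem A (ψ i))) :
    List.TFAE [IsParsevalFrame (superAffineSystem A (WithLp.toLp 2 ψ)),
      IsParsevalFrame (superQuasiAffineSystem A (WithLp.toLp 2 ψ)),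
      DiagonalEquation A ψ ∧ OffDiagonalEquation A ψ] := by
  obtain rfl : ψ = fun _ => 0 := funext fun i => eq_zero_of_isBessel_of_dimension_zero (hψ i)
  have h1 : superAffineSystem A (WithLp.toLp 2 fun _ : Fin r => (0 : L2 0)) = fun _ => 0 := by
    rw [superAffineSystem_eq]
    simp only [affineSystem_of_dimension_zero]
    rfl
  have h2 : superQuasiAffineSystem A (WithLp.toLp 2 fun _ : Fin r => (0 : L2 0)) = fun _ => 0 := by
    rw [superQuasiAffineSystem_eq]
    simp only [quasiAffineSystem, affineSystem_of_dimension_zero, map_zero, smul_zero, ite_self]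
    rfl
  have h3 : (DiagonalEquation A (fun _ : Fin r => (0 : L2 0)) ∧
      OffDiagonalEquation A fun _ : Fin r => (0 : L2 0)) ↔ IsEmpty (Fin r) := by
    refine ⟨fun h => ⟨fun i => ?_⟩, fun h => ⟨fun i => h.elim i, fun i => h.elim i⟩⟩
    have h4 : (𝓕 (0 : L2 0) : L2 0) = 0 := (Lp.fourierTransformₗᵢ (E 0) ℂ).map_zero
    obtain ⟨ξ, hξ, h0⟩ := ((h.1 i i).and (Lp.coeFn_zero ℂ 2 (volume : Measure (E 0)))).exists
    have h5 : ∀ η : E 0, (𝓕 (0 : L2 0) : L2 0) η = 0 := fun η => by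
      rw [Subsingleton.elim η ξ, h4, h0]; rfl
    simp only [h5, zero_mul, if_true] at hξ
    exact zero_ne_one (hasSum_zero.unique hξ)
  rw [h1, h2, isParsevalFrame_zero_iff, h3,
    subsingleton_L2Sum_iff_of_dimension_zero]
  tfae_finish

end DimensionZero

end SuperWavelet

end

theorem mainTheorem5 {d r : ℕ} (A : GL (Fin d) ℝ)
    (hexp : SuperWavelet.IsExpansive (A : Matrix (Fin d) (Fin d) ℝ))
    (hint : SuperWavelet.IsIntegralMatrix (A : Matrix (Fin d) (Fin d) ℝ))
    (ψ : Fin r → SuperWavelet.L2 d)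
    (hψ : ∀ i, SuperWavelet.IsBessel (SuperWavelet.affineSystem A (ψ i))) :
    List.TFAE [
      SuperWavelet.IsParsevalFrame (SuperWavelet.superAffineSystem A (WithLp.toLp 2 ψ)),
      SuperWavelet.IsParsevalFrame (SuperWavelet.superQuasiAffineSystem A (WithLp.toLp 2 ψ)),
      SuperWavelet.DiagonalEquation A ψ ∧ SuperWavelet.OffDiagonalEquation A ψ] := by
  rcases eq_or_ne d 0 with rfl | hd
  · exact SuperWavelet.tfae_of_dimension_zero hψ
  · have hB := SuperWavelet.isExpandingLattice_of_isExpansive hd hexp hint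
    rw [SuperWavelet.isParsevalFrame_superAffineSystem_iff hd hB hψ,
      SuperWavelet.isParsevalFrame_superQuasiAffineSystem_iff hd hB hψ]
    tfae_finish
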